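/- Let $\mathfrak g=V_1\oplus\cdots\oplus V_s$ be a finite-dimensional real Lie algebra that is stratified, i.e. $[V_1,V_i]=V_{i+1}$ for $1\le i\le s-1$ and $[V_1,V_s]=0$. Let $\mathcal G$ be the connected, simply connected nilpotent Lie group with Lie algebra $\mathfrak g$. Fix a basis $X_1,\dots,X_N$ of $\mathfrak g$ adapted to the stratification, with $X_1,\dots,X_n$ a basis of $V_1$, and identify $\mathcal G$ with $\mathbb R^N$ through the exponential coordinates $(x_1,\dots,x_N)\mapsto\exp(x_1X_1+\cdots+x_NX_N)$, so that the group law is given by the Baker–Campbell–Hausdorff formula. Let $|\cdot|$ and $dg$ denote Lebesgue measure on $\mathbb R^N$ (a Haar measure of $\mathcal G$). Let $d$ be the Carnot–Carathéodory metric of the left-invariant vector fields $X_1,\dots,X_n$: $d(g,g')$ is the infimum of those $T>0$ for which there is an absolutely continuous curve $\gamma:[0,T]\to\mathcal G$ from $g$ to $g'$ such that for almost every $t$ one has $\gamma'(t)=\sum_{j\le n}a_jX_j(\gamma(t))$ for some $a_1,\dots,a_n\in\mathbb R$ with $\sum_j a_j^2\le 1$. Write $B=B(g,r)$ for the open ball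 of $d$ with centre $g$ and radius $r_B=r>0$. For a locally integrable real- or complex-valued function $f$ on $\mathcal G$ and a ball $B$ put $$f_B=\frac1{|B|}\int_B f(g)\,dg,\qquad M(f,B)=\frac1{|B|}\int_B|f(g)-f_B|\,dg .$$ Let $\mathrm{BMO}(\mathcal G)$ be the space of all locally integrable $f$ with $\|f\|_{\mathrm{BMO}(\mathcal G)}=\sup_B M(f,B)<\infty$, and let $\mathrm{VMO}(\mathcal G)$ be the closure of $C_0^\infty(\mathcal G)$, the smooth compactly supported functions, in $\mathrm{BMO}(\mathcal G)$ with respect to this (semi)norm. **Theorem.** Let $f\in\mathrm{BMO}(\mathcal G)$. Then $f\in\mathrm{VMO}(\mathcal G)$ if and only if $f$ satisfies the following three conditions: (i) $\displaystyle\lim_{a\to0^+}\ \sup_{r_B=a}M(f,B)=0$; (ii) $\displaystyle\lim_{a\to\infty}\ \sup_{r_B=a}M(f,B)=0$; (iii) $\displaystyle\lim_{r\to\infty}\ \sup_{B\subset\mathcal G\setminus B(0,r)}M(f,B)=0$. -/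

import Mathlib

open MeasureTheory Filter Topology
open scoped ENNReal ContDiff

/-- A stratification `𝔤 = V 1 ⊕ ⋯ ⊕ V step` of a real Lie algebra: `[V 1, V i] = V (i + 1)` for
`1 ≤ i < step`, and `[V 1, V step] = 0`. (Only the values `V 1, …, V step` are used.) -/
structure Stratification (𝔤 : Type*) [LieRing 𝔤] [LieAlgebra ℝ 𝔤] where
  step : ℕ
  V : ℕ → Submodule ℝ 𝔤
  internal : DirectSum.IsInternal (fun i : Fin step => V (i + 1))
  bracket_eq : ∀ i, 1 ≤ i → i < step →
    Submodule.span ℝ {z : 𝔤 | ∃ x ∈ V 1, ∃ y ∈ V i, ⁅x, y⁆ = z} = V (i + 1)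
  bracket_top : ∀ x ∈ V 1, ∀ y ∈ V step, ⁅x, y⁆ = 0

/-- A basis of `𝔤` adapted to a stratification: each basis vector lies in one of the layers.
The basis vectors of layer `j` then form a basis of `V j`. -/
structure AdaptedBasis {𝔤 : Type*} [LieRing 𝔤] [LieAlgebra ℝ 𝔤] (S : Stratification 𝔤)
    (ι : Type*) where
  X : Module.Basis ι ℝ 𝔤
  layer : ι → ℕ
  one_le_layer : ∀ i, 1 ≤ layer i
  layer_le : ∀ i, layer i ≤ S.step
  mem : ∀ i, X i ∈ S.V (layer i)

section GroupLaw

variable {𝔤 : Type*} [LieRing 𝔤] [LieAlgebra ℝ 𝔤]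

/-- `exp (ad x)`. In a nilpotent Lie algebra `ad x` is nilpotent, so the terms of degree
`≥ dim 𝔤` of the exponential series vanish. -/
noncomputable def expAd (x : 𝔤) : Module.End ℝ 𝔤 :=
  ∑ k ∈ Finset.range (Module.finrank ℝ 𝔤 + 1),
    ((k.factorial : ℝ)⁻¹) • (LieAlgebra.ad ℝ 𝔤 x) ^ k

/-- The power series `ψ(A) = A log A / (A - 1) = 1 + ∑_{m ≥ 1} (-1)^(m+1) / (m (m+1)) (A - 1)^m`,
for `A` with `A - 1` nilpotent (so that the terms with `m ≥ dim 𝔤` vanish). -/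
noncomputable def bchPsi (A : Module.End ℝ 𝔤) : Module.End ℝ 𝔤 :=
  1 + ∑ m ∈ Finset.Icc 1 (Module.finrank ℝ 𝔤),
    ((-1 : ℝ) ^ (m + 1) / ((m : ℝ) * ((m : ℝ) + 1))) • (A - 1) ^ m

variable {ι : Type*} [Fintype ι]

/-- The group law on `ℝ^ι`, the simply connected nilpotent Lie group with Lie algebra `𝔤` written
in the exponential coordinates `x ↦ exp (∑ i, x i • X i)`. It is given by the
Baker-Campbell-Hausdorff formula
`log (exp x exp y) = x + ∫_0^1 ψ(exp (ad x) exp (t ad y)) y dt`. -/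
noncomputable def groupMul (X : Module.Basis ι ℝ 𝔤) (x y : ι → ℝ) : ι → ℝ :=
  x + ∫ t in (0 : ℝ)..1, X.equivFun
    (bchPsi (expAd (X.equivFun.symm x) * expAd (t • X.equivFun.symm y)) (X.equivFun.symm y))

/-- The value at `g` of the left-invariant vector field `X i`, that is, the velocity at time `0`
of the curve `t ↦ g ∘ exp (t X i)`. -/
noncomputable def leftField (X : Module.Basis ι ℝ 𝔤) (i : ι) (g : ι → ℝ) : ι → ℝ :=
  deriv (fun t : ℝ => groupMul X g (t • X.equivFun (X i))) 0

variable {S : Stratification 𝔤} (b : AdaptedBasis S ι)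

/-- `γ : [0, T] → ℝ^ι` is subunit (horizontal of speed at most one): it is absolutely continuous
and for almost every `t` one has `γ' t = ∑ a i • X i (γ t)` with `∑ (a i)^2 ≤ 1`, both sums being
over the basis vectors of the first layer. -/
def IsSubunit (γ : ℝ → ι → ℝ) (T : ℝ) : Prop :=
  AbsolutelyContinuousOnInterval γ 0 T ∧
    ∀ᵐ t ∂(volume.restrict (Set.Icc 0 T)), ∃ a : ι → ℝ,
      ∑ i with b.layer i = 1, a i ^ 2 ≤ 1 ∧
      HasDerivAt γ (∑ i with b.layer i = 1, a i • leftField b.X i (γ t)) t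

/-- The Carnot-Carathéodory distance associated to the basis vectors of the first layer
(as an extended number: `⊤` if no subunit curve joins the points). -/
noncomputable def ccDist (g g' : ι → ℝ) : ℝ≥0∞ :=
  ⨅ (T : ℝ) (_ : 0 < T) (_ : ∃ γ : ℝ → ι → ℝ, IsSubunit b γ T ∧ γ 0 = g ∧ γ T = g'),
    ENNReal.ofReal T

/-- The open Carnot-Carathéodory ball `B(g, r)`. -/
def ccBall (g : ι → ℝ) (r : ℝ) : Set (ι → ℝ) :=
  {g' | ccDist b g g' < ENNReal.ofReal r}

end GroupLaw

section MeanOscillation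

variable {ι : Type*} [Fintype ι] {𝕜 : Type*} [RCLike 𝕜]

/-- The mean oscillation `M(f, B) = |B|⁻¹ ∫_B |f - f_B|`, with values in `[0, ∞]`. -/
noncomputable def meanOsc (f : (ι → ℝ) → 𝕜) (B : Set (ι → ℝ)) : ℝ≥0∞ :=
  ⨍⁻ g in B, ‖f g - ⨍ g' in B, f g' ∂volume‖ₑ ∂volume

variable {𝔤 : Type*} [LieRing 𝔤] [LieAlgebra ℝ 𝔤] {S : Stratification 𝔤} (b : AdaptedBasis S ι)

/-- The BMO seminorm `sup_B M(f, B)`, over all Carnot-Carathéodory balls. -/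
noncomputable def bmoNorm (f : (ι → ℝ) → 𝕜) : ℝ≥0∞ :=
  ⨆ (g : ι → ℝ) (r : ℝ) (_ : 0 < r), meanOsc f (ccBall b g r)

def MemBMO (f : (ι → ℝ) → 𝕜) : Prop :=
  LocallyIntegrable f volume ∧ bmoNorm b f < ⊤

/-- `f` belongs to the closure in BMO of the smooth compactly supported functions. -/
def MemVMO (f : (ι → ℝ) → 𝕜) : Prop :=
  MemBMO b f ∧ ∀ ε : ℝ≥0∞, 0 < ε → ∃ h : (ι → ℝ) → 𝕜,
    ContDiff ℝ ∞ h ∧ HasCompactSupport h ∧ bmoNorm b (f - h) < ε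

end MeanOscillation

/-! The forward direction is soft. A continuous compactly supported function has small oscillation
on small balls (uniform continuity), on large balls (its integral is finite and volumes grow) and
none far away. A BMO-small perturbation preserves these three properties.

For the converse, let `f` oscillate by at most `ε` on balls of radius `< δ`, of radius `≥ R`, or
missing `B(0, R)`. Take a radial cutoff `χ`, equal to `1` on `B(0, 3R)` and to `0` off `B(0, 6R)`,
let `m` be the mean of `f` over `B(0, 6R)`, and put `g = χ (f - m)`. Then `f - g` is constant where
`χ = 1` and equals `f` where `χ = 0`. On a transition ball of radius `r` the mean of `f` may drift
from `m` by about `ε log (R / r)`, but `χ` varies only by about `r / R`, and the product is `O(ε)`.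
Hence `f - g` has BMO seminorm `O(ε)` (`IsBallRegular.meanOscillation_sub_cutoffSub_le`), and `g`
oscillates by `O(ε)` on small balls. Averaging `g` over balls of radius `δ / 3` therefore costs
`O(ε)` in BMO (`IsBallRegular.meanOscillation_sub_setAverage_ball_le`) and gives a continuous
compactly supported function. A uniform smooth approximation finishes, since the seminorm is at most
twice the sup norm.

All this needs only a proper metric space whose balls of radius `r` have measure `c r ^ Q`. To reach
that setting from the Baker–Campbell–Hausdorff definition, `𝔤` is represented faithfully by
nilpotent operators on `𝔤 ⊕ ℝ D`. Differentiating the logarithm of a product of exponentials shows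
that the group law becomes operator multiplication (`AdaptedBasis.expRep_groupMul`). This yields
associativity, smoothness, left invariance of Lebesgue measure and dilations by automorphisms. A
Chow argument makes the distance finite; homogeneity then gives the topology, properness and the
volume of balls. -/

set_option linter.unusedSectionVars false

/-! ### Truncated logarithm series in a commutative algebra. -/

section NilpotentLogarithm

/-- The logarithm series `∑ (-1)^m / (m + 1) N^(m+1)` of `1 + N`, truncated at order `n`. -/
noncomputable def nilLog {R : Type*} [Ring R] [Algebra ℝ R] (n : ℕ) (N : R) : R :=
  ∑ m ∈ Finset.range n, ((-1 : ℝ) ^ m / ((m : ℝ) + 1)) • N ^ (m + 1)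

/-- The divided difference `(nilLog n l - nilLog n r) / (l - r)`. -/
noncomputable def nilLogDiff {R : Type*} [Ring R] [Algebra ℝ R] (n : ℕ) (l r : R) : R :=
  ∑ m ∈ Finset.range n, ((-1 : ℝ) ^ m / ((m : ℝ) + 1)) •
    ∑ i ∈ Finset.range (m + 1), l ^ i * r ^ (m - i)

/-- The series `log (1 + w) / w`. -/
noncomputable def nilLogQuot {R : Type*} [Ring R] [Algebra ℝ R] (n : ℕ) (w : R) : R :=
  ∑ m ∈ Finset.range n, ((-1 : ℝ) ^ m / ((m : ℝ) + 1)) • w ^ m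

variable {C : Type*} [CommRing C]

/-- The inner sums are the complete homogeneous polynomials `h_m(a, b)`. The recursion `h_{m+1} = a
h_m + b^{m+1}` makes the sum telescope; the second term on the left is the truncation error. -/
theorem one_sub_mul_sum_complete (a b : C) (M : ℕ) :
    (1 - a) * (∑ m ∈ Finset.range (M + 1), ∑ i ∈ Finset.range (m + 1), a ^ i * b ^ (m - i)) +
      a * ∑ i ∈ Finset.range (M + 1), a ^ i * b ^ (M - i) =
      ∑ m ∈ Finset.range (M + 1), b ^ m := by
  induction M with
  | zero => simp
  | succ M ih =>
    have h1 : ∑ i ∈ Finset.range (M + 2), a ^ i * b ^ (M + 1 - i) =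
        a * (∑ i ∈ Finset.range (M + 1), a ^ i * b ^ (M - i)) + b ^ (M + 1) := by
      rw [Finset.sum_range_succ', Finset.mul_sum]
      simp [pow_succ', mul_assoc]
    rw [Finset.sum_range_succ _ (M + 1), Finset.sum_range_succ (fun m => b ^ m) (M + 1), ← ih, h1]
    ring

theorem sum_complete_eq_zero {a b : C} {n m : ℕ} (ha : a ^ n = 0) (hb : b ^ n = 0)
    (hm : 2 * n ≤ m) : ∑ i ∈ Finset.range (m + 1), a ^ i * b ^ (m - i) = 0 := by
  refine Finset.sum_eq_zero fun i hi => ?_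
  rw [Finset.mem_range] at hi
  rcases le_total n i with h | h
  · rw [pow_eq_zero_of_le h ha, zero_mul]
  · rw [pow_eq_zero_of_le (by omega : n ≤ m - i) hb, mul_zero]

/-- From degree `2 n` on, every monomial contains an `n`-th power, so the truncated generating
series of the `h_m` has no error. -/
theorem one_sub_mul_one_sub_mul_sum {a b : C} {n M : ℕ} (ha : a ^ n = 0) (hb : b ^ n = 0)
    (hM : 2 * n < M) :
    (1 - a) * (1 - b) *
      (∑ m ∈ Finset.range M, ∑ i ∈ Finset.range (m + 1), a ^ i * b ^ (m - i)) = 1 := by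
  obtain ⟨M, rfl⟩ : ∃ k, M = k + 1 := ⟨M - 1, by omega⟩
  have h := one_sub_mul_sum_complete a b M
  rw [sum_complete_eq_zero ha hb (by omega), mul_zero, add_zero] at h
  rw [mul_right_comm, h, geom_sum_mul_neg, pow_eq_zero_of_le (by omega) hb, sub_zero]

variable [Algebra ℝ C]

theorem Polynomial.eq_of_derivative_eq_of_coeff_zero {p q : Polynomial C}
    (h : derivative p = derivative q) (h0 : p.coeff 0 = q.coeff 0) : p = q := by
  ext k
  rcases k with _ | k
  · exact h0
  · have := congrArg (fun p => p.coeff k) h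
    simp only [Polynomial.coeff_derivative] at this
    have h2 : ((k : ℝ) + 1) • p.coeff (k + 1) = ((k : ℝ) + 1) • q.coeff (k + 1) := by
      simp only [Algebra.smul_def, map_add, map_natCast, map_one]
      rw [mul_comm, this, mul_comm]
    exact smul_right_injective C (by positivity : (k : ℝ) + 1 ≠ 0) h2

-- The relation says `1 + l = (1 + w) (1 + r)`, so the claim is `log (1 + l) - log (1 + r) = log (1
-- + w)` divided by `l - r`. Since nilpotents cannot be divided by, `l` and `r` are replaced by `l
-- X` and `r X`. Both sides, divided by `1 + r`, become polynomials in `X` without constant term and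
-- with derivative `1 / ((1 + l X) (1 + r X))`; then `X = 1`.
open Polynomial in
theorem nilLogDiff_mul_one_add {l r w : C} {n K M : ℕ} (hl : l ^ n = 0) (hr : r ^ n = 0)
    (hw : w ^ K = 0) (h : w * (1 + r) = l - r) (hM : 2 * n < M) :
    nilLogDiff M l r * (1 + r) = nilLogQuot K w := by
  set c : ℕ → ℝ := fun m => (-1 : ℝ) ^ m / ((m : ℝ) + 1) with hc
  have hcm : ∀ m : ℕ, c m * ((m : ℝ) + 1) = (-1) ^ m := fun m => by
    rw [hc]; field_simp
  set s : ℕ → C := fun m => ∑ i ∈ Finset.range (m + 1), l ^ i * r ^ (m - i) with hs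
  set A : C[X] := Polynomial.C l with hA
  set B : C[X] := Polynomial.C r with hB
  -- This is `X / (1 + r X)`, written as a finite geometric series.
  set q : C[X] := X * ∑ k ∈ Finset.range n, (-(B * X)) ^ k with hq
  have hBn : (-(B * X)) ^ n = 0 := by
    rw [neg_pow, mul_pow, hB, ← C_pow, hr]; simp
  have hAn : (-(A * X)) ^ n = 0 := by
    rw [neg_pow, mul_pow, hA, ← C_pow, hl]; simp
  have hq1 : q * (1 + B * X) = X := by
    have := geom_sum_mul_neg (-(B * X)) n
    rw [hBn, sub_neg_eq_add, sub_zero] at this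
    rw [hq, mul_assoc, this, mul_one]
  set D : C[X] := A - B with hD
  have hDK : (q * D) ^ K = 0 := by
    rw [mul_pow, hD, hA, hB, ← C_sub, ← C_pow, ← h, mul_pow w, hw]; simp
  have hq0 : q.coeff 0 = 0 := by simp [hq]
  clear_value q
  -- Formally `K1 = (log (1 + l X) - log (1 + r X)) / (l - r)` and `K2 = log (1 + q D) / D`.
  set K1 : C[X] := ∑ m ∈ Finset.range M, c m • (Polynomial.C (s m) * X ^ (m + 1)) with hK1
  set K2 : C[X] := ∑ m ∈ Finset.range K, c m • (D ^ m * q ^ (m + 1)) with hK2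
  have hdX : derivative q * (1 + B * X) + q * B = 1 := by
    have := congrArg derivative hq1
    simpa [derivative_mul, hB] using this
  have hd2 : derivative q * (1 + B * X) ^ 2 = 1 := by
    linear_combination (1 + B * X) * hdX - B * hq1
  have hdD : derivative D = 0 := by simp [hD, hA, hB]
  have hD1 : derivative K1 * ((1 + A * X) * (1 + B * X)) = 1 := by
    have e : derivative K1 = ∑ m ∈ Finset.range M, ∑ i ∈ Finset.range (m + 1),
        (-(A * X)) ^ i * (-(B * X)) ^ (m - i) := by
      rw [hK1, derivative_sum]
      refine Finset.sum_congr rfl fun m _ => ?_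
      rw [derivative_smul, derivative_C_mul, derivative_X_pow, hs]
      simp only [map_sum, Finset.sum_mul, Finset.smul_sum]
      refine Finset.sum_congr rfl fun i hi => ?_
      have hi' : i + (m - i) = m := by rw [Finset.mem_range] at hi; omega
      have e1 : (-(A * X)) ^ i * (-(B * X)) ^ (m - i) =
          algebraMap ℝ C[X] ((-1) ^ m) * (A ^ i * B ^ (m - i) * X ^ m) := by
        rw [neg_pow, neg_pow (B * X), mul_pow, mul_pow]
        have : (X : C[X]) ^ m = X ^ i * X ^ (m - i) := by rw [← pow_add, hi']
        have h3 : algebraMap ℝ C[X] ((-1) ^ m) = (-1) ^ i * (-1) ^ (m - i) := by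
          rw [← pow_add, hi']; simp
        rw [this, h3]; ring
      rw [e1, ← hcm m, Algebra.smul_def]
      simp only [map_mul, map_add, map_natCast, map_one, C_pow, Nat.cast_add, Nat.cast_one,
        Nat.add_sub_cancel]
      ring
    rw [e, mul_comm]
    have := one_sub_mul_one_sub_mul_sum hAn hBn hM
    simpa only [sub_neg_eq_add] using this
  have hD2 : derivative K2 * ((1 + A * X) * (1 + B * X)) = 1 := by
    have e : derivative K2 = derivative q * ∑ m ∈ Finset.range K, (-(q * D)) ^ m := by
      rw [hK2, derivative_sum, Finset.mul_sum]
      refine Finset.sum_congr rfl fun m _ => ?_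
      have hDm : derivative (D ^ m) = 0 := by rw [derivative_pow, hdD, mul_zero]
      rw [derivative_smul, derivative_mul, hDm, zero_mul, zero_add, derivative_pow,
        neg_pow, mul_pow]
      have h3 : ((-1 : C[X])) ^ m = algebraMap ℝ C[X] ((-1) ^ m) := by simp
      rw [h3, ← hcm m, Algebra.smul_def]
      simp only [map_mul, map_add, map_natCast, map_one, Nat.cast_add, Nat.cast_one,
        Nat.add_sub_cancel]
      ring
    have e2 : (∑ m ∈ Finset.range K, (-(q * D)) ^ m) * (1 + q * D) = 1 := by
      have := geom_sum_mul_neg (-(q * D)) K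
      rwa [neg_pow (q * D) K, hDK, mul_zero, sub_zero, sub_neg_eq_add] at this
    have e3 : (1 + q * D) * (1 + B * X) = 1 + A * X := by
      rw [hD]; linear_combination (A - B) * hq1
    rw [e, ← e3]
    linear_combination (derivative q * (1 + B * X) ^ 2) * e2 + hd2
  have hK : K1 = K2 := by
    apply Polynomial.eq_of_derivative_eq_of_coeff_zero
    · calc derivative K1 = derivative K1 * (derivative K2 * ((1 + A * X) * (1 + B * X))) := by
            rw [hD2, mul_one]
        _ = derivative K2 * (derivative K1 * ((1 + A * X) * (1 + B * X))) := by ring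
        _ = derivative K2 := by rw [hD1, mul_one]
    · rw [Polynomial.coeff_zero_eq_eval_zero] at hq0
      simp [hK1, hK2, hq0, Polynomial.coeff_zero_eq_eval_zero, Polynomial.eval_finsetSum]
  have hev := congrArg (Polynomial.eval 1) hK
  have hq2 : q.eval 1 * (1 + r) = 1 := by
    have := congrArg (Polynomial.eval 1) hq1
    simpa [hB] using this
  have e1 : K1.eval 1 = nilLogDiff M l r := by
    simp [hK1, nilLogDiff, Polynomial.eval_finsetSum, hs, hc]
  have e2 : K2.eval 1 * (1 + r) = nilLogQuot K w := by
    have hDw : q.eval 1 * D.eval 1 = w := by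
      simp only [hD, hA, hB, eval_sub, eval_C]
      rw [← h, mul_comm w, ← mul_assoc, hq2, one_mul]
    simp only [hK2, nilLogQuot, Polynomial.eval_finsetSum, Finset.sum_mul, Polynomial.eval_smul,
      Polynomial.eval_mul, Polynomial.eval_pow, ← hDw]
    refine Finset.sum_congr rfl fun m _ => ?_
    rw [smul_mul_assoc, mul_pow]
    congr 1
    linear_combination (eval 1 D ^ m * eval 1 q ^ m) * hq2
  rw [← e1, hev, e2]

end NilpotentLogarithm

/-! ### Logarithms of commuting nilpotent elements. -/

section NilpotentLogarithmCommuting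

variable {C : Type*} [CommRing C] [Algebra ℝ C]

/-- The term of index `0` is `1`; the others have positive degree in `l` and `r`, hence are
nilpotent. -/
theorem isUnit_nilLogDiff {l r : C} {M : ℕ} (hl : IsNilpotent l) (hr : IsNilpotent r)
    (hM : 0 < M) : IsUnit (nilLogDiff M l r) := by
  obtain ⟨M, rfl⟩ : ∃ k, M = k + 1 := ⟨M - 1, by omega⟩
  rw [nilLogDiff, Finset.sum_range_succ']
  have h1 : ((-1 : ℝ) ^ 0 / (((0 : ℕ) : ℝ) + 1)) • ∑ i ∈ Finset.range (0 + 1), l ^ i * r ^ (0 - i) =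
      (1 : C) := by simp
  rw [h1, add_comm]
  refine IsNilpotent.isUnit_one_add ?_
  rw [← mem_nilradical] at *
  refine sum_mem fun m _ => ?_
  rw [Algebra.smul_def]
  refine Ideal.mul_mem_left _ _ (sum_mem fun i _ => ?_)
  rcases Nat.eq_zero_or_pos i with h | h
  · subst h
    simpa using Ideal.pow_mem_of_mem _ hr (m + 1) (by omega)
  · exact Ideal.mul_mem_right _ _ (Ideal.pow_mem_of_mem _ hl i h)

theorem mul_nilLogDiff (l r : C) (M : ℕ) :
    nilLogDiff M l r * (l - r) = nilLog M l - nilLog M r := by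
  rw [nilLogDiff, nilLog, nilLog, ← Finset.sum_sub_distrib, Finset.sum_mul]
  refine Finset.sum_congr rfl fun m _ => ?_
  rw [smul_mul_assoc, ← smul_sub]
  congr 1
  have := (Commute.all l r).geom_sum₂_mul (m + 1)
  simpa using this

/-- The difference of the two logarithms is `l - r` times a unit. -/
theorem nilLog_injective_of_isNilpotent {l r : C} {M : ℕ} (hl : IsNilpotent l)
    (hr : IsNilpotent r) (hM : 0 < M) (h : nilLog M l = nilLog M r) : l = r := by
  have h1 := mul_nilLogDiff l r M
  rw [h, sub_self, (isUnit_nilLogDiff hl hr hM).mul_right_eq_zero] at h1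
  exact sub_eq_zero.1 h1

variable {R S : Type*} [Ring R] [Algebra ℝ R] [Ring S] [Algebra ℝ S]

theorem map_nilLog (f : R →ₐ[ℝ] S) (n : ℕ) (N : R) : f (nilLog n N) = nilLog n (f N) := by
  simp [nilLog]

theorem map_nilLogDiff (f : R →ₐ[ℝ] S) (n : ℕ) (l r : R) :
    f (nilLogDiff n l r) = nilLogDiff n (f l) (f r) := by
  simp [nilLogDiff]

theorem map_nilLogQuot (f : R →ₐ[ℝ] S) (n : ℕ) (w : R) :
    f (nilLogQuot n w) = nilLogQuot n (f w) := by
  simp [nilLogQuot]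

/-- The commutative case applies inside the subalgebra generated by the three commuting elements. -/
theorem nilLogDiff_mul_one_add_of_commute {l r w : R} {n K M : ℕ} (hlr : Commute l r)
    (hlw : Commute l w) (hrw : Commute r w) (hl : l ^ n = 0) (hr : r ^ n = 0)
    (hw : w ^ K = 0) (h : w * (1 + r) = l - r) (hM : 2 * n < M) :
    nilLogDiff M l r * (1 + r) = nilLogQuot K w := by
  have hc : ∀ a ∈ ({l, r, w} : Set R), ∀ b ∈ ({l, r, w} : Set R), a * b = b * a := by
    rintro a (rfl | rfl | rfl) b (rfl | rfl | rfl) <;>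
      first | rfl | exact hlr | exact hlw | exact hrw | exact hlr.symm | exact hlw.symm |
        exact hrw.symm
  let _ : CommRing (Algebra.adjoin ℝ ({l, r, w} : Set R)) :=
    { Subalgebra.toRing _ with
      mul_comm := (Algebra.isMulCommutative_adjoin ℝ hc).is_comm.comm }
  let f : Algebra.adjoin ℝ ({l, r, w} : Set R) →ₐ[ℝ] R := Subalgebra.val _
  have hf : Function.Injective f := Subtype.val_injective
  have := nilLogDiff_mul_one_add (l := (⟨l, Algebra.subset_adjoin (by simp)⟩ :
    Algebra.adjoin ℝ ({l, r, w} : Set R))) (r := ⟨r, Algebra.subset_adjoin (by simp)⟩)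
    (w := ⟨w, Algebra.subset_adjoin (by simp)⟩) (n := n) (K := K) (M := M)
    (Subtype.ext hl) (Subtype.ext hr) (Subtype.ext hw) (Subtype.ext h) hM
  have := congrArg f this
  rw [map_mul, map_nilLogDiff, map_nilLogQuot] at this
  exact this

theorem nilLog_injective_of_commute {l r : R} {M : ℕ} (hlr : Commute l r) (hl : IsNilpotent l)
    (hr : IsNilpotent r) (hM : 0 < M) (h : nilLog M l = nilLog M r) : l = r := by
  have hc : ∀ a ∈ ({l, r} : Set R), ∀ b ∈ ({l, r} : Set R), a * b = b * a := by
    rintro a (rfl | rfl) b (rfl | rfl) <;> first | rfl | exact hlr | exact hlr.symm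
  let _ : CommRing (Algebra.adjoin ℝ ({l, r} : Set R)) :=
    { Subalgebra.toRing _ with
      mul_comm := (Algebra.isMulCommutative_adjoin ℝ hc).is_comm.comm }
  let f : Algebra.adjoin ℝ ({l, r} : Set R) →ₐ[ℝ] R := Subalgebra.val _
  have hf : Function.Injective f := Subtype.val_injective
  let l' : Algebra.adjoin ℝ ({l, r} : Set R) := ⟨l, Algebra.subset_adjoin (by simp)⟩
  let r' : Algebra.adjoin ℝ ({l, r} : Set R) := ⟨r, Algebra.subset_adjoin (by simp)⟩
  have := nilLog_injective_of_isNilpotent (l := l') (r := r') (M := M)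
    (by obtain ⟨n, hn⟩ := hl; exact ⟨n, Subtype.ext hn⟩)
    (by obtain ⟨n, hn⟩ := hr; exact ⟨n, Subtype.ext hn⟩) hM
    (hf (by rw [map_nilLog, map_nilLog]; exact h))
  exact congrArg f this

/-- The right side is the series of `bchPsi`, that is `A log A / (A - 1)` at `A = 1 + w`. Its
coefficients come from `1 / m - 1 / (m + 1) = 1 / (m (m + 1))`, and `hw` removes the top term. -/
theorem one_add_mul_nilLogQuot {w : R} {K : ℕ} (hw : w ^ (K + 1) = 0) :
    (1 + w) * nilLogQuot (K + 1) w =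
      1 + ∑ m ∈ Finset.Icc 1 K, ((-1 : ℝ) ^ (m + 1) / ((m : ℝ) * ((m : ℝ) + 1))) • w ^ m := by
  have e : ∀ L : ℕ, (1 + w) * nilLogQuot (L + 1) w =
      1 + ∑ m ∈ Finset.Icc 1 L, ((-1 : ℝ) ^ (m + 1) / ((m : ℝ) * ((m : ℝ) + 1))) • w ^ m +
        ((-1 : ℝ) ^ L / ((L : ℝ) + 1)) • w ^ (L + 1) := by
    intro L
    induction L with
    | zero => simp [nilLogQuot]
    | succ L ih =>
      rw [nilLogQuot, Finset.sum_range_succ, mul_add]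
      change (1 + w) * nilLogQuot (L + 1) w + _ = _
      have h0 : ((-1 : ℝ) ^ (L + 1 + 1) / (((L + 1 : ℕ) : ℝ) * (((L + 1 : ℕ) : ℝ) + 1))) =
          ((-1 : ℝ) ^ L / ((L : ℝ) + 1)) + ((-1 : ℝ) ^ (L + 1) / (((L + 1 : ℕ) : ℝ) + 1)) := by
        push_cast
        field_simp
        ring
      rw [ih, Finset.sum_Icc_succ_top (by omega), add_mul, one_mul, mul_smul_comm, ← pow_succ',
        h0, add_smul]
      abel
  rw [e K, hw, smul_zero, add_zero]

theorem nilLogQuot_eq_of_le {w : R} {K L : ℕ} (hw : w ^ K = 0) (h : K ≤ L) :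
    nilLogQuot L w = nilLogQuot K w := by
  symm
  refine Finset.sum_subset (Finset.range_mono h) fun m _ hm => ?_
  rw [pow_eq_zero_of_le (by simpa using hm) hw, smul_zero]

theorem commute_nilLog {a N : R} (n : ℕ) (h : Commute a N) : Commute a (nilLog n N) :=
  Commute.sum_right _ _ _ fun _ _ => (h.pow_right _).smul_right _

theorem nilLog_pow_eq_zero {N : R} (M : ℕ) {n : ℕ} (h : N ^ n = 0) : nilLog M N ^ n = 0 := by
  have e : nilLog M N = N * nilLogQuot M N := by
    simp [nilLog, nilLogQuot, Finset.mul_sum, pow_succ']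
  have hc : Commute N (nilLogQuot M N) :=
       Commute.sum_right _ _ _ fun _ _ => ((Commute.refl N).pow_right _).smul_right _
  rw [e, hc.mul_pow, h, zero_mul]

end NilpotentLogarithmCommuting

/-! ### Exponential and logarithm in a Banach algebra. -/

section BanachAlgebra

variable {𝔸 : Type*} [NormedRing 𝔸] [NormedAlgebra ℝ 𝔸] [CompleteSpace 𝔸]

theorem exp_eq_sum_range {X : 𝔸} {n : ℕ} (h : X ^ n = 0) :
    NormedSpace.exp X = ∑ k ∈ Finset.range n, ((k.factorial : ℝ)⁻¹) • X ^ k := by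
  refine (NormedSpace.exp_series_hasSum_exp' (𝕂 := ℝ) X).unique ?_
  refine hasSum_sum_of_ne_finset_zero fun k hk => ?_
  rw [pow_eq_zero_of_le (by simpa using hk) h, smul_zero]

theorem exp_mul_exp_neg_eq_one (X : 𝔸) :
    NormedSpace.exp X * NormedSpace.exp (-X) = 1 := by
  let _ : NormedAlgebra ℚ 𝔸 := NormedAlgebra.restrictScalars ℚ ℝ 𝔸
  rw [← NormedSpace.exp_add_of_commute ((Commute.refl _).neg_right)]
  simp [NormedSpace.exp_zero]

theorem exp_neg_mul_exp_eq_one (X : 𝔸) :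
    NormedSpace.exp (-X) * NormedSpace.exp X = 1 := by
  simpa using exp_mul_exp_neg_eq_one (-X)

theorem exists_exp_sub_one_eq_mul {X : 𝔸} (h : IsNilpotent X) :
    ∃ Y, Commute X Y ∧ NormedSpace.exp X - 1 = X * Y := by
  obtain ⟨n, hn⟩ := h
  refine ⟨∑ k ∈ Finset.range n, (((k + 1).factorial : ℝ)⁻¹) • X ^ k, ?_, ?_⟩
  · exact Commute.sum_right _ _ _ fun _ _ => ((Commute.refl X).pow_right _).smul_right _
  · rw [exp_eq_sum_range (n := n + 1) (by rw [pow_succ, hn, zero_mul]), Finset.sum_range_succ']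
    simp [Finset.mul_sum, pow_succ']

theorem exp_sub_one_pow_eq_zero {X : 𝔸} {n : ℕ} (h : X ^ n = 0) :
    (NormedSpace.exp X - 1) ^ n = 0 := by
  obtain ⟨Y, hY, e⟩ := exists_exp_sub_one_eq_mul ⟨n, h⟩
  rw [e, hY.mul_pow, h, zero_mul]

/-- `N'` need not commute with `N`, so powers differentiate to `∑ N^i N' N^(m-i)`. This is a divided
difference in left and right multiplication by `N`, and these two operators do commute. -/
theorem hasDerivAt_nilLog {N : ℝ → 𝔸} {N' : 𝔸} {t : ℝ} (h : HasDerivAt N N' t) (M : ℕ) :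
    HasDerivAt (fun s => nilLog M (N s))
      (nilLogDiff M (LinearMap.mulLeft ℝ (N t)) (LinearMap.mulRight ℝ (N t)) N') t := by
  have h1 : ∀ m ∈ Finset.range M, HasDerivAt
      (fun s => ((-1 : ℝ) ^ m / ((m : ℝ) + 1)) • (N s) ^ (m + 1)) _ t := fun m _ =>
    (h.fun_pow' (m + 1)).const_smul ((-1 : ℝ) ^ m / ((m : ℝ) + 1))
  refine (HasDerivAt.fun_sum h1).congr_deriv ?_
  simp only [nilLogDiff, LinearMap.sum_apply, LinearMap.smul_apply]
  refine Finset.sum_congr rfl fun m _ => ?_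
  congr 1
  rw [← Finset.sum_range_reflect]
  refine Finset.sum_congr rfl fun i hi => ?_
  rw [Finset.mem_range] at hi
  rw [Module.End.mul_apply, LinearMap.pow_mulLeft, LinearMap.pow_mulRight]
  simp only [LinearMap.mulLeft_apply, LinearMap.mulRight_apply, Nat.pred_succ, ← mul_assoc]
  congr 3
  omega

/-- The logarithm of a unipotent curve `U` with `U' = U Y`. -/
theorem hasDerivAt_nilLog_of_hasDerivAt_mul {U : ℝ → 𝔸} {Y V : 𝔸} {t : ℝ}
    (h : HasDerivAt U (U t * Y) t) (hUV : U t * V = 1) (hVU : V * U t = 1) {n M K : ℕ}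
    (hn : (U t - 1) ^ n = 0) (hM : 2 * n < M) {w : Module.End ℝ 𝔸}
    (hw : w = LinearMap.mulLeft ℝ (U t) * LinearMap.mulRight ℝ V - 1) (hK : w ^ K = 0) :
    HasDerivAt (fun s => nilLog M (U s - 1)) (((1 + w) * nilLogQuot K w) Y) t := by
  refine (hasDerivAt_nilLog (h.sub_const 1) M).congr_deriv ?_
  set l := LinearMap.mulLeft ℝ (U t - 1) with hl
  set r := LinearMap.mulRight ℝ (U t - 1) with hr
  have hlr : Commute l r := by
    ext T; simp [hl, hr, mul_assoc]
  have hlw : Commute l w := by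
    ext T; simp [hl, hw, mul_assoc, sub_mul, mul_sub]
  have hrw : Commute r w := by
    ext T; simp [hr, hw, mul_assoc, sub_mul, mul_sub, hUV, hVU]
  -- `1 + w` is conjugation by `U t` and `1 + r` is right multiplication by it, so their product is
  -- the left multiplication `1 + l`.
  have e : w * (1 + r) = l - r := by
    ext T; simp [hl, hr, hw, mul_assoc, sub_mul, mul_sub, hUV]
  have hl0 : l ^ n = 0 := by rw [hl, LinearMap.pow_mulLeft, hn]; ext; simp
  have hr0 : r ^ n = 0 := by rw [hr, LinearMap.pow_mulRight, hn]; ext; simp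
  have key := nilLogDiff_mul_one_add_of_commute hlr hlw hrw hl0 hr0 hK e hM
  have e1 : U t * Y = ((1 + r) * (1 + w)) Y := by
    simp [hr, hw, mul_assoc, mul_sub, hVU]
  rw [e1, ← Module.End.mul_apply, ← mul_assoc, key]
  have hc : Commute (1 + w) (nilLogQuot K w) :=
    Commute.sum_right _ _ _ fun _ _ =>
      (((Commute.one_left w).add_left (Commute.refl w)).pow_right _).smul_right _
  rw [hc.eq]

/-- Up to the commuting factor of right multiplication by `V`, this is the difference of left and
right multiplication by `U - 1`, two commuting nilpotents. -/
theorem conj_sub_one_pow_eq_zero {U V : 𝔸} (hUV : U * V = 1) {n : ℕ}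
    (hn : (U - 1) ^ n = 0) :
    (LinearMap.mulLeft ℝ U * LinearMap.mulRight ℝ V - 1 : Module.End ℝ 𝔸) ^ (2 * n) = 0 := by
  set l := LinearMap.mulLeft ℝ (U - 1) with hl
  set r := LinearMap.mulRight ℝ (U - 1) with hr
  set v := LinearMap.mulRight ℝ V with hv
  have hVU : V * U = 1 := by
    have hU : IsUnit U := by
      have : U = 1 + (U - 1) := by abel
      rw [this]; exact IsNilpotent.isUnit_one_add ⟨n, hn⟩
    obtain ⟨u, rfl⟩ := hU
    have : V = ↑u⁻¹ := by rw [← Units.mul_right_inj u]; simp [hUV]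
    rw [this]; simp
  have e : (LinearMap.mulLeft ℝ U * v - 1 : Module.End ℝ 𝔸) = (l - r) * v := by
    ext T; simp [hl, hr, hv, mul_assoc, sub_mul, mul_sub, hVU]
  have hlr : Commute l r := by
    ext T; simp [hl, hr, mul_assoc]
  have hc : Commute (l - r) v := by
    ext T; simp [hl, hr, hv, mul_assoc, sub_mul, mul_sub, hUV, hVU]
  have hl0 : l ^ n = 0 := by rw [hl, LinearMap.pow_mulLeft, hn]; ext; simp
  have hr0 : r ^ n = 0 := by rw [hr, LinearMap.pow_mulRight, hn]; ext; simp
  have h2 : (l - r) ^ (2 * n) = 0 := by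
    rw [sub_eq_add_neg]
    refine hlr.neg_right.add_pow_eq_zero_of_add_le_succ_of_pow_eq_zero hl0
      (by rw [neg_pow, hr0, mul_zero]) (by omega)
  rw [e, hc.mul_pow, h2, zero_mul]

/-- Conjugation by `exp (t X)` fixes `X`, so the logarithm of `exp (t X)` has derivative `X` and
differs from `t X` by a constant, which is `0` at `t = 0`. -/
theorem nilLog_exp {X : 𝔸} {n M : ℕ} (h : X ^ n = 0) (hM : 2 * n < M) :
    nilLog M (NormedSpace.exp X - 1) = X := by
  set U : ℝ → 𝔸 := fun t => NormedSpace.exp (t • X) with hU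
  have hX : ∀ t : ℝ, (t • X) ^ n = 0 := fun t => by rw [smul_pow, h, smul_zero]
  have hd : ∀ t, HasDerivAt (fun s => nilLog M (U s - 1)) X t := by
    intro t
    have h1 : HasDerivAt U (U t * X) t := hasDerivAt_exp_smul_const X t
    have hUV : U t * NormedSpace.exp (-(t • X)) = 1 := exp_mul_exp_neg_eq_one _
    have hVU : NormedSpace.exp (-(t • X)) * U t = 1 := exp_neg_mul_exp_eq_one _
    have hn := exp_sub_one_pow_eq_zero (hX t)
    refine (hasDerivAt_nilLog_of_hasDerivAt_mul h1 hUV hVU hn hM rfl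
      (pow_eq_zero_of_le (Nat.le_succ _) (conj_sub_one_pow_eq_zero hUV hn))).congr_deriv ?_
    set w := (LinearMap.mulLeft ℝ (U t) * LinearMap.mulRight ℝ (NormedSpace.exp (-(t • X))) - 1 :
      Module.End ℝ 𝔸)
    have hwX : w X = 0 := by
      have hc : Commute (U t) X := ((Commute.refl X).smul_left t).exp_left
      have : w X = U t * (X * NormedSpace.exp (-(t • X))) - X := rfl
      rw [this, ← mul_assoc, hc.eq, mul_assoc, hUV, mul_one, sub_self]
    have hq : nilLogQuot (2 * n + 1) w X = X := by
      rw [nilLogQuot, Finset.sum_range_succ', LinearMap.add_apply, LinearMap.sum_apply,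
        Finset.sum_eq_zero]
      · simp
      · intro m _
        rw [LinearMap.smul_apply, pow_succ w, Module.End.mul_apply, hwX, map_zero, smul_zero]
    rw [Module.End.mul_apply, hq]
    simp [hwX]
  have hconst : ∀ s t : ℝ, nilLog M (U s - 1) - s • X = nilLog M (U t - 1) - t • X := by
    refine is_const_of_deriv_eq_zero (f := fun s => nilLog M (U s - 1) - s • X) ?_ ?_
    · intro t
      exact ((hd t).sub ((hasDerivAt_id t).smul_const X)).differentiableAt
    · intro t
      exact ((hd t).fun_sub ((hasDerivAt_id t).smul_const X)).deriv.trans (by simp)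
  have := hconst 1 0
  simp only [hU, one_smul, zero_smul, NormedSpace.exp_zero, sub_self, nilLog] at this
  rw [← sub_eq_zero, nilLog, this]
  simp

/-- The elements `exp (nilLog M N) - 1` and `N` commute and have the same logarithm, which is
injective on commuting nilpotents. -/
theorem exp_nilLog {N : 𝔸} {n M : ℕ} (h : N ^ n = 0) (hM : 2 * n < M) :
    NormedSpace.exp (nilLog M N) = 1 + N := by
  have hL := nilLog_pow_eq_zero M h
  have hc : Commute (NormedSpace.exp (nilLog M N) - 1) N :=
    ((commute_nilLog M (Commute.refl N)).symm.exp_left).sub_left (Commute.one_left N)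
  rw [← sub_eq_iff_eq_add']
  exact nilLog_injective_of_commute hc ⟨n, exp_sub_one_pow_eq_zero hL⟩ ⟨n, h⟩ (by omega)
    (nilLog_exp hL hM)

end BanachAlgebra

/-! ### The grading: brackets, dilations and filtration in coordinates. -/

section Grading

variable {𝔤 : Type*} [LieRing 𝔤] [LieAlgebra ℝ 𝔤]

namespace Stratification

variable (S : Stratification 𝔤)

/-- The layers of a stratification, extended by `0` beyond the step. -/
def layer (k : ℕ) : Submodule ℝ 𝔤 := if k ≤ S.step then S.V k else ⊥

variable {S}

theorem lie_mem_layer_succ {j : ℕ} (hj : 1 ≤ j) {x y : 𝔤} (hx : x ∈ S.layer 1)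
    (hy : y ∈ S.layer j) : ⁅x, y⁆ ∈ S.layer (j + 1) := by
  rcases lt_trichotomy j S.step with h | h | h
  · rw [layer, if_pos (by omega)] at *
    rw [← S.bracket_eq j hj h]
    exact Submodule.subset_span ⟨x, hx, y, hy, rfl⟩
  · rw [layer, if_pos (by omega)] at hx hy
    subst h
    rw [S.bracket_top x hx y hy]
    exact zero_mem _
  · rw [layer, if_neg (by omega), Submodule.mem_bot] at hy
    rw [hy, lie_zero]
    exact zero_mem _

/-- Induction on `i`: layer `i + 1` is spanned by brackets of layers `1` and `i`, and the Jacobi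
identity passes them on to `y` one at a time. -/
theorem lie_mem_layer {i j : ℕ} (hi : 1 ≤ i) (hj : 1 ≤ j) {x y : 𝔤} (hx : x ∈ S.layer i)
    (hy : y ∈ S.layer j) : ⁅x, y⁆ ∈ S.layer (i + j) := by
  induction i, hi using Nat.le_induction generalizing j x y with
  | base => rw [add_comm]; exact lie_mem_layer_succ hj hx hy
  | succ i hi ih =>
    by_cases h : i + 1 ≤ S.step
    · rw [layer, if_pos h, ← S.bracket_eq i hi h] at hx
      induction hx using Submodule.span_induction with
      | mem z hz =>
        obtain ⟨u, hu, v, hv, rfl⟩ := hz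
        have hu' : u ∈ S.layer 1 := by rwa [layer, if_pos (by omega)]
        have hv' : v ∈ S.layer i := by rwa [layer, if_pos (by omega)]
        rw [lie_lie]
        refine sub_mem ?_ ?_
        · have := lie_mem_layer_succ (by omega) hu' (ih hj hv' hy)
          rwa [show i + 1 + j = i + j + 1 by ring]
        · have := ih (by omega) hv' (lie_mem_layer_succ hj hu' hy)
          rwa [show i + 1 + j = i + (j + 1) by ring]
      | zero => rw [zero_lie]; exact zero_mem _
      | add a c _ _ ha hc => rw [add_lie]; exact add_mem ha hc
      | smul t a _ ha => rw [smul_lie]; exact Submodule.smul_mem _ _ ha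
    · rw [layer, if_neg h, Submodule.mem_bot] at hx
      rw [hx, zero_lie]
      exact zero_mem _

end Stratification

namespace AdaptedBasis

variable {S : Stratification 𝔤} {ι : Type*} [Fintype ι] (b : AdaptedBasis S ι)

theorem mem_layer (i : ι) : b.X i ∈ S.layer (b.layer i) := by
  rw [Stratification.layer, if_pos (b.layer_le i)]
  exact b.mem i

/-- The part of `v` carried by basis vectors outside layer `k` lies both in layer `k` and in the sum
of the other layers; independence kills it. -/
theorem layer_eq_of_repr_ne_zero {k : ℕ} (hk : 1 ≤ k) {v : 𝔤} (hv : v ∈ S.layer k) {m : ι}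
    (hm : b.X.repr v m ≠ 0) : b.layer m = k := by
  classical
  by_cases hks : k ≤ S.step
  swap
  · rw [Stratification.layer, if_neg hks, Submodule.mem_bot] at hv
    simp [hv] at hm
  rw [Stratification.layer, if_pos hks] at hv
  set i : Fin S.step := ⟨k - 1, by omega⟩ with hi
  have hik : (i : ℕ) + 1 = k := by simp [hi]; omega
  set v' := ∑ m with b.layer m = k, b.X.repr v m • b.X m with hv'
  have h1 : v' ∈ S.V k := by
    refine sum_mem fun m hm => Submodule.smul_mem _ _ ?_
    have := b.mem m
    rwa [(Finset.mem_filter.1 hm).2] at this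
  have h2 : v - v' ∈ ⨆ (j : Fin S.step) (_ : j ≠ i), S.V (j + 1) := by
    have e : v - v' = ∑ m with ¬ b.layer m = k, b.X.repr v m • b.X m := by
      rw [sub_eq_iff_eq_add', hv', Finset.sum_filter_add_sum_filter_not, b.X.sum_repr]
    rw [e]
    refine sum_mem fun m hm => Submodule.smul_mem _ _ ?_
    have hm' := (Finset.mem_filter.1 hm).2
    have h3 := b.one_le_layer m
    have h4 := b.layer_le m
    refine Submodule.mem_iSup_of_mem (⟨b.layer m - 1, by omega⟩ : Fin S.step) ?_
    refine Submodule.mem_iSup_of_mem ?_ ?_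
    · intro h
      have := congrArg Fin.val h
      simp only [hi] at this
      omega
    · have := b.mem m
      rwa [show b.layer m - 1 + 1 = b.layer m by omega]
  have hind := S.internal.submodule_iSupIndep i
  rw [hik] at hind
  have h0 := Submodule.disjoint_def.1 hind _ (sub_mem hv h1) h2
  rw [sub_eq_zero] at h0
  by_contra hne
  apply hm
  rw [h0, hv']
  simp only [map_sum, map_smul, Module.Basis.repr_self, Finsupp.coe_finsetSum, Finset.sum_apply,
    Finsupp.smul_apply, smul_eq_mul]
  refine Finset.sum_eq_zero fun j hj => ?_
  rw [Finsupp.single_apply, if_neg, mul_zero]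
  rintro rfl
  exact hne (Finset.mem_filter.1 hj).2

/-- The bracket in coordinates. -/
noncomputable def bracket (x y : ι → ℝ) : ι → ℝ :=
  b.X.equivFun ⁅b.X.equivFun.symm x, b.X.equivFun.symm y⁆

theorem equivFun_lie (u v : 𝔤) :
    b.X.equivFun ⁅u, v⁆ = b.bracket (b.X.equivFun u) (b.X.equivFun v) := by
  simp [bracket]

/-- The structure constants respect the grading. Hence dilations preserve the bracket, the degree
map is a derivation and the bracket is filtered. -/
theorem repr_lie_ne_zero {i j m : ι} (h : b.X.repr ⁅b.X i, b.X j⁆ m ≠ 0) :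
    b.layer m = b.layer i + b.layer j :=
  b.layer_eq_of_repr_ne_zero (by have := b.one_le_layer i; omega)
    (Stratification.lie_mem_layer (b.one_le_layer i) (b.one_le_layer j) (b.mem_layer i)
      (b.mem_layer j)) h

theorem bracket_apply (x y : ι → ℝ) (m : ι) :
    b.bracket x y m = ∑ i, ∑ j, x i * y j * b.X.repr ⁅b.X i, b.X j⁆ m := by
  rw [bracket, b.X.equivFun_symm_apply, b.X.equivFun_symm_apply, sum_lie]
  simp only [lie_sum, smul_lie, lie_smul, map_sum, map_smul, Finset.sum_apply,
    Pi.smul_apply, smul_eq_mul, Module.Basis.equivFun_apply]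
  refine Finset.sum_congr rfl fun i _ => Finset.sum_congr rfl fun j _ => by ring

theorem bracket_add_left (x y z : ι → ℝ) : b.bracket (x + y) z = b.bracket x z + b.bracket y z := by
  simp only [bracket, map_add, add_lie]

theorem bracket_add_right (x y z : ι → ℝ) :
    b.bracket x (y + z) = b.bracket x y + b.bracket x z := by
  simp only [bracket, map_add, lie_add]

theorem bracket_smul_left (t : ℝ) (x y : ι → ℝ) : b.bracket (t • x) y = t • b.bracket x y := by
  simp [bracket]

theorem bracket_smul_right (t : ℝ) (x y : ι → ℝ) : b.bracket x (t • y) = t • b.bracket x y := by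
  simp [bracket]

theorem bracket_bracket (x y z : ι → ℝ) :
    b.bracket (b.bracket x y) z = b.bracket x (b.bracket y z) - b.bracket y (b.bracket x z) := by
  simp [bracket]

/-- The dilation `x i ↦ t ^ layer i * x i`. -/
noncomputable def dilation (t : ℝ) : (ι → ℝ) →ₗ[ℝ] (ι → ℝ) where
  toFun x i := t ^ b.layer i * x i
  map_add' x y := by ext i; simp [mul_add]
  map_smul' c x := by ext i; simp; ring

@[simp]
theorem dilation_apply (t : ℝ) (x : ι → ℝ) (i : ι) : b.dilation t x i = t ^ b.layer i * x i := rfl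

/-- The derivation multiplying the layer `k` by `k`. -/
noncomputable def degreeMap : (ι → ℝ) →ₗ[ℝ] (ι → ℝ) where
  toFun x i := b.layer i * x i
  map_add' x y := by ext i; simp [mul_add]
  map_smul' c x := by ext i; simp; ring

@[simp]
theorem degreeMap_apply (x : ι → ℝ) (i : ι) : b.degreeMap x i = b.layer i * x i := rfl

theorem dilation_bracket (t : ℝ) (x y : ι → ℝ) :
    b.dilation t (b.bracket x y) = b.bracket (b.dilation t x) (b.dilation t y) := by
  ext m
  simp only [dilation_apply, bracket_apply, Finset.mul_sum]
  refine Finset.sum_congr rfl fun i _ => Finset.sum_congr rfl fun j _ => ?_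
  by_cases h : b.X.repr ⁅b.X i, b.X j⁆ m = 0
  · simp [h]
  · rw [b.repr_lie_ne_zero h, pow_add]
    ring

theorem degreeMap_bracket (x y : ι → ℝ) :
    b.degreeMap (b.bracket x y) = b.bracket (b.degreeMap x) y + b.bracket x (b.degreeMap y) := by
  ext m
  simp only [degreeMap_apply, bracket_apply, Finset.mul_sum, Pi.add_apply,
    ← Finset.sum_add_distrib]
  refine Finset.sum_congr rfl fun i _ => Finset.sum_congr rfl fun j _ => ?_
  by_cases h : b.X.repr ⁅b.X i, b.X j⁆ m = 0
  · simp [h]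
  · rw [b.repr_lie_ne_zero h]
    push_cast
    ring

theorem bracket_skew (x y : ι → ℝ) : b.bracket x y = -b.bracket y x := by
  rw [bracket, bracket, ← lie_skew, map_neg]

/-- The vectors whose components in the layers below `k` vanish. -/
def filt (k : ℕ) : Submodule ℝ (ι → ℝ) where
  carrier := {x | ∀ i, b.layer i < k → x i = 0}
  add_mem' hx hy i hi := by simp [hx i hi, hy i hi]
  zero_mem' i _ := rfl
  smul_mem' c x hx i hi := by simp [hx i hi]

theorem filt_antitone {k l : ℕ} (h : k ≤ l) : b.filt l ≤ b.filt k :=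
  fun _ hx i hi => hx i (by omega)

theorem mem_filt_one (x : ι → ℝ) : x ∈ b.filt 1 := fun i hi => by
  have := b.one_le_layer i; omega

theorem eq_zero_of_mem_filt {k : ℕ} (hk : S.step < k) {x : ι → ℝ} (hx : x ∈ b.filt k) :
    x = 0 :=
  funext fun i => hx i (by have := b.layer_le i; omega)

theorem bracket_mem_filt {k l : ℕ} {x y : ι → ℝ} (hx : x ∈ b.filt k) (hy : y ∈ b.filt l) :
    b.bracket x y ∈ b.filt (k + l) := by
  intro m hm
  rw [bracket_apply]
  refine Finset.sum_eq_zero fun i _ => Finset.sum_eq_zero fun j _ => ?_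
  by_cases h : b.X.repr ⁅b.X i, b.X j⁆ m = 0
  · simp [h]
  · have := b.repr_lie_ne_zero h
    rcases lt_or_ge (b.layer i) k with h1 | h1
    · simp [hx i h1]
    · simp [hy j (by omega)]

end AdaptedBasis

end Grading

/-! ### A faithful representation by nilpotent operators. -/

section Representation

variable {𝔤 : Type*} [LieRing 𝔤] [LieAlgebra ℝ 𝔤] {S : Stratification 𝔤} {ι : Type*} [Fintype ι]

namespace AdaptedBasis

variable (b : AdaptedBasis S ι)

/-- The adjoint representation on `𝔤 ⊕ ℝ D`, where `D` is the degree derivation, in coordinates.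
It is faithful and nilpotent. -/
noncomputable def rep : (ι → ℝ) →ₗ[ℝ] ((ι → ℝ) × ℝ →L[ℝ] (ι → ℝ) × ℝ) where
  toFun x := LinearMap.toContinuousLinearMap
    { toFun := fun v => (b.bracket x v.1 + v.2 • b.degreeMap x, 0)
      map_add' := fun v w => by
        ext <;> simp [bracket_add_right, add_mul]; ring
      map_smul' := fun c v => by
        ext <;> simp [bracket_smul_right, mul_assoc] }
  map_add' x y := by
    ext v <;> simp [bracket_add_left]; ring
  map_smul' c x := by
    ext v <;> simp [bracket_smul_left]

theorem rep_apply (x : ι → ℝ) (v : (ι → ℝ) × ℝ) :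
    b.rep x v = (b.bracket x v.1 + v.2 • b.degreeMap x, 0) := rfl

/-- On `𝔤` this is the Jacobi identity; on the additional line it is the derivation property of
`degreeMap`. -/
theorem rep_bracket (x y : ι → ℝ) :
    b.rep (b.bracket x y) = b.rep x * b.rep y - b.rep y * b.rep x := by
  refine ContinuousLinearMap.ext fun v => ?_
  change _ = b.rep x (b.rep y v) - b.rep y (b.rep x v)
  simp only [rep_apply, bracket_add_right, bracket_smul_right, degreeMap_bracket, zero_smul,
    add_zero, bracket_bracket, Prod.mk_sub_mk, sub_self]
  rw [bracket_skew b (b.degreeMap x) y]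
  congr 1
  module

/-- The left inverse of `rep`. -/
noncomputable def repInv : ((ι → ℝ) × ℝ →L[ℝ] (ι → ℝ) × ℝ) →L[ℝ] (ι → ℝ) :=
  ContinuousLinearMap.pi fun i => (b.layer i : ℝ)⁻¹ • (ContinuousLinearMap.proj i).comp
    ((ContinuousLinearMap.fst ℝ (ι → ℝ) ℝ).comp (ContinuousLinearMap.apply ℝ _ ((0 : ι → ℝ), (1 : ℝ))))

theorem repInv_apply (T : (ι → ℝ) × ℝ →L[ℝ] (ι → ℝ) × ℝ) (i : ι) :
    b.repInv T i = (b.layer i : ℝ)⁻¹ * (T (0, 1)).1 i := rfl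

theorem layer_ne_zero (i : ι) : (b.layer i : ℝ) ≠ 0 := by
  have := b.one_le_layer i
  positivity

@[simp]
theorem repInv_rep (x : ι → ℝ) : b.repInv (b.rep x) = x := by
  ext i
  have h0 : b.bracket x 0 = 0 := by simp [bracket]
  rw [repInv_apply, rep_apply]
  simp [h0, b.layer_ne_zero i]

theorem rep_injective : Function.Injective b.rep :=
  Function.LeftInverse.injective b.repInv_rep

/-- The filtration on the space of the representation. -/
def repFilt (k : ℕ) : Submodule ℝ ((ι → ℝ) × ℝ) where
  carrier := {v | v.1 ∈ b.filt k ∧ (0 < k → v.2 = 0)}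
  add_mem' hx hy := ⟨add_mem hx.1 hy.1, fun h => by simp [hx.2 h, hy.2 h]⟩
  zero_mem' := ⟨zero_mem _, fun _ => rfl⟩
  smul_mem' c x hx := ⟨Submodule.smul_mem _ _ hx.1, fun h => by simp [hx.2 h]⟩

theorem repFilt_antitone {k l : ℕ} (h : k ≤ l) : b.repFilt l ≤ b.repFilt k :=
  fun _ hx => ⟨b.filt_antitone h hx.1, fun h' => hx.2 (by omega)⟩

/-- The operators raising the filtration by `k`. -/
def raise (k : ℕ) : Submodule ℝ ((ι → ℝ) × ℝ →L[ℝ] (ι → ℝ) × ℝ) where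
  carrier := {T | ∀ j, ∀ v ∈ b.repFilt j, T v ∈ b.repFilt (j + k)}
  add_mem' hx hy j v hv := add_mem (hx j v hv) (hy j v hv)
  zero_mem' _ _ _ := zero_mem _
  smul_mem' _ _ hx j v hv := Submodule.smul_mem _ _ (hx j v hv)

theorem raise_antitone {k l : ℕ} (h : k ≤ l) : b.raise l ≤ b.raise k :=
  fun _ hT j v hv => b.repFilt_antitone (by omega) (hT j v hv)

theorem one_mem_raise : 1 ∈ b.raise 0 := fun _ _ hv => hv

theorem mul_mem_raise {k l : ℕ} {T T' : (ι → ℝ) × ℝ →L[ℝ] (ι → ℝ) × ℝ} (hT : T ∈ b.raise k)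
    (hT' : T' ∈ b.raise l) : T * T' ∈ b.raise (k + l) := fun j v hv => by
  have := hT _ _ (hT' j v hv)
  rwa [show j + (k + l) = j + l + k by ring]

theorem pow_mem_raise {k : ℕ} {T : (ι → ℝ) × ℝ →L[ℝ] (ι → ℝ) × ℝ} (hT : T ∈ b.raise k) (m : ℕ) :
    T ^ m ∈ b.raise (m * k) := by
  induction m with
  | zero => simpa using b.one_mem_raise
  | succ m ih =>
    rw [pow_succ, Nat.succ_mul]
    exact b.mul_mem_raise ih hT

/-- The filtration is the whole space at index `0` and vanishes beyond the step. Nilpotency of the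
represented operators comes from here. -/
theorem eq_zero_of_mem_raise {k : ℕ} (hk : S.step < k) {T : (ι → ℝ) × ℝ →L[ℝ] (ι → ℝ) × ℝ}
    (hT : T ∈ b.raise k) : T = 0 := by
  refine ContinuousLinearMap.ext fun v => ?_
  have h := hT 0 v ⟨b.filt_antitone (Nat.zero_le 1) (b.mem_filt_one _), fun h => absurd h (by simp)⟩
  rw [zero_add] at h
  exact Prod.ext (b.eq_zero_of_mem_filt hk h.1) (h.2 (by omega))

theorem rep_mem_raise {k : ℕ} {x : ι → ℝ} (hx : x ∈ b.filt k) : b.rep x ∈ b.raise k := by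
  intro j v hv
  rw [rep_apply]
  refine ⟨?_, fun _ => rfl⟩
  refine add_mem ?_ ?_
  · rw [add_comm]; exact b.bracket_mem_filt hx hv.1
  · rcases Nat.eq_zero_or_pos j with h | h
    · refine Submodule.smul_mem _ _ fun i hi => ?_
      rw [degreeMap_apply, hx i (by omega), mul_zero]
    · rw [hv.2 h, zero_smul]
      exact zero_mem _

/-- The value of `rep x` at `(0, 1)` is `x` with coordinates multiplied by their layers, so the
order of a point can be read off its operator. -/
theorem mem_filt_of_rep_mem_raise {k : ℕ} {x : ι → ℝ} (hx : b.rep x ∈ b.raise k) :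
    x ∈ b.filt k := by
  have h := (hx 0 (0, 1) ⟨zero_mem _, fun h => absurd h (by simp)⟩).1
  rw [zero_add] at h
  intro i hi
  rw [← b.repInv_rep x, repInv_apply, h i hi, mul_zero]

theorem pow_eq_zero_of_mem_raise {T : (ι → ℝ) × ℝ →L[ℝ] (ι → ℝ) × ℝ} (hT : T ∈ b.raise 1) :
    T ^ (S.step + 1) = 0 :=
  b.eq_zero_of_mem_raise (by simp) (b.pow_mem_raise hT (S.step + 1))

theorem rep_pow_eq_zero (x : ι → ℝ) : b.rep x ^ (S.step + 1) = 0 :=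
  b.pow_eq_zero_of_mem_raise (b.rep_mem_raise (b.mem_filt_one x))

end AdaptedBasis

end Representation

/-- This is `exp (ad X) = Ad (exp X)`: `ad X` is the sum of left multiplication by `X` and right
multiplication by `-X`, which commute, so its exponential factors. -/
theorem sum_pow_commutator_apply {𝔸 : Type*} [NormedRing 𝔸] [NormedAlgebra ℝ 𝔸]
    [CompleteSpace 𝔸] {X : 𝔸} {n K : ℕ} (h : X ^ n = 0) (hK : 2 * n ≤ K) (T : 𝔸) :
    (∑ k ∈ Finset.range K, ((k.factorial : ℝ)⁻¹) •
      (LinearMap.mulLeft ℝ X - LinearMap.mulRight ℝ X : Module.End ℝ 𝔸) ^ k) T =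
      NormedSpace.exp X * T * NormedSpace.exp (-X) := by
  set l : 𝔸 →L[ℝ] 𝔸 := ContinuousLinearMap.mul ℝ 𝔸 X with hl
  set r : 𝔸 →L[ℝ] 𝔸 := (ContinuousLinearMap.mul ℝ 𝔸).flip (-X) with hr
  have hX : (-X) ^ n = 0 := by rw [neg_pow, h, mul_zero]
  have hlr : Commute l r := by
    refine ContinuousLinearMap.ext fun T => ?_
    change X * (T * -X) = X * T * -X
    rw [mul_assoc]
  have hlp : ∀ k T, (l ^ k) T = X ^ k * T := by
    intro k
    induction k with
    | zero => simp
    | succ k ih =>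
      intro T
      rw [pow_succ', ContinuousLinearMap.mul_def, ContinuousLinearMap.comp_apply, ih, hl,
        ContinuousLinearMap.mul_apply', pow_succ', mul_assoc]
  have hrp : ∀ k T, (r ^ k) T = T * (-X) ^ k := by
    intro k
    induction k with
    | zero => simp
    | succ k ih =>
      intro T
      rw [pow_succ', ContinuousLinearMap.mul_def, ContinuousLinearMap.comp_apply, ih, hr,
        ContinuousLinearMap.flip_apply, ContinuousLinearMap.mul_apply', pow_succ, mul_assoc]
  have hl0 : l ^ n = 0 := ContinuousLinearMap.ext fun T => by rw [hlp, h]; simp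
  have hr0 : r ^ n = 0 := ContinuousLinearMap.ext fun T => by rw [hrp, hX]; simp
  have hs : (l + r) ^ (2 * n) = 0 :=
    hlr.add_pow_eq_zero_of_add_le_succ_of_pow_eq_zero hl0 hr0 (by omega)
  have hp : ∀ k T, ((l + r) ^ k) T =
      ((LinearMap.mulLeft ℝ X - LinearMap.mulRight ℝ X : Module.End ℝ 𝔸) ^ k) T := by
    intro k
    induction k with
    | zero => simp
    | succ k ih =>
      intro T
      rw [pow_succ', ContinuousLinearMap.mul_def, ContinuousLinearMap.comp_apply, ih,
        pow_succ' (_ - _ : Module.End ℝ 𝔸), Module.End.mul_apply]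
      simp [hl, hr, sub_eq_add_neg]
  have e1 : NormedSpace.exp (l + r) T = NormedSpace.exp X * T * NormedSpace.exp (-X) := by
    let _ : NormedAlgebra ℚ (𝔸 →L[ℝ] 𝔸) := NormedAlgebra.restrictScalars ℚ ℝ _
    rw [NormedSpace.exp_add_of_commute hlr, exp_eq_sum_range hl0,
      exp_eq_sum_range hr0, exp_eq_sum_range h, exp_eq_sum_range hX,
      ContinuousLinearMap.mul_def, ContinuousLinearMap.comp_apply]
    simp only [sum_apply, smul_apply, hlp, hrp, Finset.sum_mul, Finset.mul_sum, smul_mul_assoc,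
      mul_smul_comm, Finset.smul_sum, map_sum, map_smul]
    refine Finset.sum_congr rfl fun i _ => Finset.sum_congr rfl fun j _ => ?_
    rw [mul_assoc]
  rw [← e1, exp_eq_sum_range (pow_eq_zero_of_le hK hs)]
  simp only [sum_apply, smul_apply, hp, LinearMap.sum_apply, LinearMap.smul_apply]

theorem mulLeft_sub_mulRight_pow_eq_zero {𝔸 : Type*} [Ring 𝔸] [Algebra ℝ 𝔸] {X : 𝔸} {n : ℕ}
    (h : X ^ n = 0) :
    (LinearMap.mulLeft ℝ X - LinearMap.mulRight ℝ X : Module.End ℝ 𝔸) ^ (2 * n) = 0 := by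
  have hc : Commute (LinearMap.mulLeft ℝ X) (LinearMap.mulRight ℝ (-X)) := by
    ext T; simp [mul_assoc]
  have e : (LinearMap.mulLeft ℝ X - LinearMap.mulRight ℝ X : Module.End ℝ 𝔸) =
      LinearMap.mulLeft ℝ X + LinearMap.mulRight ℝ (-X) := by
    ext T; simp [sub_eq_add_neg]
  rw [e]
  exact hc.add_pow_eq_zero_of_add_le_succ_of_pow_eq_zero (m := n) (n := n)
    (by rw [LinearMap.pow_mulLeft, h]; ext; simp)
    (by rw [LinearMap.pow_mulRight, neg_pow, h]; ext; simp) (by omega)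

theorem mul_sub_one_eq {R : Type*} [Ring R] (T T' : R) :
    T * T' - 1 = (T - 1) * (T' - 1) + (T - 1) + (T' - 1) := by
  noncomm_ring

/-- By Cayley–Hamilton, as the characteristic polynomial is a power of `X`. This makes the
truncations at the dimension in `expAd` and `bchPsi` exact. -/
theorem Module.End.pow_finrank_eq_zero_of_isNilpotent {V : Type*} [AddCommGroup V] [Module ℝ V]
    [Module.Finite ℝ V] {T : Module.End ℝ V} (h : IsNilpotent T) :
    T ^ Module.finrank ℝ V = 0 := by
  have h1 := LinearMap.aeval_self_charpoly T
  rwa [LinearMap.isNilpotent_iff_charpoly T |>.1 h, map_pow, Polynomial.aeval_X] at h1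

/-! ### The Baker–Campbell–Hausdorff integrand as an operator derivative. -/

section GroupStructure

variable {𝔤 : Type*} [LieRing 𝔤] [LieAlgebra ℝ 𝔤] {S : Stratification 𝔤} {ι : Type*} [Fintype ι]

namespace AdaptedBasis

variable (b : AdaptedBasis S ι)

/-- The group element with coordinates `x`, as an operator. -/
noncomputable def expRep (x : ι → ℝ) : (ι → ℝ) × ℝ →L[ℝ] (ι → ℝ) × ℝ :=
  NormedSpace.exp (b.rep x)

theorem rep_equivFun_lie (u v : 𝔤) : b.rep (b.X.equivFun ⁅u, v⁆) =
    (LinearMap.mulLeft ℝ (b.rep (b.X.equivFun u)) - LinearMap.mulRight ℝ (b.rep (b.X.equivFun u)) :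
      Module.End ℝ _) (b.rep (b.X.equivFun v)) := by
  rw [equivFun_lie, rep_bracket]
  rfl

theorem rep_equivFun_ad_pow (u v : 𝔤) (k : ℕ) :
    b.rep (b.X.equivFun (((LieAlgebra.ad ℝ 𝔤 u) ^ k) v)) =
    ((LinearMap.mulLeft ℝ (b.rep (b.X.equivFun u)) - LinearMap.mulRight ℝ (b.rep (b.X.equivFun u)) :
      Module.End ℝ _) ^ k) (b.rep (b.X.equivFun v)) := by
  induction k with
  | zero => simp
  | succ k ih =>
    rw [pow_succ', Module.End.mul_apply, LieAlgebra.ad_apply, rep_equivFun_lie, ih, pow_succ' (_ - _),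
      Module.End.mul_apply]

theorem rep_equivFun_injective : Function.Injective fun v : 𝔤 => b.rep (b.X.equivFun v) :=
  b.rep_injective.comp b.X.equivFun.injective

include b in
theorem ad_pow_eq_zero (u : 𝔤) {k : ℕ} (hk : Module.finrank ℝ 𝔤 ≤ k) :
    (LieAlgebra.ad ℝ 𝔤 u) ^ k = 0 := by
  have : Module.Finite ℝ 𝔤 := Module.Finite.of_basis b.X
  refine pow_eq_zero_of_le hk (Module.End.pow_finrank_eq_zero_of_isNilpotent
    ⟨2 * (S.step + 1), ?_⟩)
  ext v
  apply b.rep_equivFun_injective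
  simp only [rep_equivFun_ad_pow]
  set X := b.rep (b.X.equivFun u)
  have hX : X ^ (S.step + 1) = 0 := b.rep_pow_eq_zero _
  rw [mulLeft_sub_mulRight_pow_eq_zero hX]
  simp

theorem rep_equivFun_expAd (u v : 𝔤) : b.rep (b.X.equivFun (expAd u v)) =
    b.expRep (b.X.equivFun u) * b.rep (b.X.equivFun v) *
      NormedSpace.exp (-b.rep (b.X.equivFun u)) := by
  rw [expRep, ← sum_pow_commutator_apply (b.rep_pow_eq_zero (b.X.equivFun u))
    (le_max_left _ (Module.finrank ℝ 𝔤 + 1))]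
  have h1 : expAd u = ∑ k ∈ Finset.range (max (2 * (S.step + 1)) (Module.finrank ℝ 𝔤 + 1)),
      ((k.factorial : ℝ)⁻¹) • (LieAlgebra.ad ℝ 𝔤 u) ^ k := by
    refine Finset.sum_subset (Finset.range_mono (le_max_right _ _)) fun k _ hk => ?_
    rw [b.ad_pow_eq_zero u (by rw [Finset.mem_range] at hk; omega), smul_zero]
  rw [h1]
  simp only [LinearMap.sum_apply, LinearMap.smul_apply, map_sum, map_smul, rep_equivFun_ad_pow]

/-- The truncation order of the logarithm. -/
def logOrder (_ : AdaptedBasis S ι) : ℕ := 2 * (S.step + 1) + 1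

/-- The conjugation by `U`, minus the identity. -/
noncomputable def conjSubOne (x y : ι → ℝ) : Module.End ℝ ((ι → ℝ) × ℝ →L[ℝ] (ι → ℝ) × ℝ) :=
  LinearMap.mulLeft ℝ (b.expRep x * b.expRep y) *
    LinearMap.mulRight ℝ (NormedSpace.exp (-b.rep y) * NormedSpace.exp (-b.rep x)) - 1

theorem expRep_mul_exp_neg (x : ι → ℝ) : b.expRep x * NormedSpace.exp (-b.rep x) = 1 :=
  exp_mul_exp_neg_eq_one _

theorem exp_neg_mul_expRep (x : ι → ℝ) : NormedSpace.exp (-b.rep x) * b.expRep x = 1 :=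
  exp_neg_mul_exp_eq_one _

theorem expRep_sub_one_mem_raise {k : ℕ} {x : ι → ℝ} (hx : x ∈ b.filt k) :
    b.expRep x - 1 ∈ b.raise k := by
  rw [expRep, exp_eq_sum_range (n := S.step + 1 + 1) (by rw [pow_succ, b.rep_pow_eq_zero x, zero_mul]),
    Finset.sum_range_succ']
  simp only [pow_zero, Nat.factorial_zero, Nat.cast_one, inv_one, one_smul, add_sub_cancel_right]
  exact sum_mem fun m _ => Submodule.smul_mem _ _
    (b.raise_antitone (Nat.le_mul_of_pos_left k (Nat.succ_pos m))
      (b.pow_mem_raise (b.rep_mem_raise hx) (m + 1)))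

theorem mul_sub_one_mem_raise {k : ℕ} {T T' : (ι → ℝ) × ℝ →L[ℝ] (ι → ℝ) × ℝ}
    (hT : T - 1 ∈ b.raise k) (hT' : T' - 1 ∈ b.raise k) : T * T' - 1 ∈ b.raise k := by
  rw [mul_sub_one_eq]
  exact add_mem (add_mem (b.raise_antitone (by omega) (b.mul_mem_raise hT hT')) hT) hT'

theorem expRep_mul_sub_one_pow (x y : ι → ℝ) :
    (b.expRep x * b.expRep y - 1) ^ (S.step + 1) = 0 :=
  b.pow_eq_zero_of_mem_raise (b.mul_sub_one_mem_raise
    (b.expRep_sub_one_mem_raise (b.mem_filt_one x)) (b.expRep_sub_one_mem_raise (b.mem_filt_one y)))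

theorem expRep_mul_inverse (x y : ι → ℝ) : b.expRep x * b.expRep y *
    (NormedSpace.exp (-b.rep y) * NormedSpace.exp (-b.rep x)) = 1 := by
  rw [mul_assoc, ← mul_assoc (b.expRep y), expRep_mul_exp_neg, one_mul, expRep_mul_exp_neg]

theorem inverse_mul_expRep_mul (x y : ι → ℝ) :
    (NormedSpace.exp (-b.rep y) * NormedSpace.exp (-b.rep x)) * (b.expRep x * b.expRep y) = 1 := by
  rw [mul_assoc, ← mul_assoc _ (b.expRep x), exp_neg_mul_expRep, one_mul, exp_neg_mul_expRep]

theorem conjSubOne_pow (x y : ι → ℝ) : b.conjSubOne x y ^ (2 * (S.step + 1)) = 0 :=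
  conj_sub_one_pow_eq_zero (b.expRep_mul_inverse x y) (b.expRep_mul_sub_one_pow x y)

theorem rep_equivFun_expAd_mul (u v z : 𝔤) : b.rep (b.X.equivFun ((expAd u * expAd v - 1) z)) =
    b.conjSubOne (b.X.equivFun u) (b.X.equivFun v) (b.rep (b.X.equivFun z)) := by
  rw [LinearMap.sub_apply, Module.End.mul_apply, map_sub, map_sub, rep_equivFun_expAd,
    rep_equivFun_expAd]
  simp [conjSubOne, mul_assoc]

theorem rep_equivFun_expAd_mul_pow (u v z : 𝔤) (k : ℕ) :
    b.rep (b.X.equivFun (((expAd u * expAd v - 1) ^ k) z)) =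
    (b.conjSubOne (b.X.equivFun u) (b.X.equivFun v) ^ k) (b.rep (b.X.equivFun z)) := by
  induction k with
  | zero => simp
  | succ k ih =>
    rw [pow_succ', Module.End.mul_apply, rep_equivFun_expAd_mul, ih, pow_succ',
      Module.End.mul_apply]

include b in
theorem isNilpotent_expAd_mul_sub_one (u v : 𝔤) : IsNilpotent (expAd u * expAd v - 1) := by
  refine ⟨2 * (S.step + 1), ?_⟩
  ext z
  apply b.rep_equivFun_injective
  simp only [rep_equivFun_expAd_mul_pow, conjSubOne_pow]
  simp

/-- The representation carries `ad` to the operator commutator, hence `expAd` to conjugation and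
power series in one to power series in the other. The two truncation orders are reconciled through
the common bound `L`. -/
theorem rep_equivFun_bchPsi (u v z : 𝔤) :
    b.rep (b.X.equivFun (bchPsi (expAd u * expAd v) z)) =
    ((1 + b.conjSubOne (b.X.equivFun u) (b.X.equivFun v)) * nilLogQuot (2 * (S.step + 1))
      (b.conjSubOne (b.X.equivFun u) (b.X.equivFun v))) (b.rep (b.X.equivFun z)) := by
  have : Module.Finite ℝ 𝔤 := Module.Finite.of_basis b.X
  set A := expAd u * expAd v with hA
  set w := b.conjSubOne (b.X.equivFun u) (b.X.equivFun v) with hw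
  have hfin : (A - 1) ^ Module.finrank ℝ 𝔤 = 0 :=
    Module.End.pow_finrank_eq_zero_of_isNilpotent (b.isNilpotent_expAd_mul_sub_one u v)
  set L := max (Module.finrank ℝ 𝔤 + 1) (2 * (S.step + 1)) with hL
  have h1 : bchPsi A = (1 + (A - 1)) * nilLogQuot L (A - 1) := by
    rw [nilLogQuot_eq_of_le (pow_eq_zero_of_le (Nat.le_succ _) hfin) (le_max_left _ _),
      one_add_mul_nilLogQuot (pow_eq_zero_of_le (Nat.le_succ _) hfin), bchPsi]
  have h2 : nilLogQuot L w = nilLogQuot (2 * (S.step + 1)) w :=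
    nilLogQuot_eq_of_le (b.conjSubOne_pow _ _) (le_max_right _ _)
  have h3 : ∀ z, b.rep (b.X.equivFun (nilLogQuot L (A - 1) z)) =
      nilLogQuot L w (b.rep (b.X.equivFun z)) := fun z => by
    simp only [nilLogQuot, LinearMap.sum_apply, LinearMap.smul_apply, map_sum, map_smul, hA,
      rep_equivFun_expAd_mul_pow, hw]
  rw [h1, ← h2, Module.End.mul_apply, Module.End.mul_apply, LinearMap.add_apply,
    LinearMap.add_apply, Module.End.one_apply, Module.End.one_apply, map_add, map_add, h3, hA,
    rep_equivFun_expAd_mul, ← hA, h3]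

/-- The integrand of the Baker-Campbell-Hausdorff formula. -/
noncomputable def bchVelocity (x y : ι → ℝ) (t : ℝ) : ι → ℝ :=
  b.X.equivFun (bchPsi (expAd (b.X.equivFun.symm x) * expAd (t • b.X.equivFun.symm y))
    (b.X.equivFun.symm y))

/-- The curve `U s = exp x exp (s y)` satisfies `U' = U y`, so its logarithm moves with velocity
`ψ(Ad U) y`, the integrand in `groupMul`. -/
theorem hasDerivAt_nilLog_expRep_mul (x y : ι → ℝ) (t : ℝ) :
    HasDerivAt (fun s : ℝ => nilLog b.logOrder (b.expRep x * b.expRep (s • y) - 1))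
      (b.rep (b.bchVelocity x y t)) t := by
  have h1 : HasDerivAt (fun s : ℝ => b.expRep x * b.expRep (s • y))
      (b.expRep x * b.expRep (t • y) * b.rep y) t := by
    have := (hasDerivAt_exp_smul_const (𝕂 := ℝ) (b.rep y) t).const_mul (b.expRep x)
    simp only [expRep, map_smul, mul_assoc] at this ⊢
    exact this
  have h2 := hasDerivAt_nilLog_of_hasDerivAt_mul (M := b.logOrder) h1
    (b.expRep_mul_inverse x (t • y))
    (b.inverse_mul_expRep_mul x (t • y)) (b.expRep_mul_sub_one_pow x (t • y))
    (by simp [logOrder]) rfl (b.conjSubOne_pow x (t • y))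
  refine h2.congr_deriv ?_
  rw [bchVelocity, rep_equivFun_bchPsi, map_smul b.X.equivFun, LinearEquiv.apply_symm_apply,
    LinearEquiv.apply_symm_apply]
  rfl

end AdaptedBasis

end GroupStructure

/-! ### Group axioms, dilations, leading terms and invariance of Lebesgue measure. -/

section GroupStructure

variable {𝔤 : Type*} [LieRing 𝔤] [LieAlgebra ℝ 𝔤] {S : Stratification 𝔤} {ι : Type*} [Fintype ι]

namespace AdaptedBasis

variable (b : AdaptedBasis S ι)

theorem contDiff_nilLog {𝔸 : Type*} [NormedRing 𝔸] [NormedAlgebra ℝ 𝔸] (M : ℕ) :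
    ContDiff ℝ ∞ (nilLog M : 𝔸 → 𝔸) :=
  ContDiff.sum fun _ _ => (contDiff_id.pow _).const_smul _

theorem contDiff_expRep : ContDiff ℝ ∞ b.expRep :=
  contDiff_iff_contDiffAt.2 fun x =>
    ((NormedSpace.exp_analytic (𝕂 := ℝ) (b.rep x)).contDiffAt).comp x
      (LinearMap.toContinuousLinearMap b.rep).contDiff.contDiffAt

theorem contDiff_nilLog_expRep_mul : ContDiff ℝ ∞ fun p : (ι → ℝ) × (ι → ℝ) =>
    nilLog b.logOrder (b.expRep p.1 * b.expRep p.2 - 1) :=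
  (contDiff_nilLog _).comp (((b.contDiff_expRep.comp contDiff_fst).mul
    (b.contDiff_expRep.comp contDiff_snd)).sub contDiff_const)

theorem continuous_bchVelocity (x y : ι → ℝ) : Continuous (b.bchVelocity x y) := by
  have h : ContDiff ℝ ∞ fun s : ℝ => nilLog b.logOrder (b.expRep x * b.expRep (s • y) - 1) :=
    ContDiff.comp (f := fun s : ℝ => (x, s • y)) b.contDiff_nilLog_expRep_mul
      (contDiff_const.prodMk (contDiff_id.smul contDiff_const))
  have h1 : (fun t => b.repInv (deriv (fun s : ℝ =>
      nilLog b.logOrder (b.expRep x * b.expRep (s • y) - 1)) t)) = b.bchVelocity x y := by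
    funext t
    rw [(b.hasDerivAt_nilLog_expRep_mul x y t).deriv, repInv_rep]
  rw [← h1]
  exact b.repInv.continuous.comp (h.continuous_deriv (by simp))

theorem nilLog_expRep (x : ι → ℝ) : nilLog b.logOrder (b.expRep x - 1) = b.rep x :=
  nilLog_exp (b.rep_pow_eq_zero x) (by simp [logOrder])

theorem expRep_zero : b.expRep 0 = 1 := by
  rw [expRep, map_zero, NormedSpace.exp_zero]

/-- The fundamental theorem of calculus along `s ↦ log (exp x exp (s y))`, which starts at `x` when
`s = 0`. -/
theorem rep_groupMul (x y : ι → ℝ) :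
    b.rep (groupMul b.X x y) = nilLog b.logOrder (b.expRep x * b.expRep y - 1) := by
  have h1 := intervalIntegral.integral_eq_sub_of_hasDerivAt
    (fun t _ => b.hasDerivAt_nilLog_expRep_mul x y t)
    (((LinearMap.toContinuousLinearMap b.rep).continuous.comp
      (b.continuous_bchVelocity x y)).intervalIntegrable 0 1)
  have h2 := (LinearMap.toContinuousLinearMap b.rep).intervalIntegral_comp_comm
    ((b.continuous_bchVelocity x y).intervalIntegrable (μ := volume) 0 1)
  simp only [LinearMap.coe_toContinuousLinearMap'] at h2
  rw [h1] at h2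
  simp only [one_smul, zero_smul, expRep_zero, mul_one, nilLog_expRep] at h2
  rw [groupMul, map_add]
  change _ + b.rep (∫ t in (0 : ℝ)..1, b.bchVelocity x y t) = _
  rw [← h2]
  abel

/-- With injectivity of `expRep`, this reduces the group axioms to associativity and inverses of
operators. -/
theorem expRep_groupMul (x y : ι → ℝ) :
    b.expRep (groupMul b.X x y) = b.expRep x * b.expRep y := by
  rw [expRep, rep_groupMul, exp_nilLog (b.expRep_mul_sub_one_pow x y) (by simp [logOrder])]
  abel

theorem expRep_injective : Function.Injective b.expRep := fun x y h =>
  b.rep_injective (by rw [← nilLog_expRep, ← nilLog_expRep, h])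

theorem groupMul_assoc (x y z : ι → ℝ) :
    groupMul b.X (groupMul b.X x y) z = groupMul b.X x (groupMul b.X y z) :=
  b.expRep_injective (by simp only [expRep_groupMul, mul_assoc])

theorem groupMul_zero (x : ι → ℝ) : groupMul b.X x 0 = x :=
  b.expRep_injective (by rw [expRep_groupMul, expRep_zero, mul_one])

theorem zero_groupMul (x : ι → ℝ) : groupMul b.X 0 x = x :=
  b.expRep_injective (by rw [expRep_groupMul, expRep_zero, one_mul])

theorem groupMul_neg (x : ι → ℝ) : groupMul b.X x (-x) = 0 :=
  b.expRep_injective (by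
    rw [expRep_groupMul, expRep_zero, expRep, expRep, map_neg, exp_mul_exp_neg_eq_one])

theorem neg_groupMul (x : ι → ℝ) : groupMul b.X (-x) x = 0 := by
  simpa using b.groupMul_neg (-x)

theorem neg_groupMul_cancel (x y : ι → ℝ) : groupMul b.X (-x) (groupMul b.X x y) = y := by
  rw [← groupMul_assoc, neg_groupMul, zero_groupMul]

theorem groupMul_neg_cancel (x y : ι → ℝ) : groupMul b.X x (groupMul b.X (-x) y) = y := by
  rw [← groupMul_assoc, groupMul_neg, zero_groupMul]

theorem groupMul_smul_add (x y : ι → ℝ) (s t : ℝ) :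
    groupMul b.X (groupMul b.X x (s • y)) (t • y) = groupMul b.X x ((s + t) • y) := by
  refine b.expRep_injective ?_
  simp only [expRep_groupMul, mul_assoc]
  congr 1
  let _ : NormedAlgebra ℚ ((ι → ℝ) × ℝ →L[ℝ] (ι → ℝ) × ℝ) := NormedAlgebra.restrictScalars ℚ ℝ _
  rw [expRep, expRep, expRep, ← NormedSpace.exp_add_of_commute, ← map_add, add_smul]
  rw [map_smul, map_smul]
  exact ((Commute.refl _).smul_left _).smul_right _

theorem groupMul_eq (x y : ι → ℝ) :
    groupMul b.X x y = b.repInv (nilLog b.logOrder (b.expRep x * b.expRep y - 1)) := by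
  rw [← rep_groupMul, repInv_rep]

theorem contDiff_groupMul : ContDiff ℝ ∞ fun p : (ι → ℝ) × (ι → ℝ) => groupMul b.X p.1 p.2 := by
  simp only [groupMul_eq]
  exact b.repInv.contDiff.comp b.contDiff_nilLog_expRep_mul

theorem contDiff_groupMul_right (x : ι → ℝ) : ContDiff ℝ ∞ (groupMul b.X x) :=
  b.contDiff_groupMul.comp (contDiff_const.prodMk contDiff_id)

theorem continuous_groupMul : Continuous fun p : (ι → ℝ) × (ι → ℝ) => groupMul b.X p.1 p.2 :=
  b.contDiff_groupMul.continuous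

/-- Left translation. -/
noncomputable def leftTranslate (x : ι → ℝ) : (ι → ℝ) ≃ₜ (ι → ℝ) where
  toFun := groupMul b.X x
  invFun := groupMul b.X (-x)
  left_inv := b.neg_groupMul_cancel x
  right_inv := b.groupMul_neg_cancel x
  continuous_toFun := (b.contDiff_groupMul_right x).continuous
  continuous_invFun := (b.contDiff_groupMul_right (-x)).continuous

/-! ### Dilations -/

/-- The dilation, extended to the space of the representation. -/
noncomputable def repDilation (t : ℝ) : (ι → ℝ) × ℝ →L[ℝ] (ι → ℝ) × ℝ :=
  (LinearMap.toContinuousLinearMap (b.dilation t)).prodMap (ContinuousLinearMap.id ℝ ℝ)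

theorem semiconjBy_rep (t : ℝ) (x : ι → ℝ) :
    SemiconjBy (b.repDilation t) (b.rep x) (b.rep (b.dilation t x)) := by
  refine ContinuousLinearMap.ext fun v => ?_
  change (b.dilation t (b.bracket x v.1 + v.2 • b.degreeMap x), (0 : ℝ)) =
    (b.bracket (b.dilation t x) (b.dilation t v.1) + v.2 • b.degreeMap (b.dilation t x), 0)
  rw [map_add, map_smul, dilation_bracket]
  congr 3
  ext i
  simp only [dilation_apply, degreeMap_apply]
  ring

theorem _root_.SemiconjBy.nilLog {R : Type*} [Ring R] [Algebra ℝ R] {a x y : R}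
    (h : SemiconjBy a x y) (M : ℕ) : SemiconjBy a (nilLog M x) (nilLog M y) := by
  simp only [SemiconjBy, _root_.nilLog, Finset.mul_sum, Finset.sum_mul, mul_smul_comm,
    smul_mul_assoc, (h.pow_right _).eq]

theorem semiconjBy_expRep (t : ℝ) (x : ι → ℝ) :
    SemiconjBy (b.repDilation t) (b.expRep x) (b.expRep (b.dilation t x)) := by
  let _ : NormedAlgebra ℚ ((ι → ℝ) × ℝ →L[ℝ] (ι → ℝ) × ℝ) := NormedAlgebra.restrictScalars ℚ ℝ _
  exact (b.semiconjBy_rep t x).exp_right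

/-- The extended dilation intertwines the operators of a point and of its dilate. It is not
invertible for `t = 0`, so the identity is read off at `(0, 1)`, which it fixes and which determines
the point. -/
theorem dilation_groupMul (t : ℝ) (x y : ι → ℝ) :
    b.dilation t (groupMul b.X x y) = groupMul b.X (b.dilation t x) (b.dilation t y) := by
  have h1 := b.semiconjBy_rep t (groupMul b.X x y)
  have h2 := (((b.semiconjBy_expRep t x).mul_right (b.semiconjBy_expRep t y)).sub_right
    (SemiconjBy.one_right _)).nilLog b.logOrder
  rw [← rep_groupMul, ← rep_groupMul] at h2
  have h3 := h1.eq.symm.trans h2.eq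
  have h4 : b.repDilation t (0, 1) = (0, 1) := by simp [repDilation]
  have h5 := congrArg (fun T => T (0, 1)) h3
  simp only [ContinuousLinearMap.mul_def, ContinuousLinearMap.comp_apply, h4] at h5
  rw [← b.repInv_rep (b.dilation t _), ← b.repInv_rep (groupMul b.X (b.dilation t x) _)]
  ext i
  rw [repInv_apply, h5, repInv_apply]

/-! ### Leading terms -/

theorem nilLog_sub_mem_raise {k : ℕ} {N : (ι → ℝ) × ℝ →L[ℝ] (ι → ℝ) × ℝ} (h : N ∈ b.raise k) :
    nilLog b.logOrder N - N ∈ b.raise (2 * k) := by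
  rw [nilLog, logOrder, Finset.sum_range_succ']
  simp only [pow_zero, Nat.cast_zero, zero_add, div_one, one_smul, pow_one, add_sub_cancel_right]
  exact sum_mem fun m _ => Submodule.smul_mem _ _
    (b.raise_antitone (Nat.mul_le_mul_right k (by omega)) (b.pow_mem_raise h (m + 1 + 1)))

theorem expRep_sub_rep_mem_raise {k : ℕ} {x : ι → ℝ} (hx : x ∈ b.filt k) :
    b.expRep x - 1 - b.rep x ∈ b.raise (2 * k) := by
  have h := b.nilLog_sub_mem_raise (b.expRep_sub_one_mem_raise hx)
  rw [nilLog_expRep] at h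
  rw [← neg_sub]
  exact neg_mem h

theorem _root_.sub_mul_sub_one_add_eq {R : Type*} [Ring R] (L P Q X Y : R) :
    L - (P * Q - 1) + (P - 1) * (Q - 1) + (P - 1 - X + (Q - 1 - Y)) = L - (X + Y) := by
  noncomm_ring

theorem _root_.mul_mul_sub_one_eq_commutator {R : Type*} [Ring R] {P Q V : R} (h : Q * P * V = 1) :
    P * Q * V - 1 = ((P - 1) * (Q - 1) - (Q - 1) * (P - 1)) * (V - 1) +
      ((P - 1) * (Q - 1) - (Q - 1) * (P - 1)) := by
  have e : (P - 1) * (Q - 1) - (Q - 1) * (P - 1) = P * Q - Q * P := by noncomm_ring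
  rw [e, mul_sub, mul_one, sub_add_cancel, sub_mul, h]

theorem _root_.commutator_sub_commutator {R : Type*} [Ring R] (p q X Y : R) :
    (p * q - q * p) - (X * Y - Y * X) =
      ((p - X) * q + X * (q - Y)) - ((q - Y) * X + q * (p - X)) := by
  noncomm_ring

/-- For operators of order `k`, the nonlinear terms of the exponentials, of the product and of the
logarithm all have order at least `2 k`. -/
theorem groupMul_sub_mem_filt {k : ℕ} {x y : ι → ℝ} (hx : x ∈ b.filt k) (hy : y ∈ b.filt k) :
    groupMul b.X x y - (x + y) ∈ b.filt (2 * k) := by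
  refine b.mem_filt_of_rep_mem_raise ?_
  have hx1 := b.expRep_sub_one_mem_raise hx
  have hy1 := b.expRep_sub_one_mem_raise hy
  have h := b.nilLog_sub_mem_raise (b.mul_sub_one_mem_raise hx1 hy1)
  have h3 : (b.expRep x - 1) * (b.expRep y - 1) ∈ b.raise (2 * k) := by
    rw [two_mul]; exact b.mul_mem_raise hx1 hy1
  have := add_mem (add_mem h h3) (add_mem (b.expRep_sub_rep_mem_raise hx)
    (b.expRep_sub_rep_mem_raise hy))
  rwa [sub_mul_sub_one_add_eq, ← map_add, ← rep_groupMul, ← map_sub] at this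

theorem groupMul_mem_filt {k : ℕ} {x y : ι → ℝ} (hx : x ∈ b.filt k) (hy : y ∈ b.filt k) :
    groupMul b.X x y ∈ b.filt k := by
  have := add_mem (b.filt_antitone (by omega) (b.groupMul_sub_mem_filt hx hy)) (add_mem hx hy)
  rwa [sub_add_cancel] at this

/-- The group commutator. -/
noncomputable def commutator (x y : ι → ℝ) : ι → ℝ :=
  groupMul b.X (groupMul b.X x y) (groupMul b.X (-x) (-y))

/-- Since `V = (Q P)⁻¹`, one has `P Q V - 1 = (P Q - Q P) V`. The commutator has order `k + 1`, and
replacing `V` by `1`, `P - 1` by `X`, `Q - 1` by `Y` or the logarithm by its linear term changes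
only order `k + 2`. -/
theorem commutator_mem_raise {k : ℕ} (hk : 1 ≤ k)
    {P Q V X Y : (ι → ℝ) × ℝ →L[ℝ] (ι → ℝ) × ℝ} (h : Q * P * V = 1) (hP : P - 1 ∈ b.raise 1)
    (hQ : Q - 1 ∈ b.raise k) (hV : V - 1 ∈ b.raise 1) (hX : X ∈ b.raise 1)
    (hPX : P - 1 - X ∈ b.raise 2) (hQY : Q - 1 - Y ∈ b.raise (k + 1)) :
    nilLog b.logOrder (P * Q * V - 1) - (X * Y - Y * X) ∈ b.raise (k + 2) := by
  have hc : (P - 1) * (Q - 1) - (Q - 1) * (P - 1) ∈ b.raise (k + 1) := by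
    refine sub_mem ?_ (b.mul_mem_raise hQ hP)
    rw [add_comm]; exact b.mul_mem_raise hP hQ
  have hN : P * Q * V - 1 - ((P - 1) * (Q - 1) - (Q - 1) * (P - 1)) ∈ b.raise (k + 2) := by
    rw [mul_mul_sub_one_eq_commutator h, add_sub_cancel_right]
    have := b.mul_mem_raise hc hV
    exact this
  have hN1 : P * Q * V - 1 ∈ b.raise (k + 1) := by
    have := add_mem (b.raise_antitone (by omega) hN) hc
    rwa [sub_add_cancel] at this
  have hl := b.raise_antitone (by omega : k + 2 ≤ 2 * (k + 1)) (b.nilLog_sub_mem_raise hN1)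
  have hb : ((P - 1) * (Q - 1) - (Q - 1) * (P - 1)) - (X * Y - Y * X) ∈ b.raise (k + 2) := by
    rw [commutator_sub_commutator]
    refine sub_mem (add_mem ?_ ?_) (add_mem ?_ ?_)
    · rw [add_comm]; exact b.mul_mem_raise hPX hQ
    · have := b.mul_mem_raise hX hQY
      rwa [show 1 + (k + 1) = k + 2 by ring] at this
    · have := b.mul_mem_raise hQY hX
      exact this
    · exact b.mul_mem_raise hQ hPX
  have := add_mem (add_mem hl hN) hb
  rwa [sub_add_sub_cancel, sub_add_sub_cancel] at this

theorem commutator_sub_bracket_mem_filt {k : ℕ} (hk : 1 ≤ k) {x y : ι → ℝ} (hy : y ∈ b.filt k) :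
    b.commutator x y - b.bracket x y ∈ b.filt (k + 2) := by
  refine b.mem_filt_of_rep_mem_raise ?_
  have hx := b.mem_filt_one x
  have hYX : b.expRep y * b.expRep x * (b.expRep (-x) * b.expRep (-y)) = 1 := by
    rw [mul_assoc, ← mul_assoc (b.expRep x), ← expRep_groupMul b x (-x), groupMul_neg,
      expRep_zero, one_mul, ← expRep_groupMul, groupMul_neg, expRep_zero]
  have e : b.rep (b.commutator x y - b.bracket x y) = nilLog b.logOrder (b.expRep x * b.expRep y *
      (b.expRep (-x) * b.expRep (-y)) - 1) - (b.rep x * b.rep y - b.rep y * b.rep x) := by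
    rw [map_sub, rep_bracket, commutator, rep_groupMul, expRep_groupMul, expRep_groupMul]
  rw [e]
  have hV := b.mul_sub_one_mem_raise (b.expRep_sub_one_mem_raise (b.mem_filt_one (-x)))
    (b.expRep_sub_one_mem_raise (b.mem_filt_one (-y)))
  have hQY : b.expRep y - 1 - b.rep y ∈ b.raise (k + 1) :=
    b.raise_antitone (by omega) (b.expRep_sub_rep_mem_raise hy)
  have hPX : b.expRep x - 1 - b.rep x ∈ b.raise 2 := by
    have h := b.expRep_sub_rep_mem_raise hx
    rwa [mul_one] at h
  exact b.commutator_mem_raise hk hYX (b.expRep_sub_one_mem_raise hx)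
    (b.expRep_sub_one_mem_raise hy) hV (b.rep_mem_raise hx) hPX hQY

/-! ### The differential of a left translation -/

theorem hasDerivAt_groupMul_smul (x y : ι → ℝ) (t : ℝ) :
    HasDerivAt (fun s : ℝ => groupMul b.X x (s • y)) (b.bchVelocity x y t) t := by
  simp only [groupMul_eq]
  have := b.repInv.hasFDerivAt.comp_hasDerivAt t (b.hasDerivAt_nilLog_expRep_mul x y t)
  rwa [repInv_rep] at this

theorem fderiv_groupMul_zero_apply (x y : ι → ℝ) :
    fderiv ℝ (groupMul b.X x) 0 y = b.bchVelocity x y 0 := by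
  have h1 : HasFDerivAt (groupMul b.X x) (fderiv ℝ (groupMul b.X x) 0) ((0 : ℝ) • y) := by
    rw [zero_smul]
    exact ((b.contDiff_groupMul_right x).differentiable (by simp) 0).hasFDerivAt
  have h2 := h1.comp_hasDerivAt (0 : ℝ) ((hasDerivAt_id (0 : ℝ)).smul_const y)
  rw [one_smul] at h2
  exact h2.unique (b.hasDerivAt_groupMul_smul x y 0)

theorem det_one_add_of_isNilpotent {V : Type*} [AddCommGroup V] [Module ℝ V]
    [Module.Finite ℝ V] {T : Module.End ℝ V} (h : IsNilpotent T) :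
    LinearMap.det (1 + T) = 1 := by
  have h1 := LinearMap.eval_charpoly (-T) 1
  rw [LinearMap.isNilpotent_iff_charpoly (-T) |>.1 h.neg] at h1
  simpa using h1.symm

/-- In the basis, the differential is `ψ` of a unipotent operator, that is `1` plus a nilpotent. -/
theorem det_fderiv_groupMul_zero (x : ι → ℝ) : (fderiv ℝ (groupMul b.X x) 0).det = 1 := by
  have : Module.Finite ℝ 𝔤 := Module.Finite.of_basis b.X
  set A := expAd (b.X.equivFun.symm x) * expAd (0 : 𝔤) with hA
  have h1 : ((fderiv ℝ (groupMul b.X x) 0 : (ι → ℝ) →L[ℝ] (ι → ℝ)) : (ι → ℝ) →ₗ[ℝ] (ι → ℝ)) =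
      (b.X.equivFun : 𝔤 →ₗ[ℝ] (ι → ℝ)) ∘ₗ bchPsi A ∘ₗ (b.X.equivFun.symm : (ι → ℝ) →ₗ[ℝ] 𝔤) := by
    refine LinearMap.ext fun y => ?_
    change fderiv ℝ (groupMul b.X x) 0 y = _
    rw [fderiv_groupMul_zero_apply, bchVelocity, zero_smul]
    rfl
  rw [ContinuousLinearMap.det, h1, LinearMap.det_conj, bchPsi]
  refine det_one_add_of_isNilpotent ?_
  have hnil : IsNilpotent (A - 1) := b.isNilpotent_expAd_mul_sub_one _ _
  have e : ∑ m ∈ Finset.Icc 1 (Module.finrank ℝ 𝔤),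
      ((-1 : ℝ) ^ (m + 1) / ((m : ℝ) * ((m : ℝ) + 1))) • (A - 1) ^ m = (A - 1) *
      ∑ m ∈ Finset.Icc 1 (Module.finrank ℝ 𝔤),
      ((-1 : ℝ) ^ (m + 1) / ((m : ℝ) * ((m : ℝ) + 1))) • (A - 1) ^ (m - 1) := by
    rw [Finset.mul_sum]
    refine Finset.sum_congr rfl fun m hm => ?_
    rw [mul_smul_comm, ← pow_succ', Nat.sub_add_cancel (Finset.mem_Icc.1 hm).1]
  rw [e]
  refine Commute.isNilpotent_mul_right ?_ hnil
  exact Commute.sum_right _ _ _ fun _ _ => ((Commute.refl _).pow_right _).smul_right _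

/-- The chain rule for composed translations. It expresses left invariance of the fields and reduces
the Jacobian at `h` to the one at the origin. -/
theorem fderiv_groupMul_comp (x h : ι → ℝ) :
    (fderiv ℝ (groupMul b.X x) h).comp (fderiv ℝ (groupMul b.X h) 0) =
      fderiv ℝ (groupMul b.X (groupMul b.X x h)) 0 := by
  have hd : ∀ x y, HasFDerivAt (groupMul b.X x) (fderiv ℝ (groupMul b.X x) y) y := fun x y =>
    ((b.contDiff_groupMul_right x).differentiable (by simp) y).hasFDerivAt
  have h1 : HasFDerivAt (groupMul b.X x) (fderiv ℝ (groupMul b.X x) h) (groupMul b.X h 0) := by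
    rw [groupMul_zero]; exact hd x h
  have h2 := h1.comp 0 (hd h 0)
  have e : groupMul b.X x ∘ groupMul b.X h = groupMul b.X (groupMul b.X x h) := by
    funext z; exact (b.groupMul_assoc x h z).symm
  rw [e] at h2
  exact h2.unique (hd _ 0)

theorem det_fderiv_groupMul (x h : ι → ℝ) : (fderiv ℝ (groupMul b.X x) h).det = 1 := by
  have h1 := congrArg ContinuousLinearMap.det (b.fderiv_groupMul_comp x h)
  rw [det_fderiv_groupMul_zero] at h1
  have h2 : ((fderiv ℝ (groupMul b.X x) h).comp (fderiv ℝ (groupMul b.X h) 0)).det =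
      (fderiv ℝ (groupMul b.X x) h).det * (fderiv ℝ (groupMul b.X h) 0).det :=
    LinearMap.det_comp _ _
  rwa [h2, det_fderiv_groupMul_zero, mul_one] at h1

theorem measurePreserving_groupMul (x : ι → ℝ) :
    MeasurePreserving (groupMul b.X x) volume volume := by
  have hcont : Continuous (groupMul b.X x) := (b.leftTranslate x).continuous
  refine ⟨hcont.measurable, ?_⟩
  refine Measure.ext fun s hs => ?_
  rw [Measure.map_apply hcont.measurable hs]
  have e : groupMul b.X x ⁻¹' s = groupMul b.X (-x) '' s :=
    ((b.leftTranslate x).toEquiv.image_symm_eq_preimage s).symm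
  rw [e]
  have := lintegral_abs_det_fderiv_eq_addHaar_image volume hs
    (f := groupMul b.X (-x)) (f' := fderiv ℝ (groupMul b.X (-x)))
    (fun y _ => ((b.contDiff_groupMul_right (-x)).differentiable (by simp)
      y).hasFDerivAt.hasFDerivWithinAt)
    ((b.leftTranslate x).symm.injective.injOn)
  rw [← this]
  simp [det_fderiv_groupMul]

end AdaptedBasis

end GroupStructure

/-! ### Absolutely continuous and Lipschitz curves. -/

section LipschitzCurves

open Set
open scoped NNReal

theorem AbsolutelyContinuousOnInterval.of_dist_le {X Y : Type*} [PseudoMetricSpace X]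
    [PseudoMetricSpace Y] {f : ℝ → X} {g : ℝ → Y} {a b : ℝ}
    (hf : AbsolutelyContinuousOnInterval f a b) (h : ∀ s t, dist (g s) (g t) ≤ dist (f s) (f t)) :
    AbsolutelyContinuousOnInterval g a b := by
  rw [absolutelyContinuousOnInterval_iff] at *
  intro ε hε
  obtain ⟨δ, hδ, H⟩ := hf ε hε
  exact ⟨δ, hδ, fun E hE hE' => (Finset.sum_le_sum fun i _ => h _ _).trans_lt (H E hE hE')⟩

theorem AbsolutelyContinuousOnInterval.lipschitzOnWith_of_ae_hasDerivAt {ι : Type*} [Fintype ι]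
    {f : ℝ → ι → ℝ} {a b : ℝ} {C : ℝ≥0} (hf : AbsolutelyContinuousOnInterval f a b)
    (h : ∀ᵐ t, t ∈ uIcc a b → ∃ v, ‖v‖ ≤ C ∧ HasDerivAt f v t) :
    LipschitzOnWith C f (uIcc a b) := by
  refine LipschitzOnWith.of_dist_le_mul fun s hs t ht => ?_
  rw [dist_pi_le_iff (by positivity)]
  intro i
  have hi : AbsolutelyContinuousOnInterval (fun t => f t i) t s :=
    (hf.mono (uIcc_subset_uIcc ht hs)).of_dist_le fun _ _ => dist_le_pi_dist _ _ i
  rw [Real.dist_eq, ← hi.integral_deriv_eq_sub, Real.dist_eq, ← Real.norm_eq_abs]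
  refine intervalIntegral.norm_integral_le_of_norm_le_const_ae ?_
  filter_upwards [h] with x hx hx'
  obtain ⟨v, hv, hd⟩ := hx (uIcc_subset_uIcc ht hs (uIoc_subset_uIcc hx'))
  rw [((hasDerivAt_pi.1 hd) i).deriv]
  exact (norm_le_pi_norm v i).trans hv

theorem LipschitzOnWith.union_Icc {X : Type*} [PseudoMetricSpace X] {f : ℝ → X} {a b c : ℝ}
    {K : ℝ≥0} (h1 : LipschitzOnWith K f (Icc a b)) (h2 : LipschitzOnWith K f (Icc b c)) :
    LipschitzOnWith K f (Icc a c) := by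
  have key : ∀ s ∈ Icc a c, ∀ t ∈ Icc a c, s ≤ t → dist (f s) (f t) ≤ K * dist s t := by
    intro s hs t ht hst
    rcases le_total t b with htb | htb
    · exact h1.dist_le_mul s ⟨hs.1, hst.trans htb⟩ t ⟨ht.1, htb⟩
    rcases le_total s b with hsb | hsb
    · have hb1 := h1.dist_le_mul s ⟨hs.1, hsb⟩ b ⟨hs.1.trans hsb, le_rfl⟩
      have hb2 := h2.dist_le_mul b ⟨le_rfl, htb.trans ht.2⟩ t ⟨htb, ht.2⟩
      have e : dist s t = dist s b + dist b t := by
        rw [Real.dist_eq, Real.dist_eq, Real.dist_eq, abs_of_nonpos (by linarith),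
          abs_of_nonpos (by linarith), abs_of_nonpos (by linarith)]
        ring
      rw [e, mul_add]
      exact (dist_triangle _ _ _).trans (add_le_add hb1 hb2)
    · exact h2.dist_le_mul s ⟨hsb, hs.2⟩ t ⟨htb, ht.2⟩
  refine LipschitzOnWith.of_dist_le_mul fun s hs t ht => ?_
  rcases le_total s t with h | h
  · exact key s hs t ht h
  · rw [dist_comm (f s), dist_comm s]
    exact key t ht s hs h

end LipschitzCurves

/-! ### Subunit curves and the Carnot–Carathéodory distance. -/

section Metric

open Set
open scoped NNReal

variable {𝔤 : Type*} [LieRing 𝔤] [LieAlgebra ℝ 𝔤] {S : Stratification 𝔤} {ι : Type*} [Fintype ι]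

namespace AdaptedBasis

variable (b : AdaptedBasis S ι)

/-- The unit ball of the first layer. -/
def horizontal : Set (ι → ℝ) :=
  {u | (∀ i, b.layer i ≠ 1 → u i = 0) ∧ ∑ i with b.layer i = 1, u i ^ 2 ≤ 1}

/-- The differential at the origin of the left translation by `g`. -/
noncomputable def dLeft (g : ι → ℝ) : (ι → ℝ) →L[ℝ] (ι → ℝ) := fderiv ℝ (groupMul b.X g) 0

theorem hasFDerivAt_groupMul (x y : ι → ℝ) :
    HasFDerivAt (groupMul b.X x) (fderiv ℝ (groupMul b.X x) y) y :=
  ((b.contDiff_groupMul_right x).differentiable (by simp) y).hasFDerivAt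

theorem leftField_eq (i : ι) (g : ι → ℝ) : leftField b.X i g = b.dLeft g (b.X.equivFun (b.X i)) := by
  rw [leftField, (b.hasDerivAt_groupMul_smul g (b.X.equivFun (b.X i)) 0).deriv, dLeft,
    fderiv_groupMul_zero_apply]

theorem exists_subunit_iff (g v : ι → ℝ) : (∃ a : ι → ℝ, ∑ i with b.layer i = 1, a i ^ 2 ≤ 1 ∧
    v = ∑ i with b.layer i = 1, a i • leftField b.X i g) ↔ ∃ u ∈ b.horizontal, v = b.dLeft g u := by
  classical
  have key : ∀ a : ι → ℝ, ∑ i with b.layer i = 1, a i • leftField b.X i g =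
      b.dLeft g (fun i => if b.layer i = 1 then a i else 0) := by
    intro a
    have e : (fun i => if b.layer i = 1 then a i else 0) =
        ∑ i with b.layer i = 1, a i • b.X.equivFun (b.X i) := by
      ext j
      simp only [Finset.sum_apply, Pi.smul_apply, Module.Basis.equivFun_apply,
        Module.Basis.repr_self, smul_eq_mul, Finsupp.single_apply]
      rw [Finset.sum_filter, Finset.sum_eq_single j]
      · simp
      · intro i _ hij; simp [hij]
      · simp
    rw [e, map_sum]
    simp only [leftField_eq, map_smul]
  constructor
  · rintro ⟨a, ha, rfl⟩
    refine ⟨_, ⟨fun i hi => if_neg hi, ?_⟩, key a⟩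
    refine (Finset.sum_congr rfl fun i hi => ?_).trans_le ha
    rw [if_pos (Finset.mem_filter.1 hi).2]
  · rintro ⟨u, hu, rfl⟩
    refine ⟨u, hu.2, ?_⟩
    rw [key]
    congr 1
    ext i
    split_ifs with h
    · rfl
    · exact hu.1 i h

theorem norm_le_one_of_mem_horizontal {u : ι → ℝ} (hu : u ∈ b.horizontal) : ‖u‖ ≤ 1 := by
  rw [pi_norm_le_iff_of_nonneg zero_le_one]
  intro i
  by_cases h : b.layer i = 1
  · rw [Real.norm_eq_abs, ← sq_le_one_iff_abs_le_one]
    exact (Finset.single_le_sum (f := fun i => u i ^ 2) (fun i _ => sq_nonneg _)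
      (Finset.mem_filter.2 ⟨Finset.mem_univ i, h⟩)).trans hu.2
  · rw [hu.1 i h]; simp

theorem neg_mem_horizontal {u : ι → ℝ} (hu : u ∈ b.horizontal) : -u ∈ b.horizontal :=
  ⟨fun i hi => by simp [hu.1 i hi], by simpa using hu.2⟩

theorem zero_mem_horizontal : (0 : ι → ℝ) ∈ b.horizontal := ⟨fun _ _ => rfl, by simp⟩

theorem continuous_dLeft : Continuous b.dLeft := by
  have h : ContDiff ℝ ∞ (Function.uncurry fun x y => groupMul b.X x y) := b.contDiff_groupMul
  exact (ContDiff.fderiv (m := ∞) (n := 0) h (contDiff_const (c := (0 : ι → ℝ))) (by simp)).continuous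

/-- The curve has compact image, where the differentials of the left translations are bounded, so
its velocity is bounded. The Lipschitz form is easier to reverse, concatenate and push forward. -/
theorem isSubunit_iff {γ : ℝ → ι → ℝ} {T : ℝ} (hT : 0 ≤ T) : IsSubunit b γ T ↔
    (∃ K, LipschitzOnWith K γ (Icc 0 T)) ∧
      ∀ᵐ t ∂volume, t ∈ Icc 0 T → ∃ u ∈ b.horizontal, HasDerivAt γ (b.dLeft (γ t) u) t := by
  have e : ∀ t, (∃ a : ι → ℝ, ∑ i with b.layer i = 1, a i ^ 2 ≤ 1 ∧
      HasDerivAt γ (∑ i with b.layer i = 1, a i • leftField b.X i (γ t)) t) ↔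
      ∃ u ∈ b.horizontal, HasDerivAt γ (b.dLeft (γ t) u) t := by
    intro t
    constructor
    · rintro ⟨a, ha, h⟩
      obtain ⟨u, hu, hv⟩ := (b.exists_subunit_iff (γ t) _).1 ⟨a, ha, rfl⟩
      exact ⟨u, hu, hv ▸ h⟩
    · rintro ⟨u, hu, h⟩
      obtain ⟨a, ha, hv⟩ := (b.exists_subunit_iff (γ t) _).2 ⟨u, hu, rfl⟩
      exact ⟨a, ha, hv ▸ h⟩
  rw [IsSubunit, ae_restrict_iff' measurableSet_Icc]
  simp only [e]
  refine ⟨fun h => ⟨?_, h.2⟩, fun h => ⟨?_, h.2⟩⟩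
  · have hc : ContinuousOn γ (uIcc 0 T) := h.1.continuousOn
    obtain ⟨C, hC⟩ := isCompact_uIcc.exists_bound_of_continuousOn
      (b.continuous_dLeft.comp_continuousOn hc)
    refine ⟨Real.toNNReal C, ?_⟩
    rw [← uIcc_of_le hT]
    refine h.1.lipschitzOnWith_of_ae_hasDerivAt ?_
    filter_upwards [h.2] with t ht ht'
    obtain ⟨u, hu, hd⟩ := ht (by rwa [← uIcc_of_le hT])
    refine ⟨_, ?_, hd⟩
    refine ((b.dLeft (γ t)).le_opNorm u).trans ?_
    refine (mul_le_of_le_one_right (norm_nonneg _) (b.norm_le_one_of_mem_horizontal hu)).trans ?_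
    exact (hC t ht').trans (Real.le_coe_toNNReal C)
  · obtain ⟨K, hK⟩ := h.1
    rw [← uIcc_of_le hT] at hK
    exact hK.absolutelyContinuousOnInterval

theorem ccDist_le {x y : ι → ℝ} {γ : ℝ → ι → ℝ} {T : ℝ} (hT : 0 < T) (hγ : IsSubunit b γ T)
    (h0 : γ 0 = x) (h1 : γ T = y) : ccDist b x y ≤ ENNReal.ofReal T :=
  iInf₂_le_of_le T hT (iInf_le _ ⟨γ, hγ, h0, h1⟩)

theorem exists_of_ccDist_lt {x y : ι → ℝ} {r : ℝ≥0∞} (h : ccDist b x y < r) :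
    ∃ T, 0 < T ∧ ENNReal.ofReal T < r ∧ ∃ γ, IsSubunit b γ T ∧ γ 0 = x ∧ γ T = y := by
  simp only [ccDist, iInf_lt_iff] at h
  obtain ⟨T, hT, hγ, hr⟩ := h
  exact ⟨T, hT, hr, hγ⟩

theorem isSubunit_const (x : ι → ℝ) {T : ℝ} (hT : 0 ≤ T) : IsSubunit b (fun _ => x) T := by
  rw [isSubunit_iff b hT]
  refine ⟨⟨0, (LipschitzWith.const x).lipschitzOnWith⟩, Eventually.of_forall fun t _ =>
    ⟨0, b.zero_mem_horizontal, ?_⟩⟩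
  rw [map_zero]
  exact hasDerivAt_const t x

theorem ccDist_self (x : ι → ℝ) : ccDist b x x = 0 := by
  refine le_antisymm ?_ bot_le
  refine ENNReal.le_of_forall_pos_le_add fun ε hε _ => ?_
  rw [zero_add]
  have := b.ccDist_le (NNReal.coe_pos.2 hε) (b.isSubunit_const x ε.2) rfl rfl
  simpa using this

theorem IsSubunit.reverse {γ : ℝ → ι → ℝ} {T : ℝ} (hT : 0 ≤ T) (h : IsSubunit b γ T) :
    IsSubunit b (fun t => γ (T - t)) T := by
  rw [isSubunit_iff b hT] at *
  obtain ⟨⟨K, hK⟩, h⟩ := h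
  refine ⟨⟨K, LipschitzOnWith.of_dist_le_mul fun s hs t ht => ?_⟩, ?_⟩
  · have := hK.dist_le_mul (T - s) ⟨by linarith [hs.2], by linarith [hs.1]⟩ (T - t)
      ⟨by linarith [ht.2], by linarith [ht.1]⟩
    rwa [dist_sub_left] at this
  · have hmp : MeasurePreserving (fun t : ℝ => T - t) volume volume :=
      Measure.measurePreserving_sub_left volume T
    filter_upwards [hmp.quasiMeasurePreserving.ae h] with t ht ht'
    obtain ⟨u, hu, hd⟩ := ht ⟨by linarith [ht'.2], by linarith [ht'.1]⟩
    refine ⟨-u, b.neg_mem_horizontal hu, ?_⟩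
    rw [map_neg]
    exact hd.comp_const_sub T t

theorem ccDist_le_symm (x y : ι → ℝ) : ccDist b x y ≤ ccDist b y x := by
  refine le_of_forall_gt fun r hr => ?_
  obtain ⟨T, hT, hr, γ, hγ, h0, h1⟩ := b.exists_of_ccDist_lt hr
  exact (b.ccDist_le hT (IsSubunit.reverse b hT.le hγ) (by simpa using h1) (by simpa using h0)).trans_lt hr

theorem ccDist_comm (x y : ι → ℝ) : ccDist b x y = ccDist b y x :=
  le_antisymm (b.ccDist_le_symm x y) (b.ccDist_le_symm y x)

theorem IsSubunit.concat {γ γ' : ℝ → ι → ℝ} {T T' : ℝ} (hT : 0 ≤ T) (hT' : 0 ≤ T')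
    (h : IsSubunit b γ T) (h' : IsSubunit b γ' T') (he : γ T = γ' 0) :
    IsSubunit b (fun t => if t ≤ T then γ t else γ' (t - T)) (T + T') := by
  rw [isSubunit_iff b (by positivity)]
  rw [isSubunit_iff b hT] at h
  rw [isSubunit_iff b hT'] at h'
  obtain ⟨⟨K, hK⟩, h⟩ := h
  obtain ⟨⟨K', hK'⟩, h'⟩ := h'
  refine ⟨⟨max K K', LipschitzOnWith.union_Icc (b := T) ?_ ?_⟩, ?_⟩
  · refine LipschitzOnWith.of_dist_le_mul fun s hs t ht => ?_
    simp only [if_pos hs.2, if_pos ht.2]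
    exact (hK.weaken (le_max_left K K')).dist_le_mul s hs t ht
  · refine LipschitzOnWith.of_dist_le_mul fun s hs t ht => ?_
    have e : ∀ t ∈ Icc T (T + T'), (if t ≤ T then γ t else γ' (t - T)) = γ' (t - T) := by
      intro t ht
      split_ifs with h
      · rw [le_antisymm h ht.1, he, sub_self]
      · rfl
    simp only [e s hs, e t ht]
    have := (hK'.weaken (le_max_right K K')).dist_le_mul (s - T)
      ⟨by linarith [hs.1], by linarith [hs.2]⟩ (t - T) ⟨by linarith [ht.1], by linarith [ht.2]⟩
    simpa using this
  · have hmp : MeasurePreserving (fun t : ℝ => t - T) volume volume :=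
      measurePreserving_sub_right volume T
    have hne : ∀ᵐ t : ℝ ∂volume, t ≠ T := by
      rw [ae_iff]; simp
    filter_upwards [h, hmp.quasiMeasurePreserving.ae h', hne] with t ht ht' htT htm
    rcases lt_or_gt_of_ne htT with hlt | hlt
    · obtain ⟨u, hu, hd⟩ := ht ⟨htm.1, hlt.le⟩
      refine ⟨u, hu, ?_⟩
      rw [if_pos hlt.le]
      refine hd.congr_of_eventuallyEq ?_
      filter_upwards [Iio_mem_nhds hlt] with s hs
      exact if_pos (le_of_lt hs)
    · obtain ⟨u, hu, hd⟩ := ht' ⟨by linarith, by linarith [htm.2]⟩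
      refine ⟨u, hu, ?_⟩
      rw [if_neg (not_le.2 hlt)]
      refine (hd.comp_sub_const t T).congr_of_eventuallyEq ?_
      filter_upwards [Ioi_mem_nhds hlt] with s hs
      exact if_neg (not_le.2 hs)

theorem ccDist_triangle (x y z : ι → ℝ) : ccDist b x z ≤ ccDist b x y + ccDist b y z := by
  by_cases h1 : ccDist b x y = ⊤
  · simp [h1]
  by_cases h2 : ccDist b y z = ⊤
  · simp [h2]
  refine ENNReal.le_of_forall_pos_le_add fun ε hε _ => ?_
  have hε' : (ε / 2 : ℝ≥0∞) ≠ 0 := by simpa using hε.ne'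
  obtain ⟨T, hT, hr, γ, hγ, h0, hT1⟩ := b.exists_of_ccDist_lt (ENNReal.lt_add_right h1 hε')
  obtain ⟨T', hT', hr', γ', hγ', h0', hT1'⟩ := b.exists_of_ccDist_lt (ENNReal.lt_add_right h2 hε')
  have := b.ccDist_le (add_pos hT hT') (IsSubunit.concat b hT.le hT'.le hγ hγ' (hT1.trans h0'.symm))
    (x := x) (y := z) (by simp [hT.le, h0]) (by simp [hT', hT1'])
  rw [ENNReal.ofReal_add hT.le hT'.le] at this
  refine (this.trans (add_le_add hr.le hr'.le)).trans_eq ?_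
  rw [add_add_add_comm, ENNReal.add_halves]

/-- Serves left translations (`l = 1`) and dilations alike: `φ` multiplies horizontal velocities by
`l`, and the slower parametrisation on `[0, l T]` compensates. -/
theorem IsSubunit.map {γ : ℝ → ι → ℝ} {T l : ℝ} (hT : 0 ≤ T) (hl : 0 < l) (h : IsSubunit b γ T)
    {φ : (ι → ℝ) → (ι → ℝ)} (hφ : ContDiff ℝ ∞ φ)
    (hd : ∀ g, ∀ u ∈ b.horizontal, fderiv ℝ φ g (b.dLeft g u) = l • b.dLeft (φ g) u) :
    IsSubunit b (fun t => φ (γ (l⁻¹ * t))) (l * T) := by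
  rw [isSubunit_iff b (by positivity)]
  rw [isSubunit_iff b hT] at h
  obtain ⟨⟨K, hK⟩, h⟩ := h
  obtain ⟨R, hR⟩ := (isCompact_Icc.image_of_continuousOn hK.continuousOn).isBounded.subset_closedBall
    (0 : ι → ℝ)
  obtain ⟨K', hK'⟩ := hφ.contDiffOn.exists_lipschitzOnWith (by simp)
    (convex_closedBall (0 : ι → ℝ) R) (isCompact_closedBall _ _)
  have hm : ∀ t ∈ Icc 0 (l * T), l⁻¹ * t ∈ Icc 0 T := fun t ht =>
    ⟨mul_nonneg (inv_nonneg.2 hl.le) ht.1, by rw [inv_mul_le_iff₀ hl]; exact ht.2⟩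
  refine ⟨⟨K' * (K * Real.toNNReal l⁻¹), LipschitzOnWith.of_dist_le_mul fun s hs t ht => ?_⟩, ?_⟩
  · have h1 := hK'.dist_le_mul _ (hR ⟨_, hm s hs, rfl⟩) _ (hR ⟨_, hm t ht, rfl⟩)
    have h2 := hK.dist_le_mul _ (hm s hs) _ (hm t ht)
    have h3 : dist (l⁻¹ * s) (l⁻¹ * t) = l⁻¹ * dist s t := by
      rw [Real.dist_eq, Real.dist_eq, ← mul_sub, abs_mul, abs_of_pos (inv_pos.2 hl)]
    rw [h3] at h2
    push_cast
    rw [Real.coe_toNNReal _ (inv_nonneg.2 hl.le), mul_assoc, mul_assoc]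
    exact h1.trans (mul_le_mul_of_nonneg_left h2 K'.2)
  · have hq : Measure.QuasiMeasurePreserving (fun t : ℝ => l⁻¹ * t) volume volume := by
      refine ⟨measurable_const_mul _, ?_⟩
      rw [Real.map_volume_mul_left (inv_ne_zero hl.ne')]
      exact Measure.smul_absolutelyContinuous
    filter_upwards [hq.ae h] with t ht ht'
    obtain ⟨u, hu, hγ⟩ := ht (hm t ht')
    refine ⟨u, hu, ?_⟩
    have h1 : HasDerivAt (fun t : ℝ => γ (l⁻¹ * t)) (l⁻¹ • b.dLeft (γ (l⁻¹ * t)) u) t := by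
      have := hγ.scomp t ((hasDerivAt_id t).const_mul l⁻¹)
      rwa [mul_one] at this
    have h2 := ((hφ.differentiable (by simp) (γ (l⁻¹ * t))).hasFDerivAt).comp_hasDerivAt t h1
    rwa [map_smul, hd _ u hu, inv_smul_smul₀ hl.ne'] at h2

theorem ccDist_map_le {l : ℝ} (hl : 0 < l)
    {φ : (ι → ℝ) → (ι → ℝ)} (hφ : ContDiff ℝ ∞ φ)
    (hd : ∀ g, ∀ u ∈ b.horizontal, fderiv ℝ φ g (b.dLeft g u) = l • b.dLeft (φ g) u)
    (x y : ι → ℝ) : ccDist b (φ x) (φ y) ≤ ENNReal.ofReal l * ccDist b x y := by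
  refine le_of_forall_gt fun r hr => ?_
  have hl' : ENNReal.ofReal l ≠ 0 := by simpa using hl
  have hr' : ccDist b x y < r / ENNReal.ofReal l := by
    rwa [ENNReal.lt_div_iff_mul_lt (Or.inl hl') (Or.inl ENNReal.ofReal_ne_top), mul_comm]
  obtain ⟨T, hT, hTr, γ, hγ, h0, h1⟩ := b.exists_of_ccDist_lt hr'
  refine (b.ccDist_le (mul_pos hl hT) (IsSubunit.map b hT.le hl hγ hφ hd) (by simp [h0])
    (by simp [hl.ne', h1])).trans_lt ?_
  rw [ENNReal.ofReal_mul hl.le, mul_comm]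
  rwa [ENNReal.lt_div_iff_mul_lt (Or.inl hl') (Or.inl ENNReal.ofReal_ne_top)] at hTr

theorem ccDist_groupMul_le (g x y : ι → ℝ) :
    ccDist b (groupMul b.X g x) (groupMul b.X g y) ≤ ccDist b x y := by
  have := b.ccDist_map_le one_pos (b.contDiff_groupMul_right g) (fun h u _ => by
    rw [one_smul]
    exact congrArg (fun A => A u) (b.fderiv_groupMul_comp g h)) x y
  simpa using this

theorem ccDist_groupMul (g x y : ι → ℝ) :
    ccDist b (groupMul b.X g x) (groupMul b.X g y) = ccDist b x y := by
  refine le_antisymm (b.ccDist_groupMul_le g x y) ?_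
  have := b.ccDist_groupMul_le (-g) (groupMul b.X g x) (groupMul b.X g y)
  rwa [neg_groupMul_cancel, neg_groupMul_cancel] at this

theorem dilation_horizontal (t : ℝ) {u : ι → ℝ} (hu : u ∈ b.horizontal) :
    b.dilation t u = t • u := by
  ext i
  rw [dilation_apply, Pi.smul_apply, smul_eq_mul]
  by_cases h : b.layer i = 1
  · rw [h, pow_one]
  · rw [hu.1 i h]; simp

theorem contDiff_dilation (t : ℝ) : ContDiff ℝ ∞ (b.dilation t) :=
  (LinearMap.toContinuousLinearMap (b.dilation t)).contDiff

theorem dilation_dLeft (t : ℝ) (g u : ι → ℝ) :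
    b.dilation t (b.dLeft g u) = b.dLeft (b.dilation t g) (b.dilation t u) := by
  set δ := LinearMap.toContinuousLinearMap (b.dilation t) with hδ
  have h1 : HasFDerivAt (fun y => b.dilation t (groupMul b.X g y)) (δ.comp (b.dLeft g)) 0 :=
    δ.hasFDerivAt.comp 0 (b.hasFDerivAt_groupMul g 0)
  have h2 : HasFDerivAt (groupMul b.X (b.dilation t g)) (b.dLeft (b.dilation t g)) (δ 0) := by
    rw [map_zero]; exact b.hasFDerivAt_groupMul _ 0
  have h3 := h2.comp 0 δ.hasFDerivAt
  have e : (fun y => b.dilation t (groupMul b.X g y)) = groupMul b.X (b.dilation t g) ∘ δ := by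
    funext y; exact b.dilation_groupMul t g y
  rw [e] at h1
  exact congrArg (fun A => A u) (h1.unique h3)

theorem ccDist_dilation_le {t : ℝ} (ht : 0 < t) (x y : ι → ℝ) :
    ccDist b (b.dilation t x) (b.dilation t y) ≤ ENNReal.ofReal t * ccDist b x y := by
  refine b.ccDist_map_le ht (b.contDiff_dilation t) (fun g u hu => ?_) x y
  have : fderiv ℝ (b.dilation t) g = LinearMap.toContinuousLinearMap (b.dilation t) :=
    (LinearMap.toContinuousLinearMap (b.dilation t)).fderiv
  rw [this]
  change b.dilation t (b.dLeft g u) = _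
  rw [dilation_dLeft, b.dilation_horizontal t hu, map_smul]

theorem dilation_dilation (s t : ℝ) (x : ι → ℝ) :
    b.dilation s (b.dilation t x) = b.dilation (s * t) x := by
  ext i; simp [mul_pow, mul_assoc]

theorem dilation_one (x : ι → ℝ) : b.dilation 1 x = x := by ext i; simp

theorem dilation_inv_dilation {t : ℝ} (ht : 0 < t) (x : ι → ℝ) :
    b.dilation t⁻¹ (b.dilation t x) = x := by
  rw [dilation_dilation, inv_mul_cancel₀ ht.ne', dilation_one]

theorem dilation_dilation_inv {t : ℝ} (ht : 0 < t) (x : ι → ℝ) :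
    b.dilation t (b.dilation t⁻¹ x) = x := by
  rw [dilation_dilation, mul_inv_cancel₀ ht.ne', dilation_one]

theorem ccDist_zero_groupMul (x y : ι → ℝ) :
    ccDist b 0 (groupMul b.X x y) ≤ ccDist b 0 x + ccDist b 0 y := by
  refine (b.ccDist_triangle 0 x _).trans (add_le_add le_rfl ?_)
  conv_lhs => rw [← b.groupMul_zero x, groupMul_assoc, ccDist_groupMul, zero_groupMul]

theorem ccDist_zero_neg (x : ι → ℝ) : ccDist b 0 (-x) = ccDist b 0 x := by
  rw [ccDist_comm, ← b.ccDist_groupMul x, groupMul_neg, groupMul_zero]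

theorem ccDist_eq (x y : ι → ℝ) : ccDist b x y = ccDist b 0 (groupMul b.X (-x) y) := by
  rw [← b.ccDist_groupMul (-x) x y, neg_groupMul]

/-- The straight line `t ↦ t • u` is a one-parameter subgroup, hence an integral curve of the
left-invariant field of `u`. -/
theorem ccDist_zero_smul_horizontal {u : ι → ℝ} (hu : u ∈ b.horizontal) {T : ℝ} (hT : 0 < T) :
    ccDist b 0 (T • u) ≤ ENNReal.ofReal T := by
  refine b.ccDist_le hT ((b.isSubunit_iff hT.le).2 ⟨⟨‖u‖₊, ?_⟩, Eventually.of_forall fun t _ =>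
    ⟨u, hu, ?_⟩⟩) (γ := fun t => t • u) (zero_smul _ _) rfl
  · refine LipschitzOnWith.of_dist_le_mul fun s _ t _ => ?_
    rw [dist_eq_norm, ← sub_smul, norm_smul, Real.dist_eq, mul_comm, coe_nnnorm, Real.norm_eq_abs]
  · have h1 := b.hasDerivAt_groupMul_smul (t • u) u 0
    rw [← fderiv_groupMul_zero_apply] at h1
    have h2 : HasDerivAt (fun s : ℝ => s • u) u t := by
      simpa using (hasDerivAt_id t).smul_const u
    have h3 : (fun s : ℝ => groupMul b.X (t • u) (s • u)) = fun s => (t + s) • u := by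
      funext s
      have := b.groupMul_smul_add 0 u t s
      rwa [zero_groupMul, zero_groupMul] at this
    rw [h3] at h1
    have h4 : HasDerivAt (fun s : ℝ => (t + s) • u) u 0 := by
      simpa using ((hasDerivAt_id (0 : ℝ)).const_add t).smul_const u
    have h5 : b.dLeft (t • u) u = u := h1.unique h4
    rw [h5]
    exact h2

/-- Small balls around the origin are bounded. -/
theorem exists_norm_le_one_of_ccDist_lt :
    ∃ c : ℝ, 0 < c ∧ ∀ x, ccDist b 0 x < ENNReal.ofReal c → ‖x‖ ≤ 1 := by
  obtain ⟨C, hC⟩ := (isCompact_closedBall (0 : ι → ℝ) 1).exists_bound_of_continuousOn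
    b.continuous_dLeft.continuousOn
  set M : ℝ := max C 1 with hM
  have hM0 : 0 < M := lt_max_of_lt_right one_pos
  refine ⟨M⁻¹, inv_pos.2 hM0, fun x hx => ?_⟩
  obtain ⟨T, hT, hTr, γ, hγ, h0, h1⟩ := b.exists_of_ccDist_lt hx
  rw [ENNReal.ofReal_lt_ofReal_iff (inv_pos.2 hM0)] at hTr
  by_contra! hgt
  have hcont : ContinuousOn γ (Icc 0 T) := by
    rw [← uIcc_of_le hT.le]; exact hγ.1.continuousOn
  -- The least element `t₀` is the first exit time from the unit ball. Until then the speed is at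
  -- most `M`, so `t₀ ≥ 1 / M`, which exceeds `T`.
  set A := {t ∈ Icc (0 : ℝ) T | 1 ≤ ‖γ t‖} with hA
  have hAc : IsCompact A := by
    refine isCompact_Icc.of_isClosed_subset ?_ (fun t ht => ht.1)
    exact hcont.norm.preimage_isClosed_of_isClosed isClosed_Icc isClosed_Ici
  obtain ⟨t₀, ht₀, hmin⟩ := hAc.exists_isLeast ⟨T, ⟨hT.le, le_rfl⟩, by rw [h1]; exact hgt.le⟩
  have hle : ∀ t ∈ Ico 0 t₀, ‖γ t‖ < 1 := by
    intro t ht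
    by_contra! h
    exact absurd (hmin ⟨⟨ht.1, ht.2.le.trans ht₀.1.2⟩, h⟩) (not_le.2 ht.2)
  have hsub : uIcc 0 t₀ ⊆ uIcc 0 T := by
    rw [uIcc_of_le ht₀.1.1, uIcc_of_le hT.le]
    exact Icc_subset_Icc_right ht₀.1.2
  have hlip : LipschitzOnWith (Real.toNNReal M) γ (uIcc 0 t₀) := by
    refine (hγ.1.mono hsub).lipschitzOnWith_of_ae_hasDerivAt ?_
    have hne : ∀ᵐ t : ℝ ∂volume, t ≠ t₀ := by rw [ae_iff]; simp
    filter_upwards [((b.isSubunit_iff hT.le).1 hγ).2, hne] with t ht hne ht'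
    obtain ⟨u, hu, hd⟩ := ht (by rw [← uIcc_of_le hT.le]; exact hsub ht')
    refine ⟨_, ?_, hd⟩
    rw [uIcc_of_le ht₀.1.1] at ht'
    refine ((b.dLeft (γ t)).le_opNorm u).trans ?_
    refine (mul_le_of_le_one_right (norm_nonneg _) (b.norm_le_one_of_mem_horizontal hu)).trans ?_
    refine (hC _ ?_).trans ((le_max_left _ _).trans (Real.le_coe_toNNReal M))
    rw [mem_closedBall_zero_iff]
    exact (hle t ⟨ht'.1, lt_of_le_of_ne ht'.2 hne⟩).le
  have := hlip.dist_le_mul t₀ right_mem_uIcc 0 left_mem_uIcc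
  rw [h0, dist_zero_right, Real.coe_toNNReal _ hM0.le, Real.dist_eq, sub_zero,
    abs_of_nonneg ht₀.1.1] at this
  have h2 : M * t₀ < 1 := by
    calc M * t₀ ≤ M * T := mul_le_mul_of_nonneg_left ht₀.1.2 hM0.le
      _ < M * M⁻¹ := mul_lt_mul_of_pos_left hTr hM0
      _ = 1 := mul_inv_cancel₀ hM0.ne'
  linarith [ht₀.2]

end AdaptedBasis

end Metric

/-! ### Chow's theorem: finiteness and local boundedness of the distance. -/

section Connectivity

open Set
open scoped NNReal

variable {𝔤 : Type*} [LieRing 𝔤] [LieAlgebra ℝ 𝔤] {S : Stratification 𝔤} {ι : Type*} [Fintype ι]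

namespace AdaptedBasis

variable (b : AdaptedBasis S ι)

theorem dilation_mem_filt (t : ℝ) {k : ℕ} {x : ι → ℝ} (hx : x ∈ b.filt k) :
    b.dilation t x ∈ b.filt k := fun i hi => by
  rw [dilation_apply, hx i hi, mul_zero]

theorem ccDist_zero_dilation_le {t : ℝ} (ht : 0 < t) (x : ι → ℝ) :
    ccDist b 0 (b.dilation t x) ≤ ENNReal.ofReal t * ccDist b 0 x := by
  simpa using b.ccDist_dilation_le ht 0 x

/-- The vector `v` of layer `k` is the leading term of a point at finite distance from `0`. -/
def IsLeadingTerm (k : ℕ) (v : ι → ℝ) : Prop :=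
  ∃ g ∈ b.filt k, g - v ∈ b.filt (k + 1) ∧ ccDist b 0 g ≠ ⊤

theorem IsLeadingTerm.add {k : ℕ} (hk : 1 ≤ k) {v w : ι → ℝ} (hv : b.IsLeadingTerm k v)
    (hw : b.IsLeadingTerm k w) : b.IsLeadingTerm k (v + w) := by
  obtain ⟨g, hg, hgv, hd⟩ := hv
  obtain ⟨g', hg', hgv', hd'⟩ := hw
  refine ⟨groupMul b.X g g', b.groupMul_mem_filt hg hg', ?_, ?_⟩
  · have := add_mem (b.filt_antitone (by omega) (b.groupMul_sub_mem_filt hg hg'))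
      (add_mem hgv hgv')
    convert this using 1
    abel
  · exact ne_top_of_le_ne_top (ENNReal.add_ne_top.2 ⟨hd, hd'⟩) (b.ccDist_zero_groupMul g g')

theorem IsLeadingTerm.neg {k : ℕ} {v : ι → ℝ} (hv : b.IsLeadingTerm k v) :
    b.IsLeadingTerm k (-v) := by
  obtain ⟨g, hg, hgv, hd⟩ := hv
  refine ⟨-g, neg_mem hg, ?_, by rwa [ccDist_zero_neg]⟩
  have := neg_mem hgv
  rwa [neg_sub, ← neg_sub_neg] at this

theorem dilation_sub_mem_filt {k : ℕ} {s : ℝ} {g v : ι → ℝ} (hg : g ∈ b.filt k)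
    (hgv : g - v ∈ b.filt (k + 1)) : b.dilation s g - s ^ k • v ∈ b.filt (k + 1) := by
  intro i hi
  have h1 : g i = v i := sub_eq_zero.1 (hgv i hi)
  rw [Pi.sub_apply, dilation_apply, Pi.smul_apply, smul_eq_mul, ← h1]
  rcases Nat.lt_succ_iff_lt_or_eq.1 hi with h | h
  · rw [hg i h]; ring
  · rw [h, sub_self]

theorem isLeadingTerm_zero (k : ℕ) : b.IsLeadingTerm k 0 :=
  ⟨0, zero_mem _, by simp, by simp [ccDist_self]⟩

/-- Dilation by `c ^ (1 / k)` multiplies layer `k` by `c`; negative factors use the group inverse.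
-/
theorem IsLeadingTerm.smul {k : ℕ} (hk : 1 ≤ k) {v : ι → ℝ} (hv : b.IsLeadingTerm k v) (c : ℝ) :
    b.IsLeadingTerm k (c • v) := by
  have pos : ∀ c : ℝ, 0 < c → b.IsLeadingTerm k (c • v) := by
    intro c hc
    obtain ⟨g, hg, hgv, hd⟩ := hv
    have hs : 0 < c ^ (1 / k : ℝ) := by positivity
    refine ⟨b.dilation (c ^ (1 / k : ℝ)) g, b.dilation_mem_filt _ hg, ?_, ?_⟩
    · have := b.dilation_sub_mem_filt (s := c ^ (1 / k : ℝ)) hg hgv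
      rwa [← Real.rpow_natCast, ← Real.rpow_mul hc.le, one_div_mul_cancel (by positivity),
        Real.rpow_one] at this
    · exact ne_top_of_le_ne_top (ENNReal.mul_ne_top ENNReal.ofReal_ne_top hd)
        (b.ccDist_zero_dilation_le hs g)
  rcases lt_trichotomy c 0 with h | h | h
  · have := IsLeadingTerm.neg b (pos (-c) (by linarith))
    rwa [neg_smul, neg_neg] at this
  · rw [h, zero_smul]; exact b.isLeadingTerm_zero k
  · exact pos c h

theorem ccDist_zero_ne_top_of_layer_one {x : ι → ℝ} (hx : ∀ i, b.layer i ≠ 1 → x i = 0) :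
    ccDist b 0 x ≠ ⊤ := by
  set T : ℝ := ∑ i with b.layer i = 1, x i ^ 2 + 1 with hT
  have h0 : 0 ≤ ∑ i with b.layer i = 1, x i ^ 2 := Finset.sum_nonneg fun i _ => sq_nonneg _
  have hT1 : 1 ≤ T := by linarith
  have hu : T⁻¹ • x ∈ b.horizontal := by
    refine ⟨fun i hi => by simp [hx i hi], ?_⟩
    simp only [Pi.smul_apply, smul_eq_mul, mul_pow, ← Finset.mul_sum]
    rw [inv_pow, inv_mul_le_iff₀ (by positivity)]
    nlinarith
  have := b.ccDist_zero_smul_horizontal hu (by linarith : 0 < T)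
  rw [smul_inv_smul₀ (by positivity)] at this
  exact ne_top_of_le_ne_top ENNReal.ofReal_ne_top this

/-- The group commutator of `x` with a point realising `v` has leading term `[x, v]`, and the
triangle inequality keeps it at finite distance. -/
theorem IsLeadingTerm.bracket {k : ℕ} (hk : 1 ≤ k) {x v : ι → ℝ}
    (hx : ∀ i, b.layer i ≠ 1 → x i = 0) (hv : b.IsLeadingTerm k v) :
    b.IsLeadingTerm (k + 1) (b.bracket x v) := by
  obtain ⟨g, hg, hgv, hd⟩ := hv
  have hxd := b.ccDist_zero_ne_top_of_layer_one hx
  have h1 : b.commutator x g - b.bracket x v ∈ b.filt (k + 1 + 1) := by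
    have h2 := b.bracket_mem_filt (b.mem_filt_one x) hgv
    rw [show 1 + (k + 1) = k + 2 by ring] at h2
    have h3 := add_mem (b.commutator_sub_bracket_mem_filt hk (x := x) hg) h2
    have h4 : b.bracket x (g - v) = b.bracket x g - b.bracket x v := by
      simp only [AdaptedBasis.bracket, map_sub, lie_sub]
    rw [h4] at h3
    simpa using h3
  have hvk : v ∈ b.filt k := by
    have := sub_mem hg (b.filt_antitone (Nat.le_succ k) hgv)
    simpa using this
  have h5 := b.bracket_mem_filt (b.mem_filt_one x) hvk
  rw [add_comm] at h5
  refine ⟨b.commutator x g, ?_, h1, ?_⟩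
  · have := add_mem (b.filt_antitone (Nat.le_succ _) h1) h5
    simpa using this
  · refine ne_top_of_le_ne_top ?_ ((b.ccDist_zero_groupMul _ _).trans
      (add_le_add (b.ccDist_zero_groupMul _ _) (b.ccDist_zero_groupMul _ _)))
    rw [ccDist_zero_neg, ccDist_zero_neg]
    simp [hxd, hd]

theorem equivFun_apply_eq_zero {k : ℕ} (hk : 1 ≤ k) {v : 𝔤} (hv : v ∈ S.layer k) {i : ι}
    (hi : b.layer i ≠ k) : b.X.equivFun v i = 0 := by
  by_contra h
  exact hi (b.layer_eq_of_repr_ne_zero hk hv h)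

theorem isLeadingTerm_of_mem {k : ℕ} (hk : 1 ≤ k) (hks : k ≤ S.step) {v : 𝔤} (hv : v ∈ S.V k) :
    b.IsLeadingTerm k (b.X.equivFun v) := by
  have hlayer : ∀ j, j ≤ S.step → S.layer j = S.V j := fun j hj => if_pos hj
  have h1 : ∀ x ∈ S.V 1, ∀ i, b.layer i ≠ 1 → b.X.equivFun x i = 0 := fun x hx i hi =>
    b.equivFun_apply_eq_zero le_rfl (by rwa [hlayer 1 (by omega)]) hi
  induction k, hk using Nat.le_induction generalizing v with
  | base =>
    exact ⟨b.X.equivFun v, b.mem_filt_one _, by simp, b.ccDist_zero_ne_top_of_layer_one (h1 v hv)⟩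
  | succ k hk ih =>
    rw [← S.bracket_eq k hk (by omega)] at hv
    induction hv using Submodule.span_induction with
    | mem z hz =>
      obtain ⟨x, hx, y, hy, rfl⟩ := hz
      rw [equivFun_lie]
      exact IsLeadingTerm.bracket b hk (h1 x hx) (ih (by omega) hy)
    | zero => rw [map_zero]; exact b.isLeadingTerm_zero _
    | add x y _ _ hx hy => rw [map_add]; exact IsLeadingTerm.add b (by omega) hx hy
    | smul c x _ hx => rw [map_smul]; exact IsLeadingTerm.smul b (by omega) hx c

/-- The layer-`k` coordinates of `x` are cancelled one at a time, multiplying by the inverse of a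
dilate of a fixed point with leading term `X i`. What remains lies in `filt (k + 1)`. The dilation
factors range over a compact interval, so all bounds are uniform. -/
theorem exists_ccDist_le_of_filt_succ {k : ℕ} (hk : 1 ≤ k)
    (ih : ∀ R : ℝ, ∃ C : ℝ≥0, ∀ x ∈ b.filt (k + 1), ‖x‖ ≤ R → ccDist b 0 x ≤ C) (R : ℝ) :
    ∃ C : ℝ≥0, ∀ x ∈ b.filt k, ‖x‖ ≤ R → ccDist b 0 x ≤ C := by
  classical
  -- `s` contains the layer-`k` coordinates still allowed to be nonzero; `R` varies because each
  -- cancellation enlarges the norm bound.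
  suffices H : ∀ s : Finset ι, ∀ R : ℝ, ∃ C : ℝ≥0, ∀ x ∈ b.filt k, ‖x‖ ≤ R →
      (∀ i, b.layer i = k → i ∉ s → x i = 0) → ccDist b 0 x ≤ C by
    obtain ⟨C, hC⟩ := H Finset.univ R
    exact ⟨C, fun x hx hxR => hC x hx hxR fun i _ hi => absurd (Finset.mem_univ i) hi⟩
  intro s
  induction s using Finset.induction_on with
  | empty =>
    intro R
    obtain ⟨C, hC⟩ := ih R
    refine ⟨C, fun x hx hxR h => hC x (fun i hi => ?_) hxR⟩
    rcases Nat.lt_succ_iff_lt_or_eq.1 hi with h' | h'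
    · exact hx i h'
    · exact h i h' (Finset.notMem_empty i)
  | insert i s his ihs =>
    intro R
    by_cases hi : b.layer i = k
    swap
    · obtain ⟨C, hC⟩ := ihs R
      refine ⟨C, fun x hx hxR h => hC x hx hxR fun j hj hjs => h j hj ?_⟩
      rw [Finset.mem_insert, not_or]
      exact ⟨fun e => hi (e ▸ hj), hjs⟩
    obtain ⟨p, hp, hpe, hpd⟩ := b.isLeadingTerm_of_mem hk (hi ▸ b.layer_le i)
      (v := b.X i) (hi ▸ b.mem i)
    set σ : ℝ := |R| ^ (1 / k : ℝ) with hσ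
    have hdc : Continuous fun s : ℝ => b.dilation s p := by
      refine continuous_pi fun j => ?_
      simp only [dilation_apply]
      fun_prop
    obtain ⟨R₁, hR₁⟩ := (isCompact_Icc (a := (0 : ℝ)) (b := σ)).exists_bound_of_continuousOn
      hdc.continuousOn
    obtain ⟨R₂, hR₂⟩ := ((isCompact_closedBall (0 : ι → ℝ) R₁).prod
      (isCompact_closedBall (0 : ι → ℝ) R)).exists_bound_of_continuousOn
      b.continuous_groupMul.continuousOn
    obtain ⟨C, hC⟩ := ihs R₂
    refine ⟨Real.toNNReal σ * (ccDist b 0 p).toNNReal + C, fun x hx hxR h => ?_⟩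
    have key : ∃ q, q ∈ b.filt k ∧ ‖q‖ ≤ R₁ ∧
        ccDist b 0 q ≤ ENNReal.ofReal σ * ccDist b 0 p ∧
        q - x i • b.X.equivFun (b.X i) ∈ b.filt (k + 1) := by
      have key' : ∀ c : ℝ, 0 ≤ c → c ≤ |R| → ∃ q, q ∈ b.filt k ∧ ‖q‖ ≤ R₁ ∧
          ccDist b 0 q ≤ ENNReal.ofReal σ * ccDist b 0 p ∧
          q - c • b.X.equivFun (b.X i) ∈ b.filt (k + 1) := by
        intro c hc hcR
        set τ : ℝ := c ^ (1 / k : ℝ) with hτ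
        have hτ0 : 0 ≤ τ := by positivity
        have hτσ : τ ≤ σ := Real.rpow_le_rpow hc hcR (by positivity)
        have hτk : τ ^ k = c := by
          rw [hτ, ← Real.rpow_natCast, ← Real.rpow_mul hc, one_div_mul_cancel (by positivity),
            Real.rpow_one]
        refine ⟨b.dilation τ p, b.dilation_mem_filt _ hp, hR₁ τ ⟨hτ0, hτσ⟩, ?_, ?_⟩
        · rcases hτ0.eq_or_lt with h0 | h0
          · have : b.dilation τ p = 0 := by
              ext j
              have := b.one_le_layer j
              rw [dilation_apply, ← h0, zero_pow (by omega), zero_mul, Pi.zero_apply]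
            rw [this, ccDist_self]
            exact bot_le
          · exact (b.ccDist_zero_dilation_le h0 p).trans (by gcongr)
        · have := b.dilation_sub_mem_filt (s := τ) hp hpe
          rwa [hτk] at this
      have hxi : |x i| ≤ |R| := (norm_le_pi_norm x i).trans (hxR.trans (le_abs_self R))
      rcases le_total 0 (x i) with h0 | h0
      · exact key' (x i) h0 (by rwa [abs_of_nonneg h0] at hxi)
      · obtain ⟨q, hq1, hq2, hq3, hq4⟩ := key' (-x i) (by linarith)
          (by rwa [abs_of_nonpos h0] at hxi)
        refine ⟨-q, neg_mem hq1, by rwa [norm_neg], by rwa [ccDist_zero_neg], ?_⟩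
        have := neg_mem hq4
        rw [neg_smul, sub_neg_eq_add, neg_add] at this
        rwa [sub_eq_add_neg]
    obtain ⟨q, hq1, hq2, hq3, hq4⟩ := key
    set y := groupMul b.X (-q) x with hy
    have hyk : y ∈ b.filt k := b.groupMul_mem_filt (neg_mem hq1) hx
    have hyR : ‖y‖ ≤ R₂ := hR₂ (-q, x) ⟨by simpa using hq2, by simpa using hxR⟩
    have hye : y - (x - x i • b.X.equivFun (b.X i)) ∈ b.filt (k + 1) := by
      have h1 := b.filt_antitone (by omega : k + 1 ≤ 2 * k)
        (b.groupMul_sub_mem_filt (neg_mem hq1) hx)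
      have h2 := sub_mem h1 hq4
      convert h2 using 1
      rw [hy]
      abel
    have hyC := hC y hyk hyR fun j hj hjs => by
      have h1 := hye j (by omega)
      have h2 : y j = x j - x i * b.X.equivFun (b.X i) j := by
        have h1' : y j - (x j - x i * b.X.equivFun (b.X i) j) = 0 := h1
        linarith
      rw [h2]
      by_cases hij : j = i
      · subst hij; simp
      · rw [h j hj (by simp [hij, hjs])]
        simp [Ne.symm hij]
    have hxy : x = groupMul b.X q y := by rw [hy, groupMul_neg_cancel]
    rw [hxy]
    refine (b.ccDist_zero_groupMul q y).trans ?_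
    push_cast
    rw [ENNReal.coe_toNNReal hpd]
    exact add_le_add hq3 hyC

theorem exists_ccDist_le (R : ℝ) : ∃ C : ℝ≥0, ∀ x, ‖x‖ ≤ R → ccDist b 0 x ≤ C := by
  have H : ∀ j k : ℕ, 1 ≤ k → k + j = S.step + 1 → ∀ R : ℝ, ∃ C : ℝ≥0, ∀ x ∈ b.filt k, ‖x‖ ≤ R →
      ccDist b 0 x ≤ C := by
    intro j
    induction j with
    | zero =>
      intro k _ hk R
      refine ⟨0, fun x hx _ => ?_⟩
      rw [b.eq_zero_of_mem_filt (by omega) hx, ccDist_self]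
      exact bot_le
    | succ j ih =>
      intro k hk hj R
      exact b.exists_ccDist_le_of_filt_succ hk (ih (k + 1) (by omega) (by omega)) R
  obtain ⟨C, hC⟩ := H S.step 1 le_rfl (by omega) R
  exact ⟨C, fun x hx => hC x (b.mem_filt_one x) hx⟩

theorem ccDist_ne_top (x y : ι → ℝ) : ccDist b x y ≠ ⊤ := by
  rw [ccDist_eq]
  obtain ⟨C, hC⟩ := b.exists_ccDist_le ‖groupMul b.X (-x) y‖
  exact ne_top_of_le_ne_top ENNReal.coe_ne_top (hC _ le_rfl)

end AdaptedBasis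

end Connectivity

/-- `ℝ^ι` with the Carnot-Carathéodory metric of an adapted basis. -/
@[nolint unusedArguments]
def CarnotSpace {𝔤 : Type*} [LieRing 𝔤] [LieAlgebra ℝ 𝔤] {S : Stratification 𝔤} {ι : Type*}
    (_ : AdaptedBasis S ι) : Type _ := ι → ℝ

/-! ### Topology, properness and ball volumes of the Carnot–Carathéodory metric. -/

namespace AdaptedBasis

variable {𝔤 : Type*} [LieRing 𝔤] [LieAlgebra ℝ 𝔤] {S : Stratification 𝔤} {ι : Type*} [Fintype ι]
  (b : AdaptedBasis S ι)

theorem norm_dilation_le_of_ccDist_lt {c : ℝ} (hc : ∀ x, ccDist b 0 x < ENNReal.ofReal c → ‖x‖ ≤ 1)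
    {t r : ℝ} (ht : 0 < t) (hr : t * r < c) {x : ι → ℝ} (hx : ccDist b 0 x ≤ ENNReal.ofReal r)
    (hc0 : 0 < c) : ‖b.dilation t x‖ ≤ 1 := by
  refine hc _ (((b.ccDist_zero_dilation_le ht x).trans (mul_le_mul_right hx _)).trans_lt ?_)
  rw [← ENNReal.ofReal_mul ht.le]
  exact (ENNReal.ofReal_lt_ofReal_iff hc0).2 hr

/-- By homogeneity, a point close to `0` is the dilate by a small `s` of a point of norm at most
`1`, so its distance is at most `s C`. -/
theorem tendsto_ccDist_zero : Tendsto (fun x => ccDist b 0 x) (𝓝 0) (𝓝 0) := by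
  obtain ⟨C, hC⟩ := b.exists_ccDist_le 1
  rw [ENNReal.tendsto_nhds_zero]
  intro ε hε
  obtain ⟨s, hs0, hs⟩ : ∃ s : ℝ, 0 < s ∧ ENNReal.ofReal s * C ≤ ε := by
    rcases eq_or_ne C 0 with rfl | hC0
    · exact ⟨1, one_pos, by simp⟩
    obtain ⟨q, hq0, hq⟩ := ENNReal.lt_iff_exists_nnreal_btwn.1
      (ENNReal.div_pos hε.ne' (ENNReal.coe_ne_top (r := C)))
    refine ⟨q, by simpa using hq0, ?_⟩
    rw [ENNReal.ofReal_coe_nnreal]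
    exact ENNReal.mul_le_of_le_div hq.le
  have hlim : Tendsto (fun x => ‖b.dilation s⁻¹ x‖) (𝓝 0) (𝓝 0) := by
    have := ((b.contDiff_dilation s⁻¹).continuous.norm).tendsto 0
    simpa using this
  filter_upwards [hlim.eventually (gt_mem_nhds one_pos)] with x hx
  have := b.ccDist_zero_dilation_le hs0 (b.dilation s⁻¹ x)
  rw [b.dilation_dilation_inv hs0] at this
  exact (this.trans (mul_le_mul_right (hC _ hx.le) _)).trans hs

theorem exists_norm_lt_of_ccDist_lt {ε : ℝ} (hε : 0 < ε) :
    ∃ δ : ℝ, 0 < δ ∧ ∀ x, ccDist b 0 x < ENNReal.ofReal δ → ‖x‖ < ε := by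
  obtain ⟨c, hc0, hc⟩ := b.exists_norm_le_one_of_ccDist_lt
  obtain ⟨t, ht1, ht⟩ : ∃ t : ℝ, 1 ≤ t ∧ ε⁻¹ < t := ⟨max 1 (ε⁻¹ + 1), le_max_left _ _,
    (lt_add_one _).trans_le (le_max_right _ _)⟩
  have ht0 : 0 < t := one_pos.trans_le ht1
  refine ⟨c / t / 2, by positivity, fun x hx => ?_⟩
  have h1 := b.norm_dilation_le_of_ccDist_lt hc ht0 (r := c / t / 2)
    (by field_simp; norm_num) hx.le hc0
  rw [pi_norm_lt_iff hε]
  intro i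
  have h2 := (norm_le_pi_norm _ i).trans h1
  rw [dilation_apply, norm_mul, norm_pow, Real.norm_of_nonneg ht0.le] at h2
  -- As `t ≥ 1` and every layer is at least `1`, the dilation expands each coordinate by at least
  -- `t`.
  have h3 : t * ‖x i‖ ≤ 1 := (mul_le_mul_of_nonneg_right
    (le_self_pow₀ ht1 (Nat.one_le_iff_ne_zero.1 (b.one_le_layer i))) (norm_nonneg _)).trans h2
  rw [inv_lt_iff_one_lt_mul₀ hε] at ht
  by_contra! h4
  nlinarith

theorem exists_norm_le_of_ccDist_le (r : ℝ) :
    ∃ R : ℝ, ∀ x, ccDist b 0 x ≤ ENNReal.ofReal r → ‖x‖ ≤ R := by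
  obtain ⟨c, hc0, hc⟩ := b.exists_norm_le_one_of_ccDist_lt
  obtain ⟨t, ht0, ht⟩ : ∃ t : ℝ, 0 < t ∧ t * r < c := by
    refine ⟨c / (|r| + 1), by positivity, ?_⟩
    have := le_abs_self r
    rw [div_mul_eq_mul_div, div_lt_iff₀ (by positivity)]
    nlinarith
  obtain ⟨R, hR⟩ := (isCompact_closedBall (0 : ι → ℝ) 1).exists_bound_of_continuousOn
    (b.contDiff_dilation t⁻¹).continuous.continuousOn
  refine ⟨R, fun x hx => ?_⟩
  have := hR (b.dilation t x)
    (mem_closedBall_zero_iff.2 (b.norm_dilation_le_of_ccDist_lt hc ht0 ht hx hc0))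
  rwa [b.dilation_inv_dilation ht0] at this

theorem det_dilation (t : ℝ) : LinearMap.det (b.dilation t) = t ^ ∑ i, b.layer i := by
  classical
  have : b.dilation t = Matrix.toLin' (Matrix.diagonal fun i => t ^ b.layer i) := by
    ext x i
    simp [Matrix.mulVec_diagonal]
  rw [this, LinearMap.det_toLin', Matrix.det_diagonal, Finset.prod_pow_eq_pow_sum]

theorem ccDist_zero_dilation {t : ℝ} (ht : 0 < t) (x : ι → ℝ) :
    ccDist b 0 (b.dilation t x) = ENNReal.ofReal t * ccDist b 0 x := by
  refine le_antisymm (b.ccDist_zero_dilation_le ht x) ?_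
  have := b.ccDist_zero_dilation_le (inv_pos.2 ht) (b.dilation t x)
  rw [b.dilation_inv_dilation ht, ENNReal.ofReal_inv_of_pos ht] at this
  rw [mul_comm]
  exact ENNReal.mul_le_of_le_div (by rwa [ENNReal.div_eq_inv_mul])

theorem ccBall_zero_eq_image {r : ℝ} (hr : 0 < r) :
    ccBall b 0 r = b.dilation r '' ccBall b 0 1 := by
  have key : ∀ x, b.dilation r x ∈ ccBall b 0 r ↔ x ∈ ccBall b 0 1 := fun x => by
    simp only [ccBall, Set.mem_ofPred_eq, b.ccDist_zero_dilation hr, ENNReal.ofReal_one]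
    have h0 : ENNReal.ofReal r ≠ 0 := by simpa using hr
    conv_lhs => rw [← mul_one (ENNReal.ofReal r), mul_assoc, one_mul]
    exact ENNReal.mul_lt_mul_iff_right h0 ENNReal.ofReal_ne_top
  ext x
  constructor
  · intro hx
    refine ⟨b.dilation r⁻¹ x, ?_, b.dilation_dilation_inv hr x⟩
    rwa [← key, b.dilation_dilation_inv hr]
  · rintro ⟨y, hy, rfl⟩
    exact (key y).2 hy

theorem ccBall_eq_preimage (x : ι → ℝ) (r : ℝ) :
    ccBall b x r = groupMul b.X (-x) ⁻¹' ccBall b 0 r := by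
  ext y
  simp only [ccBall, Set.mem_ofPred_eq, Set.mem_preimage, b.ccDist_eq x y]

/-- Left translations preserve volume, and the dilation by `r` has determinant `r` to the
homogeneous dimension. -/
theorem volume_ccBall (x : ι → ℝ) {r : ℝ} (hr : 0 < r) :
    volume (ccBall b x r) =
      ENNReal.ofReal (r ^ ∑ i, b.layer i) * volume (ccBall b 0 1) := by
  have hL : volume (ccBall b x r) = volume (ccBall b 0 r) := by
    rw [ccBall_eq_preimage]
    exact (b.measurePreserving_groupMul (-x)).measure_preimage_emb
      (b.leftTranslate (-x)).measurableEmbedding _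
  rw [hL, b.ccBall_zero_eq_image hr, Measure.addHaar_image_linearMap, det_dilation,
    abs_of_nonneg (by positivity)]

theorem nhds_zero_basis :
    (𝓝 (0 : ι → ℝ)).HasBasis (fun r : ℝ => 0 < r) (fun r => ccBall b 0 r) := by
  refine ⟨fun s => ⟨fun hs => ?_, ?_⟩⟩
  · obtain ⟨ε, hε, h⟩ := Metric.mem_nhds_iff.1 hs
    obtain ⟨δ, hδ, H⟩ := b.exists_norm_lt_of_ccDist_lt hε
    exact ⟨δ, hδ, fun x hx => h (by simpa using H x hx)⟩
  · rintro ⟨r, hr, h⟩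
    filter_upwards [b.tendsto_ccDist_zero.eventually
      (gt_mem_nhds (ENNReal.ofReal_pos.2 hr))] with x hx using h hx

theorem nhds_basis (x : ι → ℝ) :
    (𝓝 x).HasBasis (fun r : ℝ => 0 < r) (fun r => ccBall b x r) := by
  have h := b.nhds_zero_basis.comap (b.leftTranslate (-x))
  rw [(b.leftTranslate (-x)).comap_nhds_eq] at h
  have hx : (b.leftTranslate (-x)).symm 0 = x := by
    change groupMul b.X (- -x) 0 = x
    rw [neg_neg, groupMul_zero]
  rw [hx] at h
  simp only [ccBall_eq_preimage b x]
  exact h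

theorem mem_ccBall_iff {x y : ι → ℝ} {r : ℝ} : y ∈ ccBall b x r ↔ (ccDist b x y).toReal < r :=
  ENNReal.lt_ofReal_iff_toReal_lt (b.ccDist_ne_top _ _)

/-- The Carnot-Carathéodory metric, with the topology that it induces. -/
noncomputable abbrev ccMetricSpace : MetricSpace (ι → ℝ) :=
  { dist := fun x y => (ccDist b x y).toReal
    dist_self := fun x => by simp [b.ccDist_self]
    dist_comm := fun x y => by
      rw [b.ccDist_comm]
    dist_triangle := fun x y z => by
      rw [← ENNReal.toReal_add (b.ccDist_ne_top _ _) (b.ccDist_ne_top _ _)]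
      exact ENNReal.toReal_mono (by simp [b.ccDist_ne_top]) (b.ccDist_triangle x y z)
    eq_of_dist_eq_zero := fun {x y} h => by
      replace h : (ccDist b x y).toReal = 0 := h
      have h0 : ccDist b x y = 0 := by
        simpa [ENNReal.toReal_eq_zero_iff, b.ccDist_ne_top] using h
      by_contra hne
      obtain ⟨r, hr, hs⟩ := (b.nhds_basis x).mem_iff.1 (isOpen_compl_singleton.mem_nhds hne)
      have : y ∈ ccBall b x r := by simpa [ccBall, h0] using hr
      exact hs this rfl }

theorem nhds_ccMetricSpace (x : ι → ℝ) :
    𝓝 x = @nhds (ι → ℝ) b.ccMetricSpace.toUniformSpace.toTopologicalSpace x := by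
  refine (b.nhds_basis x).eq_of_same_basis ?_
  have hb : (fun r => @Metric.ball _ b.ccMetricSpace.toPseudoMetricSpace x r) =
      fun r => ccBall b x r := by
    ext r y
    rw [@Metric.mem_ball' _ b.ccMetricSpace.toPseudoMetricSpace]
    exact b.mem_ccBall_iff.symm
  exact hb ▸ @Metric.nhds_basis_ball _ b.ccMetricSpace.toPseudoMetricSpace x

/-- The Carnot-Carathéodory metric, with the topology of `ℝ^ι`. -/
noncomputable instance : MetricSpace (CarnotSpace b) :=
  @MetricSpace.replaceTopology _ (inferInstanceAs (TopologicalSpace (ι → ℝ))) b.ccMetricSpace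
    (TopologicalSpace.ext_nhds fun x => b.nhds_ccMetricSpace x)

noncomputable instance : MeasurableSpace (CarnotSpace b) := inferInstanceAs (MeasurableSpace (ι → ℝ))
instance : BorelSpace (CarnotSpace b) := inferInstanceAs (BorelSpace (ι → ℝ))

theorem ball_carnotSpace (x : CarnotSpace b) (r : ℝ) :
    Metric.ball x r = ccBall b (x : ι → ℝ) r := by
  ext y
  rw [Metric.mem_ball']
  exact b.mem_ccBall_iff.symm

theorem exists_norm_le_of_toReal_ccDist_le (x : ι → ℝ) (r : ℝ) :
    ∃ R : ℝ, ∀ y, (ccDist b x y).toReal ≤ r → ‖y‖ ≤ R := by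
  obtain ⟨R, hR⟩ := b.exists_norm_le_of_ccDist_le (r + (ccDist b 0 x).toReal)
  refine ⟨R, fun y hy => hR y ?_⟩
  rw [ENNReal.le_ofReal_iff_toReal_le (b.ccDist_ne_top _ _)
    (add_nonneg (ENNReal.toReal_nonneg.trans hy) ENNReal.toReal_nonneg)]
  calc (ccDist b 0 y).toReal ≤ (ccDist b 0 x + ccDist b x y).toReal :=
        ENNReal.toReal_mono (by simp [b.ccDist_ne_top]) (b.ccDist_triangle 0 x y)
    _ ≤ _ := by
      rw [ENNReal.toReal_add (b.ccDist_ne_top _ _) (b.ccDist_ne_top _ _)]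
      linarith

instance : ProperSpace (CarnotSpace b) := by
  refine ProperSpace.of_isCompact_closedBall_of_le 0 fun x r _ => ?_
  obtain ⟨R, hR⟩ := b.exists_norm_le_of_toReal_ccDist_le x r
  obtain ⟨K, hK, hRK⟩ : ∃ K : Set (ι → ℝ), IsCompact K ∧ ∀ y, ‖y‖ ≤ R → y ∈ K :=
    ⟨_, isCompact_closedBall 0 R, fun y => mem_closedBall_zero_iff.2⟩
  have h1 : IsCompact (X := CarnotSpace b) K := hK
  refine h1.of_isClosed_subset Metric.isClosed_closedBall fun y hy => ?_
  rw [Metric.mem_closedBall'] at hy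
  exact hRK y (hR y hy)

/-- Lebesgue measure on `ℝ^ι`, as a measure on the metric space `CarnotSpace b`. -/
noncomputable def lebesgue : Measure (CarnotSpace b) := (volume : Measure (ι → ℝ))

theorem exists_lebesgue_ball : ∃ c : ℝ, 0 < c ∧ ∀ (x : CarnotSpace b) (r : ℝ), 0 < r →
    b.lebesgue (Metric.ball x r) = ENNReal.ofReal (c * r ^ ∑ i, b.layer i) := by
  have hpos : 0 < volume (ccBall b 0 1) :=
    Measure.measure_pos_of_mem_nhds volume (b.nhds_zero_basis.mem_of_mem one_pos)
  have hfin : volume (ccBall b 0 1) < ⊤ := by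
    obtain ⟨R, hR⟩ := b.exists_norm_le_of_ccDist_le 1
    refine (measure_mono fun x hx => ?_).trans_lt (measure_closedBall_lt_top (x := 0) (r := R))
    exact mem_closedBall_zero_iff.2 (hR x (le_of_lt hx))
  refine ⟨(volume (ccBall b 0 1)).toReal, ENNReal.toReal_pos hpos.ne' hfin.ne, fun x r hr => ?_⟩
  rw [ball_carnotSpace]
  refine (b.volume_ccBall x hr).trans ?_
  rw [mul_comm, ENNReal.ofReal_mul ENNReal.toReal_nonneg, ENNReal.ofReal_toReal hfin.ne]

end AdaptedBasis

/-! ### Mean oscillation on a measure space. -/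

section MeanOscillationLemmas

variable {X E : Type*} [MeasurableSpace X] {μ : Measure X} [NormedAddCommGroup E] [NormedSpace ℝ E]

/-- The mean oscillation of `f` on `s` with respect to the measure `μ`. -/
noncomputable def meanOscillation (μ : Measure X) (f : X → E) (s : Set X) : ℝ≥0∞ :=
  ⨍⁻ x in s, ‖f x - ⨍ y in s, f y ∂μ‖ₑ ∂μ

theorem setLAverage_mono' {s : Set X} (hs : MeasurableSet s) {u v : X → ℝ≥0∞}
    (h : ∀ x ∈ s, u x ≤ v x) : ⨍⁻ x in s, u x ∂μ ≤ ⨍⁻ x in s, v x ∂μ := by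
  rw [setLAverage_eq, setLAverage_eq]
  exact ENNReal.div_le_div_right (setLIntegral_mono' hs h) _

theorem setLAverage_const_le (s : Set X) (c : ℝ≥0∞) : ⨍⁻ _ in s, c ∂μ ≤ c := by
  rw [setLAverage_eq, setLIntegral_const]
  exact ENNReal.div_le_of_le_mul le_rfl

theorem setLAverage_le_of_le {s : Set X} (hs : MeasurableSet s) {u : X → ℝ≥0∞} {c : ℝ≥0∞}
    (h : ∀ x ∈ s, u x ≤ c) : ⨍⁻ x in s, u x ∂μ ≤ c :=
  (setLAverage_mono' hs h).trans (setLAverage_const_le s c)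

theorem setLAverage_add_left {s : Set X} {u v : X → ℝ≥0∞} (hu : AEMeasurable u (μ.restrict s)) :
    ⨍⁻ x in s, (u x + v x) ∂μ = ⨍⁻ x in s, u x ∂μ + ⨍⁻ x in s, v x ∂μ := by
  simp only [setLAverage_eq]
  rw [lintegral_add_left' hu, ENNReal.add_div]

variable {f g : X → E} {s t : Set X}

theorem enorm_setAverage_le : ‖⨍ x in s, f x ∂μ‖ₑ ≤ ⨍⁻ x in s, ‖f x‖ₑ ∂μ :=
  enorm_integral_le_lintegral_enorm _

theorem enorm_setAverage_sub_le [CompleteSpace E] (h0 : μ s ≠ 0) (ht : μ s ≠ ⊤)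
    (hf : IntegrableOn f s μ) (c : E) :
    ‖⨍ x in s, f x ∂μ - c‖ₑ ≤ ⨍⁻ x in s, ‖f x - c‖ₑ ∂μ := by
  have : ⨍ x in s, f x ∂μ - c = ⨍ x in s, (f x - c) ∂μ := by
    have hc := setAverage_const h0 ht c
    simp only [setAverage_eq] at hc ⊢
    rw [integral_sub hf (integrableOn_const ht), smul_sub, hc]
  rw [this]
  exact enorm_setAverage_le

variable [CompleteSpace E]

/-- The mean may be replaced by any constant `c` at the price of a factor `2`, its distance to `c`
being at most the average of `‖f - c‖`. -/
theorem meanOscillation_le_two_mul (hs : MeasurableSet s) (h0 : μ s ≠ 0) (ht : μ s ≠ ⊤)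
    (hf : IntegrableOn f s μ) (c : E) :
    meanOscillation μ f s ≤ 2 * ⨍⁻ x in s, ‖f x - c‖ₑ ∂μ := by
  set m := ⨍ x in s, f x ∂μ
  have hm := enorm_setAverage_sub_le h0 ht hf c
  calc meanOscillation μ f s ≤ ⨍⁻ x in s, (‖f x - c‖ₑ + ‖m - c‖ₑ) ∂μ :=
        setLAverage_mono' hs fun x _ => by
          rw [← sub_sub_sub_cancel_right (f x) m c]; exact enorm_sub_le
    _ = ⨍⁻ x in s, ‖f x - c‖ₑ ∂μ + ⨍⁻ _ in s, ‖m - c‖ₑ ∂μ :=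
        setLAverage_add_left (hf.aestronglyMeasurable.sub aestronglyMeasurable_const).enorm
    _ ≤ _ := by
        rw [two_mul]
        exact add_le_add le_rfl ((setLAverage_const_le _ _).trans hm)

theorem meanOscillation_le_of_le (hs : MeasurableSet s) (h0 : μ s ≠ 0) (ht : μ s ≠ ⊤)
    (hf : IntegrableOn f s μ) (c : E) {K : ℝ≥0∞} (h : ∀ x ∈ s, ‖f x - c‖ₑ ≤ K) :
    meanOscillation μ f s ≤ 2 * K :=
  (meanOscillation_le_two_mul hs h0 ht hf c).trans
    (mul_le_mul_right (setLAverage_le_of_le hs h) _)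

theorem meanOscillation_add_le (hs : MeasurableSet s)
    (hf : IntegrableOn f s μ) (hg : IntegrableOn g s μ) :
    meanOscillation μ (f + g) s ≤ meanOscillation μ f s + meanOscillation μ g s := by
  have : ⨍ x in s, (f + g) x ∂μ = ⨍ x in s, f x ∂μ + ⨍ x in s, g x ∂μ := by
    simp only [setAverage_eq]
    rw [integral_add' hf hg, smul_add]
  have hm : AEMeasurable (fun x => ‖f x - ⨍ y in s, f y ∂μ‖ₑ) (μ.restrict s) :=
    (hf.aestronglyMeasurable.sub aestronglyMeasurable_const).enorm
  rw [meanOscillation, this, meanOscillation, meanOscillation, ← setLAverage_add_left hm]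
  refine setLAverage_mono' hs fun x _ => ?_
  rw [Pi.add_apply, add_sub_add_comm]
  exact enorm_add_le _ _

theorem meanOscillation_neg (f : X → E) (s : Set X) :
    meanOscillation μ (-f) s = meanOscillation μ f s := by
  have : ⨍ x in s, (-f) x ∂μ = - ⨍ x in s, f x ∂μ := by
    simp only [setAverage_eq, Pi.neg_apply, integral_neg, smul_neg]
  rw [meanOscillation, this, meanOscillation]
  congr 1
  ext x
  rw [Pi.neg_apply, ← neg_sub', enorm_neg]

theorem meanOscillation_sub_le (hs : MeasurableSet s)
    (hf : IntegrableOn f s μ) (hg : IntegrableOn g s μ) :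
    meanOscillation μ (f - g) s ≤ meanOscillation μ f s + meanOscillation μ g s := by
  rw [sub_eq_add_neg, ← meanOscillation_neg g]
  exact meanOscillation_add_le hs hf hg.neg

theorem meanOscillation_congr (hs : MeasurableSet s) (h : ∀ x ∈ s, f x = g x) :
    meanOscillation μ f s = meanOscillation μ g s := by
  have : ⨍ x in s, f x ∂μ = ⨍ x in s, g x ∂μ := by
    simp only [setAverage_eq]
    rw [setIntegral_congr_fun hs h]
  rw [meanOscillation, this, meanOscillation, setLAverage_eq, setLAverage_eq]
  rw [setLIntegral_congr_fun hs fun x hx => by rw [h x hx]]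

theorem meanOscillation_const (hs : MeasurableSet s) (h0 : μ s ≠ 0) (ht : μ s ≠ ⊤) (c : E) :
    meanOscillation μ (fun _ => c) s = 0 := by
  simpa using meanOscillation_le_of_le hs h0 ht (f := fun _ => c) (integrableOn_const ht) c
    (K := 0) (by simp)

theorem setLAverage_le_mul (h : s ⊆ t) (u : X → ℝ≥0∞) (ht0 : μ t ≠ 0) (ht : μ t ≠ ⊤) :
    ⨍⁻ x in s, u x ∂μ ≤ μ t / μ s * ⨍⁻ x in t, u x ∂μ := by
  rw [setLAverage_eq, setLAverage_eq]
  calc (∫⁻ x in s, u x ∂μ) / μ s ≤ (∫⁻ x in t, u x ∂μ) / μ s :=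
        ENNReal.div_le_div_right (lintegral_mono_set h) _
    _ = μ t / μ s * ((∫⁻ x in t, u x ∂μ) / μ t) := by
        rw [div_eq_mul_inv, div_eq_mul_inv, div_eq_mul_inv]
        calc _ = (∫⁻ x in t, u x ∂μ) * (μ s)⁻¹ * (μ t * (μ t)⁻¹) := by
              rw [ENNReal.mul_inv_cancel ht0 ht, mul_one]
          _ = _ := by ring

end MeanOscillationLemmas

/-! ### Metric measure spaces with balls of measure `c r ^ Q`. -/

section RegularMeasure

open Metric

/-- Every ball of radius `r` has measure `c * r ^ Q`. -/
structure IsBallRegular {X : Type*} [PseudoMetricSpace X] [MeasurableSpace X] (μ : Measure X)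
    (c : ℝ) (Q : ℕ) : Prop where
  pos : 0 < c
  measure_ball : ∀ (x : X) (r : ℝ), 0 < r → μ (ball x r) = ENNReal.ofReal (c * r ^ Q)

namespace IsBallRegular

variable {X E : Type*} [PseudoMetricSpace X] [MeasurableSpace X] [BorelSpace X]
  {μ : Measure X} {c : ℝ} {Q : ℕ} (hμ : IsBallRegular μ c Q)
  [NormedAddCommGroup E] [NormedSpace ℝ E] [CompleteSpace E] {f : X → E}

include hμ

theorem ball_ne_zero (x : X) {r : ℝ} (hr : 0 < r) : μ (ball x r) ≠ 0 := by
  rw [hμ.measure_ball x r hr, ← pos_iff_ne_zero]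
  have := hμ.pos
  exact ENNReal.ofReal_pos.2 (by positivity)

theorem ball_ne_top (x : X) {r : ℝ} (hr : 0 < r) : μ (ball x r) ≠ ⊤ := by
  rw [hμ.measure_ball x r hr]; exact ENNReal.ofReal_ne_top

theorem ball_div_ball (x y : X) {r R : ℝ} (hr : 0 < r) (hR : 0 < R) :
    μ (ball y R) / μ (ball x r) = ENNReal.ofReal (R / r) ^ Q := by
  have := hμ.pos
  rw [hμ.measure_ball x r hr, hμ.measure_ball y R hR, ← ENNReal.ofReal_div_of_pos (by positivity),
    ← ENNReal.ofReal_pow (by positivity), mul_div_mul_left _ _ this.ne', div_pow]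

theorem setLAverage_ball_le {x y : X} {r R : ℝ} (hr : 0 < r) (hR : 0 < R)
    (h : ball x r ⊆ ball y R) (u : X → ℝ≥0∞) :
    ⨍⁻ z in ball x r, u z ∂μ ≤ ENNReal.ofReal (R / r) ^ Q * ⨍⁻ z in ball y R, u z ∂μ := by
  rw [← hμ.ball_div_ball x y hr hR]
  exact setLAverage_le_mul h u (hμ.ball_ne_zero y hR) (hμ.ball_ne_top y hR)

theorem enorm_setAverage_sub_setAverage_le {x y : X} {r R : ℝ} (hr : 0 < r) (hR : 0 < R)
    (h : ball x r ⊆ ball y R) (hf : IntegrableOn f (ball y R) μ) :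
    ‖⨍ z in ball x r, f z ∂μ - ⨍ z in ball y R, f z ∂μ‖ₑ ≤
      ENNReal.ofReal (R / r) ^ Q * meanOscillation μ f (ball y R) :=
  (enorm_setAverage_sub_le (hμ.ball_ne_zero x hr) (hμ.ball_ne_top x hr) (hf.mono_set h) _).trans
    (hμ.setLAverage_ball_le hr hR h _)

/-- Telescoping over dyadic radii: each doubling moves the mean by at most `2 ^ Q * ε`, so means
drift only logarithmically in the radius. -/
theorem enorm_setAverage_sub_doubling_le {x : X} {r : ℝ} (hr : 0 < r) {ε : ℝ≥0∞}
    (hf : ∀ ρ, IntegrableOn f (ball x ρ) μ)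
    (hε : ∀ ρ, r ≤ ρ → meanOscillation μ f (ball x ρ) ≤ ε) (n : ℕ) :
    ‖⨍ z in ball x r, f z ∂μ - ⨍ z in ball x (2 ^ n * r), f z ∂μ‖ₑ ≤ n * (2 ^ Q * ε) := by
  induction n with
  | zero => simp
  | succ n ih =>
    have hn : 0 < 2 ^ n * r := by positivity
    have hle : r ≤ 2 ^ (n + 1) * r := le_mul_of_one_le_left hr.le (one_le_pow₀ (by norm_num))
    have h1 := hμ.enorm_setAverage_sub_setAverage_le (x := x) (y := x) hn
      (show 0 < 2 ^ (n + 1) * r by positivity)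
      (ball_subset_ball (by rw [pow_succ]; linarith)) (hf _)
    rw [show 2 ^ (n + 1) * r / (2 ^ n * r) = 2 by rw [pow_succ]; field_simp] at h1
    replace h1 := h1.trans (mul_le_mul_right (hε _ hle) _)
    rw [ENNReal.ofReal_ofNat] at h1
    calc _ = ‖(⨍ z in ball x r, f z ∂μ - ⨍ z in ball x (2 ^ n * r), f z ∂μ) +
          (⨍ z in ball x (2 ^ n * r), f z ∂μ - ⨍ z in ball x (2 ^ (n + 1) * r), f z ∂μ)‖ₑ := by
          rw [sub_add_sub_cancel]
      _ ≤ n * (2 ^ Q * ε) + 2 ^ Q * ε := (enorm_add_le _ _).trans (add_le_add ih h1)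
      _ = _ := by push_cast; ring

theorem meanOscillation_ball_le_of_le {x : X} {r : ℝ} (hr : 0 < r)
    (hf : IntegrableOn f (ball x r) μ) (a : E) {K : ℝ≥0∞} (h : ∀ z ∈ ball x r, ‖f z - a‖ₑ ≤ K) :
    meanOscillation μ f (ball x r) ≤ 2 * K :=
  meanOscillation_le_of_le measurableSet_ball (hμ.ball_ne_zero x hr) (hμ.ball_ne_top x hr) hf a h

end IsBallRegular

/-! ### Oscillation of compactly supported functions. -/

section CompactSupport

variable {X E : Type*} [PseudoMetricSpace X] [ProperSpace X] [MeasurableSpace X] [BorelSpace X]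
  {μ : Measure X} [IsLocallyFiniteMeasure μ] {c : ℝ} {Q : ℕ}
  [NormedAddCommGroup E] [NormedSpace ℝ E] [CompleteSpace E] {f : X → E}

theorem MeasureTheory.LocallyIntegrable.integrableOn_ball (hf : LocallyIntegrable f μ) (x : X)
    (r : ℝ) : IntegrableOn f (ball x r) μ :=
  (hf.integrableOn_isCompact (isCompact_closedBall x r)).mono_set ball_subset_closedBall

theorem IsBallRegular.exists_meanOscillation_le_of_lt (hμ : IsBallRegular μ c Q)
    (hf : Continuous f) (hfs : HasCompactSupport f) {ε : ℝ≥0∞} (hε : 0 < ε) :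
    ∃ δ : ℝ, 0 < δ ∧ ∀ x r, 0 < r → r < δ → meanOscillation μ f (ball x r) ≤ ε := by
  have hu := hfs.uniformContinuous_of_continuous hf
  rw [EMetric.uniformContinuous_iff] at hu
  obtain ⟨δ, hδ, H⟩ := hu (ε / 2) (ENNReal.half_pos hε.ne')
  obtain ⟨δ', hδ', h1⟩ := ENNReal.lt_iff_exists_real_btwn.1 hδ
  refine ⟨δ', ENNReal.ofReal_pos.1 h1.1, fun x r hr hrδ => ?_⟩
  have h2 := hμ.meanOscillation_ball_le_of_le (x := x) hr
    ((hf.integrable_of_hasCompactSupport hfs).integrableOn) (f x) (K := ε / 2) fun z hz => by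
    rw [← edist_eq_enorm_sub]
    refine (H ?_).le
    rw [edist_dist]
    refine lt_of_le_of_lt (ENNReal.ofReal_le_ofReal ?_) h1.2
    exact (mem_ball.1 hz).le.trans hrδ.le
  rwa [ENNReal.mul_div_cancel (by simp) (by simp)] at h2

/-- The oscillation is at most twice the `L¹` norm over the volume, and volumes tend to infinity
because `Q ≥ 1`. -/
theorem IsBallRegular.exists_meanOscillation_le_of_ge (hμ : IsBallRegular μ c Q) (hQ : 1 ≤ Q)
    (hf : Integrable f μ) {ε : ℝ≥0∞} (hε : 0 < ε) :
    ∃ R : ℝ, 0 < R ∧ ∀ x r, R ≤ r → meanOscillation μ f (ball x r) ≤ ε := by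
  set I := 2 * ∫⁻ x, ‖f x‖ₑ ∂μ with hI
  have hIt : I ≠ ⊤ := ENNReal.mul_ne_top (by simp) hf.hasFiniteIntegral.ne
  have hlim : Tendsto (fun r : ℝ => I / ENNReal.ofReal (c * r ^ Q)) atTop (𝓝 0) := by
    have h1 : Tendsto (fun r : ℝ => ENNReal.ofReal (c * r ^ Q)) atTop (𝓝 ⊤) :=
      ENNReal.tendsto_ofReal_atTop.comp
        ((tendsto_pow_atTop (by omega)).const_mul_atTop hμ.pos)
    simpa using ENNReal.Tendsto.const_div h1 (Or.inr hIt)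
  obtain ⟨R, hR⟩ := eventually_atTop.1
    ((hlim.eventually (gt_mem_nhds hε)).and (eventually_gt_atTop 0))
  refine ⟨max R 1, by positivity, fun x r hr => ?_⟩
  have hRr := hR r ((le_max_left _ _).trans hr)
  refine ((meanOscillation_le_two_mul measurableSet_ball (hμ.ball_ne_zero x hRr.2)
    (hμ.ball_ne_top x hRr.2) hf.integrableOn 0).trans ?_).trans hRr.1.le
  simp only [sub_zero]
  rw [setLAverage_eq, hμ.measure_ball x r hRr.2, hI, mul_div_assoc]
  exact mul_le_mul_right (ENNReal.div_le_div_right (setLIntegral_le_lintegral _ _) _) _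

theorem IsBallRegular.exists_meanOscillation_eq_zero (hμ : IsBallRegular μ c Q)
    (hfs : HasCompactSupport f) (o : X) :
    ∃ R : ℝ, 0 < R ∧ ∀ x r, 0 < r → ball x r ⊆ (ball o R)ᶜ →
      meanOscillation μ f (ball x r) = 0 := by
  obtain ⟨R, hR⟩ := hfs.isBounded.subset_ball o
  refine ⟨max R 1, by positivity, fun x r hr hB => ?_⟩
  rw [meanOscillation_congr measurableSet_ball (g := fun _ => (0 : E))]
  · exact meanOscillation_const measurableSet_ball (hμ.ball_ne_zero x hr) (hμ.ball_ne_top x hr) 0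
  · intro z hz
    by_contra h
    exact hB hz (ball_subset_ball (le_max_left _ _) (hR (subset_tsupport _ h)))

end CompactSupport

end RegularMeasure

/-! ### Cutting off at infinity. -/

section Cutoff

open Metric

variable {X E : Type*} [MetricSpace X]

/-- The function equal to `1` on the ball of radius `R` around `o`, vanishing outside the ball of
radius `2 * R` and linear in the distance to `o` in between. -/
noncomputable def radialCutoff (o : X) (R : ℝ) (x : X) : ℝ := max 0 (min 1 (2 - dist x o / R))

theorem continuous_radialCutoff (o : X) (R : ℝ) : Continuous (radialCutoff o R) := by
  unfold radialCutoff; fun_prop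

theorem radialCutoff_nonneg (o : X) (R : ℝ) (x : X) : 0 ≤ radialCutoff o R x := le_max_left _ _

theorem radialCutoff_le_one (o : X) (R : ℝ) (x : X) : radialCutoff o R x ≤ 1 :=
  max_le zero_le_one (min_le_left _ _)

theorem radialCutoff_eq_one {o x : X} {R : ℝ} (hR : 0 < R) (h : dist x o ≤ R) :
    radialCutoff o R x = 1 := by
  have : dist x o / R ≤ 1 := (div_le_one hR).2 h
  rw [radialCutoff, min_eq_left (by linarith), max_eq_right zero_le_one]

theorem radialCutoff_eq_zero {o x : X} {R : ℝ} (hR : 0 < R) (h : 2 * R ≤ dist x o) :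
    radialCutoff o R x = 0 := by
  have : 2 ≤ dist x o / R := (le_div_iff₀ hR).2 h
  rw [radialCutoff, max_eq_left ((min_le_right _ _).trans (by linarith))]

theorem abs_radialCutoff_sub_le {o : X} {R : ℝ} (hR : 0 < R) (x y : X) :
    |radialCutoff o R x - radialCutoff o R y| ≤ dist x y / R := by
  refine (abs_max_sub_max_le_max _ _ _ _).trans (max_le (by simp; positivity) ?_)
  refine (abs_min_sub_min_le_max _ _ _ _).trans (max_le (by simp; positivity) ?_)
  rw [show 2 - dist x o / R - (2 - dist y o / R) = (dist y o - dist x o) / R by ring, abs_div,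
    abs_of_pos hR, abs_sub_comm]
  exact div_le_div_of_nonneg_right (abs_dist_sub_le x y o) hR.le

theorem hasCompactSupport_radialCutoff [ProperSpace X] (o : X) {R : ℝ} (hR : 0 < R) :
    HasCompactSupport (radialCutoff o R) :=
  HasCompactSupport.intro (isCompact_closedBall o (2 * R)) fun x hx =>
    radialCutoff_eq_zero hR (by simpa using (not_le.1 hx).le)

variable [NormedAddCommGroup E] [NormedSpace ℝ E] [MeasurableSpace X] {μ : Measure X} {c : ℝ}
  {Q : ℕ}

/-- `f` minus its mean value `m` over the ball of radius `2 * R`, cut off to this ball. -/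
noncomputable def cutoffSub (μ : Measure X) (f : X → E) (o : X) (R : ℝ) (x : X) : E :=
  radialCutoff o R x • (f x - ⨍ y in ball o (2 * R), f y ∂μ)

variable {f : X → E} {o : X} {R : ℝ}

theorem hasCompactSupport_cutoffSub [ProperSpace X] (hR : 0 < R) :
    HasCompactSupport (cutoffSub μ f o R) :=
  (hasCompactSupport_radialCutoff o hR).smul_right

variable [ProperSpace X] [BorelSpace X] [IsLocallyFiniteMeasure μ]

theorem integrable_cutoffSub (hf : LocallyIntegrable f μ) (hR : 0 < R) :
    Integrable (cutoffSub μ f o R) μ :=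
  (hf.sub (locallyIntegrable_const _)).integrable_smul_left_of_hasCompactSupport
    (continuous_radialCutoff o R) (hasCompactSupport_radialCutoff o hR)

variable [CompleteSpace E] {ε : ℝ≥0∞}

/-- The cut-off function is dominated by `‖f - m‖` on `ball o (2 * R)`, whose volume is at most `2 ^
Q` times that of `ball x r`. -/
theorem IsBallRegular.meanOscillation_sub_cutoffSub_le_of_ge (hμ : IsBallRegular μ c Q)
    (hf : LocallyIntegrable f μ) (hR : 0 < R) {x : X} {r : ℝ} (hr : R ≤ r)
    (h1 : meanOscillation μ f (ball x r) ≤ ε)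
    (h2 : meanOscillation μ f (ball o (2 * R)) ≤ ε) :
    meanOscillation μ (f - cutoffSub μ f o R) (ball x r) ≤ ε + 2 * (2 ^ Q * ε) := by
  have hr0 := hR.trans_le hr
  have hR2 : 0 < 2 * R := by positivity
  refine (meanOscillation_sub_le measurableSet_ball (hf.integrableOn_ball x r)
    (integrable_cutoffSub hf hR).integrableOn).trans (add_le_add h1 ?_)
  refine (meanOscillation_le_two_mul measurableSet_ball (hμ.ball_ne_zero x hr0)
    (hμ.ball_ne_top x hr0) (integrable_cutoffSub hf hR).integrableOn 0).trans
    (mul_le_mul_right ?_ _)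
  simp only [sub_zero]
  set m := ⨍ y in ball o (2 * R), f y ∂μ with hm
  have hpt : ∀ z, ‖cutoffSub μ f o R z‖ₑ ≤
      (ball o (2 * R)).indicator (fun z => ‖f z - m‖ₑ) z := fun z => by
    by_cases hz : z ∈ ball o (2 * R)
    · rw [Set.indicator_of_mem hz, cutoffSub, enorm_smul]
      refine mul_le_of_le_one_left' ?_
      rw [Real.enorm_of_nonneg (radialCutoff_nonneg _ _ _), ENNReal.ofReal_le_one]
      exact radialCutoff_le_one _ _ _
    · rw [cutoffSub, radialCutoff_eq_zero hR (by simpa using hz)]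
      simp
  have hA0 := hμ.ball_ne_zero o hR2
  have hAt := hμ.ball_ne_top o hR2
  calc ⨍⁻ z in ball x r, ‖cutoffSub μ f o R z‖ₑ ∂μ
      ≤ (∫⁻ z in ball o (2 * R), ‖f z - m‖ₑ ∂μ) / μ (ball x r) := by
        rw [setLAverage_eq, ← lintegral_indicator (s := ball o (2 * R)) measurableSet_ball]
        exact ENNReal.div_le_div_right ((setLIntegral_le_lintegral _ _).trans
          (lintegral_mono hpt)) _
    _ = μ (ball o (2 * R)) / μ (ball x r) * meanOscillation μ f (ball o (2 * R)) := by
        rw [meanOscillation, setLAverage_eq, div_eq_mul_inv, div_eq_mul_inv, div_eq_mul_inv]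
        calc _ = (∫⁻ z in ball o (2 * R), ‖f z - m‖ₑ ∂μ) * (μ (ball x r))⁻¹ *
              (μ (ball o (2 * R)) * (μ (ball o (2 * R)))⁻¹) := by
              rw [ENNReal.mul_inv_cancel hA0 hAt, mul_one]
          _ = _ := by ring
    _ ≤ _ := by
        rw [hμ.ball_div_ball x o hr0 hR2]
        refine mul_le_mul' (pow_le_pow_left' ?_ _) h2
        rw [← ENNReal.ofReal_ofNat 2]
        exact ENNReal.ofReal_le_ofReal ((div_le_iff₀ hr0).2 (by nlinarith))

/-- Doubling from `r` to scale `R` takes `N` steps, and the factor `r / R` absorbs them since `N r ≤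
2 ^ N r ≤ 2 R`. At scale `R`, both balls are compared with `ball x (8 * R)`, which contains `ball o
(2 * R)` because `dist x o < 3 * R`. -/
theorem IsBallRegular.enorm_setAverage_sub_le_of_lt (hμ : IsBallRegular μ c Q)
    (hf : LocallyIntegrable f μ) {x : X} {r : ℝ} (hr : 0 < r) (hrR : r < R)
    (hx : dist x o < 3 * R) (h : ∀ ρ, r ≤ ρ → meanOscillation μ f (ball x ρ) ≤ ε) :
    ENNReal.ofReal (r / R) * ‖⨍ y in ball x r, f y ∂μ - ⨍ y in ball o (2 * R), f y ∂μ‖ₑ ≤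
      4 * (8 ^ Q * ε) := by
  have hR : 0 < R := hr.trans hrR
  obtain ⟨n, hn1, hn2⟩ := exists_nat_pow_near ((one_le_div hr).2 hrR.le) one_lt_two
  rw [le_div_iff₀ hr] at hn1
  rw [div_lt_iff₀ hr] at hn2
  have hN : 2 ^ (n + 1) * r ≤ 2 * R := by rw [pow_succ]; linarith
  generalize n + 1 = N at *
  have hNr : 0 < 2 ^ N * r := by positivity
  have h8 : 0 < 8 * R := by positivity
  have hD := h (8 * R) (by linarith)
  have e1 := hμ.enorm_setAverage_sub_doubling_le hr (fun ρ => hf.integrableOn_ball x ρ) h N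
  have ratio : ∀ s, R ≤ s → ENNReal.ofReal (8 * R / s) ^ Q * meanOscillation μ f (ball x (8 * R)) ≤
      8 ^ Q * ε := fun s hs => by
    refine mul_le_mul' (pow_le_pow_left' ?_ _) hD
    rw [← ENNReal.ofReal_ofNat 8]
    exact ENNReal.ofReal_le_ofReal ((div_le_iff₀ (by linarith)).2 (by linarith))
  have e2 := (hμ.enorm_setAverage_sub_setAverage_le hNr h8
    (ball_subset_ball (by linarith)) (hf.integrableOn_ball x (8 * R))).trans (ratio _ hn2.le)
  have e3 := (hμ.enorm_setAverage_sub_setAverage_le (x := o) (y := x) (r := 2 * R) (by positivity)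
    h8 (ball_subset_ball' (by rw [dist_comm]; linarith))
    (hf.integrableOn_ball x (8 * R))).trans (ratio _ (by linarith))
  set m := ⨍ y in ball o (2 * R), f y ∂μ
  have e4 : ‖⨍ y in ball x r, f y ∂μ - m‖ₑ ≤ N * (2 ^ Q * ε) + (8 ^ Q * ε + 8 ^ Q * ε) := by
    rw [show ⨍ y in ball x r, f y ∂μ - m =
      (⨍ y in ball x r, f y ∂μ - ⨍ y in ball x (2 ^ N * r), f y ∂μ) +
      ((⨍ y in ball x (2 ^ N * r), f y ∂μ - ⨍ y in ball x (8 * R), f y ∂μ) -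
        (m - ⨍ y in ball x (8 * R), f y ∂μ)) by abel]
    exact (enorm_add_le _ _).trans (add_le_add e1 (enorm_sub_le.trans (add_le_add e2 e3)))
  have k1 : ENNReal.ofReal (r / R) ≤ 1 := ENNReal.ofReal_le_one.2 ((div_le_one hR).2 hrR.le)
  have k2 : ENNReal.ofReal (r / R) * N ≤ 2 := by
    rw [← ENNReal.ofReal_natCast, ← ENNReal.ofReal_mul (by positivity), ← ENNReal.ofReal_ofNat 2]
    refine ENNReal.ofReal_le_ofReal ?_
    rw [div_mul_eq_mul_div, div_le_iff₀ hR]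
    have : (N : ℝ) ≤ 2 ^ N := by exact_mod_cast Nat.lt_two_pow_self.le
    nlinarith
  have k3 : (2 : ℝ≥0∞) ^ Q ≤ 8 ^ Q := pow_le_pow_left' (by norm_num) _
  calc _ ≤ ENNReal.ofReal (r / R) * (N * (2 ^ Q * ε) + (8 ^ Q * ε + 8 ^ Q * ε)) :=
        mul_le_mul_right e4 _
    _ = ENNReal.ofReal (r / R) * N * (2 ^ Q * ε) +
        ENNReal.ofReal (r / R) * (8 ^ Q * ε + 8 ^ Q * ε) := by ring
    _ ≤ 2 * (8 ^ Q * ε) + 1 * (8 ^ Q * ε + 8 ^ Q * ε) := by gcongr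
    _ = _ := by ring

/-- With `p` the mean over the small ball, `f - g` is compared with `m + (1 - χ x) (p - m)`, its
value for `f = p` and `χ` frozen at the centre. The errors are `(1 - χ) (f - p)` and `(χ x - χ) (p -
m)`; the latter is controlled by the Lipschitz bound `r / R` and the logarithmic drift. -/
theorem IsBallRegular.meanOscillation_sub_cutoffSub_le_of_lt (hμ : IsBallRegular μ c Q)
    (hf : LocallyIntegrable f μ) {x : X} {r : ℝ} (hr : 0 < r) (hrR : r < R)
    (hx : dist x o < 3 * R) (h : ∀ ρ, r ≤ ρ → meanOscillation μ f (ball x ρ) ≤ ε) :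
    meanOscillation μ (f - cutoffSub μ f o R) (ball x r) ≤ 2 * (ε + 4 * (8 ^ Q * ε)) := by
  have hR : 0 < R := hr.trans hrR
  have key := hμ.enorm_setAverage_sub_le_of_lt hf hr hrR hx h
  set m := ⨍ y in ball o (2 * R), f y ∂μ with hm
  set p := ⨍ y in ball x r, f y ∂μ with hp
  set χ := radialCutoff o R
  refine (meanOscillation_le_two_mul measurableSet_ball (hμ.ball_ne_zero x hr)
    (hμ.ball_ne_top x hr) ((hf.integrableOn_ball x r).sub
      (integrable_cutoffSub hf hR).integrableOn)
    (m + (1 - χ x) • (p - m))).trans (mul_le_mul_right ?_ _)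
  have hmeas : AEMeasurable (fun z => ‖f z - p‖ₑ) (μ.restrict (ball x r)) :=
    ((hf.integrableOn_ball x r).aestronglyMeasurable.sub aestronglyMeasurable_const).enorm
  calc _ ≤ ⨍⁻ z in ball x r, (‖f z - p‖ₑ + 4 * (8 ^ Q * ε)) ∂μ := by
        refine setLAverage_mono' measurableSet_ball fun z hz => ?_
        have : (f - cutoffSub μ f o R) z - (m + (1 - χ x) • (p - m)) =
            (1 - χ z) • (f z - p) + (χ x - χ z) • (p - m) := by
          simp only [Pi.sub_apply, cutoffSub]
          module
        rw [this]
        refine (enorm_add_le _ _).trans (add_le_add ?_ (le_trans ?_ key))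
        · rw [enorm_smul]
          refine mul_le_of_le_one_left' ?_
          have h0 := radialCutoff_nonneg o R z
          have h1 := radialCutoff_le_one o R z
          rw [Real.enorm_of_nonneg (sub_nonneg.2 h1), ENNReal.ofReal_le_one]
          exact sub_le_self _ h0
        · rw [enorm_smul]
          refine mul_le_mul_left ?_ _
          rw [← ofReal_norm, Real.norm_eq_abs]
          refine ENNReal.ofReal_le_ofReal ((abs_radialCutoff_sub_le hR x z).trans ?_)
          exact div_le_div_of_nonneg_right (mem_ball'.1 hz).le hR.le
    _ ≤ _ := by
        rw [setLAverage_add_left hmeas]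
        exact add_le_add (h r le_rfl) (setLAverage_const_le _ _)

/-- The cutoff starts at `3 * R`, so that a ball reaching beyond `3 * R` is controlled together with
all larger concentric ones: either the radius is at least `R`, or the ball misses `ball o R`. A ball
not reaching beyond `3 * R` sees only the constant `m`, so nothing is needed of `f` there. -/
theorem IsBallRegular.meanOscillation_sub_cutoffSub_le (hμ : IsBallRegular μ c Q)
    (hf : LocallyIntegrable f μ) (hR : 0 < R)
    (h1 : ∀ x r, R ≤ r → meanOscillation μ f (ball x r) ≤ ε)
    (h2 : ∀ x r, 0 < r → ball x r ⊆ (ball o R)ᶜ → meanOscillation μ f (ball x r) ≤ ε)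
    (x : X) {r : ℝ} (hr : 0 < r) :
    meanOscillation μ (f - cutoffSub μ f o (3 * R)) (ball x r) ≤ 10 * (8 ^ Q * ε) := by
  have hR3 : 0 < 3 * R := by positivity
  have q1 : ε ≤ 8 ^ Q * ε := le_mul_of_one_le_left' (one_le_pow₀ (by norm_num))
  have q2 : (2 : ℝ≥0∞) ^ Q * ε ≤ 8 ^ Q * ε := by gcongr; norm_num
  rcases le_or_gt (3 * R) r with hrR | hrR
  · refine (hμ.meanOscillation_sub_cutoffSub_le_of_ge hf hR3 hrR (h1 x r (by linarith))
      (h1 o _ (by linarith))).trans ?_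
    calc ε + 2 * (2 ^ Q * ε) ≤ 8 ^ Q * ε + 2 * (8 ^ Q * ε) := by gcongr
      _ = 3 * (8 ^ Q * ε) := by ring
      _ ≤ _ := by gcongr; norm_num
  by_cases hfar : ∃ y ∈ ball x r, 3 * R < dist y o
  · obtain ⟨y, hy, hyo⟩ := hfar
    have h : ∀ ρ, r ≤ ρ → meanOscillation μ f (ball x ρ) ≤ ε := fun ρ hρ => by
      rcases le_or_gt R ρ with hRρ | hRρ
      · exact h1 x ρ hRρ
      · refine h2 x ρ (hr.trans_le hρ) fun z hz hzo => ?_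
        have := dist_triangle4 y x z o
        rw [mem_ball] at hy hz hzo
        rw [dist_comm x z] at this
        linarith
    rcases lt_or_ge (dist x o) (3 * (3 * R)) with hx | hx
    · refine (hμ.meanOscillation_sub_cutoffSub_le_of_lt hf hr hrR hx h).trans ?_
      calc 2 * (ε + 4 * (8 ^ Q * ε)) ≤ 2 * (8 ^ Q * ε + 4 * (8 ^ Q * ε)) := by gcongr
        _ = _ := by ring
    -- The centre is at distance at least `9 * R` and `r < 3 * R`, so the ball avoids the support of
    -- the cutoff, which ends at `6 * R`.
    · rw [meanOscillation_congr measurableSet_ball (g := f)]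
      · refine (h r le_rfl).trans (q1.trans (le_mul_of_one_le_left' (by norm_num)))
      · intro z hz
        have := dist_triangle x z o
        rw [mem_ball'] at hz
        rw [Pi.sub_apply, cutoffSub, radialCutoff_eq_zero hR3 (by linarith), zero_smul, sub_zero]
  · push Not at hfar
    rw [meanOscillation_congr measurableSet_ball
      (g := fun _ => ⨍ y in ball o (2 * (3 * R)), f y ∂μ), meanOscillation_const measurableSet_ball
      (hμ.ball_ne_zero x hr) (hμ.ball_ne_top x hr)]
    · exact zero_le
    · intro z hz
      rw [Pi.sub_apply, cutoffSub, radialCutoff_eq_one hR3 (hfar z hz), one_smul, sub_sub_cancel]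

end Cutoff

/-! ### Smoothing by averages over balls of fixed radius. -/

section BallAverage

open Metric

variable {X E : Type*} [MetricSpace X] [MeasurableSpace X] [BorelSpace X] {μ : Measure X}
  [NormedAddCommGroup E] [NormedSpace ℝ E] {c : ℝ} {Q : ℕ} {g : X → E} {t : ℝ} {S : ℝ≥0∞}

/-- The volume `c s ^ Q` is continuous in `s`, so the closed ball is no larger than the open one. -/
theorem IsBallRegular.measure_sphere (hμ : IsBallRegular μ c Q) (x : X) (ht : 0 < t) :
    μ (sphere x t) = 0 := by
  have h1 : μ (closedBall x t) ≤ μ (ball x t) := by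
    have hlim : Tendsto (fun s : ℝ => ENNReal.ofReal (c * s ^ Q)) (𝓝[>] t)
        (𝓝 (ENNReal.ofReal (c * t ^ Q))) :=
      ((ENNReal.continuous_ofReal.comp (by fun_prop)).tendsto t).mono_left nhdsWithin_le_nhds
    rw [hμ.measure_ball x t ht]
    refine ge_of_tendsto hlim ?_
    filter_upwards [self_mem_nhdsWithin] with s hs
    rw [← hμ.measure_ball x s (ht.trans hs)]
    exact measure_mono (closedBall_subset_ball hs)
  rw [← closedBall_sdiff_ball, measure_sdiff ball_subset_closedBall
    measurableSet_ball.nullMeasurableSet (hμ.ball_ne_top x ht)]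
  exact tsub_eq_zero_of_le h1

/-- Dominated convergence: for `y` off the null sphere, membership in the ball is locally constant
in the centre. -/
theorem IsBallRegular.continuous_setAverage_ball (hμ : IsBallRegular μ c Q) (ht : 0 < t)
    (hg : Integrable g μ) : Continuous fun x => ⨍ y in ball x t, g y ∂μ := by
  have h1 : ∀ x, ⨍ y in ball x t, g y ∂μ =
      (ENNReal.ofReal (c * t ^ Q)).toReal⁻¹ • ∫ y, (ball x t).indicator g y ∂μ := fun x => by
    rw [setAverage_eq, measureReal_def, hμ.measure_ball x t ht, integral_indicator
      measurableSet_ball]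
  simp only [h1]
  refine Continuous.const_smul ?_ _
  rw [continuous_iff_continuousAt]
  intro x
  refine continuousAt_of_dominated (bound := fun y => ‖g y‖)
    (Eventually.of_forall fun z => hg.aestronglyMeasurable.indicator measurableSet_ball)
    (Eventually.of_forall fun z => Eventually.of_forall fun y => norm_indicator_le_norm_self _ _)
    hg.norm ?_
  have h2 : ∀ᵐ y ∂μ, y ∉ sphere x t := measure_eq_zero_iff_ae_notMem.1 (hμ.measure_sphere x ht)
  filter_upwards [h2] with y hy
  rcases lt_or_gt_of_ne (show dist y x ≠ t from hy) with h | h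
  · refine (continuousAt_const (y := g y)).congr ?_
    filter_upwards [(continuous_const.dist continuous_id).continuousAt.eventually_lt
      continuousAt_const h] with z hz
    rw [Set.indicator_of_mem (by exact hz)]
  · refine (continuousAt_const (y := (0 : E))).congr ?_
    filter_upwards [continuousAt_const.eventually_lt
      (continuous_const.dist continuous_id).continuousAt h] with z hz
    rw [Set.indicator_of_notMem]
    exact fun hz' => lt_asymm hz (by exact hz')

theorem hasCompactSupport_setAverage_ball [ProperSpace X] (hg : HasCompactSupport g) :
    HasCompactSupport fun x => ⨍ y in ball x t, g y ∂μ := by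
  refine HasCompactSupport.intro (K := cthickening t (tsupport g))
    (hg.isCompact.cthickening) fun x hx => ?_
  rw [setAverage_eq, setIntegral_eq_zero_of_forall_eq_zero, smul_zero]
  intro y hy
  by_contra h
  exact hx (mem_cthickening_of_dist_le x y t _ (subset_tsupport _ h) (mem_ball'.1 hy).le)

/-- A covering argument replaced by Tonelli: `u` is integrated over pairs `(y, z)` with `dist y z <
t`, `y` in `ball x r` and `z` in `ball x (2 * r)`. The doubled radius leaves room for every `ball y
t`, and its volume gives `2 ^ Q`. -/
theorem IsBallRegular.setLAverage_le_of_forall_setLAverage_le [ProperSpace X]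
    [IsLocallyFiniteMeasure μ] (hμ : IsBallRegular μ c Q) (ht : 0 < t) {u : X → ℝ≥0∞}
    (hu : AEMeasurable u μ) {K : ℝ≥0∞} (hK : ∀ z, ⨍⁻ y in ball z t, u y ∂μ ≤ K) {x : X} {r : ℝ}
    (htr : t ≤ r) : ⨍⁻ y in ball x r, u y ∂μ ≤ 2 ^ Q * K := by
  have hr : 0 < r := ht.trans_le htr
  have hr2 : 0 < 2 * r := by positivity
  set v := ENNReal.ofReal (c * t ^ Q)
  have hv : ∀ z, μ (ball z t) = v := fun z => hμ.measure_ball z t ht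
  have hv0 : v ≠ 0 := hv x ▸ hμ.ball_ne_zero x ht
  have hvt : v ≠ ⊤ := hv x ▸ hμ.ball_ne_top x ht
  have hK' : ∀ z, ∫⁻ y in ball z t, u y ∂μ ≤ K * v := fun z => by
    have := hK z
    rw [setLAverage_eq, hv] at this
    exact (ENNReal.div_le_iff hv0 hvt).1 this
  have hmeas : AEMeasurable (Function.uncurry fun y z => (ball z t).indicator u y)
      ((μ.restrict (ball x r)).prod (μ.restrict (ball x (2 * r)))) := by
    have hD : MeasurableSet {p : X × X | dist p.1 p.2 < t} :=
      (isOpen_lt (by fun_prop) (by fun_prop)).measurableSet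
    have h1 : AEMeasurable (fun p : X × X => u p.1)
        ((μ.restrict (ball x r)).prod (μ.restrict (ball x (2 * r)))) :=
      hu.restrict.comp_quasiMeasurePreserving Measure.quasiMeasurePreserving_fst
    exact h1.indicator hD
  have key : v * ∫⁻ y in ball x r, u y ∂μ ≤ K * v * μ (ball x (2 * r)) := by
    calc v * ∫⁻ y in ball x r, u y ∂μ = ∫⁻ y in ball x r, v * u y ∂μ :=
          (lintegral_const_mul' _ _ hvt).symm
      _ ≤ ∫⁻ y in ball x r, ∫⁻ z in ball x (2 * r), (ball z t).indicator u y ∂μ ∂μ := by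
          refine setLIntegral_mono' measurableSet_ball fun y hy => ?_
          have hsub : ball y t ⊆ ball x (2 * r) :=
            ball_subset_ball' (by linarith [mem_ball.1 hy])
          calc v * u y = ∫⁻ _ in ball y t, u y ∂μ := by
                rw [setLIntegral_const, hv, mul_comm]
            _ ≤ ∫⁻ z in ball y t, (ball z t).indicator u y ∂μ :=
                setLIntegral_mono' measurableSet_ball fun z hz => by
                  rw [Set.indicator_of_mem (mem_ball_comm.1 hz)]
            _ ≤ _ := lintegral_mono_set hsub
      _ = ∫⁻ z in ball x (2 * r), ∫⁻ y in ball x r, (ball z t).indicator u y ∂μ ∂μ :=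
          lintegral_lintegral_swap hmeas
      _ ≤ ∫⁻ _ in ball x (2 * r), K * v ∂μ := by
          refine lintegral_mono fun z => ?_
          refine (setLIntegral_le_lintegral _ _).trans ?_
          rw [lintegral_indicator measurableSet_ball]
          exact hK' z
      _ = _ := setLIntegral_const _ _
  rw [setLAverage_eq, ENNReal.div_le_iff (hμ.ball_ne_zero x hr) (hμ.ball_ne_top x hr)]
  have hratio : μ (ball x (2 * r)) = 2 ^ Q * μ (ball x r) := by
    have := hμ.ball_div_ball x x hr hr2
    rw [mul_div_assoc, div_self hr.ne', mul_one, ENNReal.ofReal_ofNat] at this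
    rw [← this, ENNReal.div_mul_cancel (hμ.ball_ne_zero x hr) (hμ.ball_ne_top x hr)]
  rw [hratio] at key
  rw [← ENNReal.mul_le_mul_iff_right hv0 hvt]
  refine key.trans_eq ?_
  ring

variable [CompleteSpace E] [ProperSpace X] [IsLocallyFiniteMeasure μ]

theorem IsBallRegular.enorm_setAverage_ball_sub_le (hμ : IsBallRegular μ c Q) (ht : 0 < t)
    (hg : Integrable g μ) {x y : X} (hy : dist y x ≤ t)
    (hS : meanOscillation μ g (ball x (2 * t)) ≤ S) :
    ‖⨍ z in ball y t, g z ∂μ - ⨍ z in ball x (2 * t), g z ∂μ‖ₑ ≤ 2 ^ Q * S := by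
  have := hμ.enorm_setAverage_sub_setAverage_le (x := y) (y := x) ht
    (show 0 < 2 * t by positivity) (ball_subset_ball' (by linarith)) hg.integrableOn
  rw [mul_div_assoc, div_self ht.ne', mul_one, ENNReal.ofReal_ofNat] at this
  exact this.trans (mul_le_mul_right hS _)

/-- For `r ≤ t` both functions oscillate little: the averages stay close to one mean over `ball x (2
* t)`. For `r ≥ t`, `g - a` is small in mean on each ball of radius `t`, hence on every larger ball.
-/
theorem IsBallRegular.meanOscillation_sub_setAverage_ball_le (hμ : IsBallRegular μ c Q)
    (ht : 0 < t) (hg : Integrable g μ)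
    (hS : ∀ x r, 0 < r → r ≤ 2 * t → meanOscillation μ g (ball x r) ≤ S) (x : X) {r : ℝ}
    (hr : 0 < r) :
    meanOscillation μ (g - fun y => ⨍ z in ball y t, g z ∂μ) (ball x r) ≤ 6 * (4 ^ Q * S) := by
  set a := fun y => ⨍ z in ball y t, g z ∂μ with ha
  have hac : Continuous a := hμ.continuous_setAverage_ball ht hg
  have ha_int : ∀ x r, IntegrableOn a (ball x r) μ := fun x r =>
    hac.locallyIntegrable.integrableOn_ball x r
  have hS2 : ∀ x, meanOscillation μ g (ball x (2 * t)) ≤ S := fun x =>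
    hS x _ (by positivity) le_rfl
  have q1 : S ≤ 4 ^ Q * S := le_mul_of_one_le_left' (one_le_pow₀ (by norm_num))
  have q2 : (2 : ℝ≥0∞) ^ Q * S ≤ 4 ^ Q * S := by gcongr; norm_num
  have q3 : (2 : ℝ≥0∞) ^ Q * (2 ^ Q * S) = 4 ^ Q * S := by
    rw [← mul_assoc, ← mul_pow]; norm_num
  rcases le_total r t with hrt | hrt
  · calc _ ≤ meanOscillation μ g (ball x r) + meanOscillation μ a (ball x r) :=
          meanOscillation_sub_le measurableSet_ball hg.integrableOn (ha_int x r)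
      _ ≤ S + 2 * (2 ^ Q * S) := by
          refine add_le_add (hS x r hr (by linarith)) ?_
          exact hμ.meanOscillation_ball_le_of_le hr (ha_int x r) _ fun y hy =>
            hμ.enorm_setAverage_ball_sub_le ht hg ((mem_ball.1 hy).le.trans hrt) (hS2 x)
      _ ≤ 4 ^ Q * S + 2 * (4 ^ Q * S) := by gcongr
      _ = 3 * (4 ^ Q * S) := by ring
      _ ≤ _ := by gcongr; norm_num
  · have hloc : ∀ z, ⨍⁻ y in ball z t, ‖(g - a) y‖ₑ ∂μ ≤ 3 * (2 ^ Q * S) := fun z => by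
      set p := ⨍ w in ball z (2 * t), g w ∂μ
      have hm : AEMeasurable (fun y => ‖g y - a z‖ₑ) (μ.restrict (ball z t)) :=
        (hg.integrableOn.aestronglyMeasurable.sub aestronglyMeasurable_const).enorm
      calc _ ≤ ⨍⁻ y in ball z t, (‖g y - a z‖ₑ + (2 ^ Q * S + 2 ^ Q * S)) ∂μ := by
            refine setLAverage_mono' measurableSet_ball fun y hy => ?_
            have : (g - a) y = (g y - a z) + ((a z - p) - (a y - p)) := by
              rw [Pi.sub_apply]; abel
            rw [this]
            refine (enorm_add_le _ _).trans (add_le_add le_rfl (enorm_sub_le.trans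
              (add_le_add ?_ ?_)))
            · exact hμ.enorm_setAverage_ball_sub_le ht hg (by simpa using ht.le) (hS2 z)
            · exact hμ.enorm_setAverage_ball_sub_le ht hg (mem_ball.1 hy).le (hS2 z)
        _ ≤ S + (2 ^ Q * S + 2 ^ Q * S) := by
            rw [setLAverage_add_left hm]
            exact add_le_add (hS z t ht (by linarith)) (setLAverage_const_le _ _)
        _ ≤ 2 ^ Q * S + (2 ^ Q * S + 2 ^ Q * S) := by
            gcongr
            exact le_mul_of_one_le_left' (one_le_pow₀ (by norm_num))
        _ = _ := by ring
    have hu : AEMeasurable (fun y => ‖(g - a) y‖ₑ) μ :=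
      (hg.aestronglyMeasurable.sub hac.aestronglyMeasurable).enorm
    refine (meanOscillation_le_two_mul measurableSet_ball (hμ.ball_ne_zero x hr)
      (hμ.ball_ne_top x hr) (hg.integrableOn.sub (ha_int x r)) 0).trans ?_
    simp only [sub_zero]
    refine (mul_le_mul_right (hμ.setLAverage_le_of_forall_setLAverage_le ht hu hloc hrt) _).trans_eq
      ?_
    rw [← q3]
    ring

/-- A locally integrable function whose mean oscillation is uniformly small on small balls, on
large balls and on balls far away can be approximated by continuous compactly supported functions
in the BMO seminorm. -/
theorem IsBallRegular.exists_continuous_hasCompactSupport_meanOscillation_sub_le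
    (hμ : IsBallRegular μ c Q) {f : X → E} (hf : LocallyIntegrable f μ) {o : X} {ε : ℝ≥0∞}
    {δ R : ℝ} (hδ : 0 < δ) (hR : 0 < R)
    (h1 : ∀ x r, 0 < r → r < δ → meanOscillation μ f (ball x r) ≤ ε)
    (h2 : ∀ x r, R ≤ r → meanOscillation μ f (ball x r) ≤ ε)
    (h3 : ∀ x r, 0 < r → ball x r ⊆ (ball o R)ᶜ → meanOscillation μ f (ball x r) ≤ ε) :
    ∃ a : X → E, Continuous a ∧ HasCompactSupport a ∧
      ∀ x r, 0 < r → meanOscillation μ (f - a) (ball x r) ≤ 76 * (32 ^ Q * ε) := by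
  set g := cutoffSub μ f o (3 * R)
  have hgi : Integrable g μ := integrable_cutoffSub hf (by positivity)
  have hgs : HasCompactSupport g := hasCompactSupport_cutoffSub (by positivity)
  have hfg : ∀ x r, 0 < r → meanOscillation μ (f - g) (ball x r) ≤ 10 * (8 ^ Q * ε) :=
    fun x r hr => hμ.meanOscillation_sub_cutoffSub_le hf hR h2 h3 x hr
  -- Balls of radius up to `2 * t` then stay below the threshold `δ`.
  set t := δ / 3 with ht
  have ht0 : 0 < t := by positivity
  have hgS : ∀ x r, 0 < r → r ≤ 2 * t → meanOscillation μ g (ball x r) ≤ 11 * (8 ^ Q * ε) :=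
    fun x r hr hrt => by
    have : g = f - (f - g) := by abel
    rw [this]
    calc _ ≤ meanOscillation μ f (ball x r) + meanOscillation μ (f - g) (ball x r) :=
          meanOscillation_sub_le measurableSet_ball (hf.integrableOn_ball x r)
            ((hf.integrableOn_ball x r).sub hgi.integrableOn)
      _ ≤ 8 ^ Q * ε + 10 * (8 ^ Q * ε) := add_le_add ((h1 x r hr (by linarith)).trans
          (le_mul_of_one_le_left' (one_le_pow₀ (by norm_num)))) (hfg x r hr)
      _ = _ := by ring
  have hac := hμ.continuous_setAverage_ball ht0 hgi
  refine ⟨fun y => ⨍ z in ball y t, g z ∂μ, hac,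
    hasCompactSupport_setAverage_ball hgs, fun x r hr => ?_⟩
  set a := fun y => ⨍ z in ball y t, g z ∂μ
  have e1 : f - a = (f - g) + (g - a) := by abel
  have q : (4 : ℝ≥0∞) ^ Q * (8 ^ Q * ε) = 32 ^ Q * ε := by
    rw [← mul_assoc, ← mul_pow]; norm_num
  have q' : (8 : ℝ≥0∞) ^ Q * ε ≤ 32 ^ Q * ε := by gcongr; norm_num
  rw [e1]
  -- The constants are `76 = 10 + 6 * 11` and `32 = 4 * 8`.
  calc _ ≤ meanOscillation μ (f - g) (ball x r) + meanOscillation μ (g - a) (ball x r) :=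
        meanOscillation_add_le measurableSet_ball ((hf.integrableOn_ball x r).sub hgi.integrableOn)
          (hgi.integrableOn.sub (hac.locallyIntegrable.integrableOn_ball x r))
    _ ≤ 10 * (8 ^ Q * ε) + 6 * (4 ^ Q * (11 * (8 ^ Q * ε))) :=
        add_le_add (hfg x r hr) (hμ.meanOscillation_sub_setAverage_ball_le ht0 hgi hgS x hr)
    _ = 10 * (8 ^ Q * ε) + 66 * (4 ^ Q * (8 ^ Q * ε)) := by ring
    _ ≤ 10 * (32 ^ Q * ε) + 66 * (32 ^ Q * ε) := by rw [q]; gcongr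
    _ = _ := by ring

end BallAverage

/-! ### Transfer to Carnot–Carathéodory balls. -/

namespace AdaptedBasis

variable {𝔤 : Type*} [LieRing 𝔤] [LieAlgebra ℝ 𝔤] {S : Stratification 𝔤} {ι : Type*} [Fintype ι]
  (b : AdaptedBasis S ι) {𝕜 : Type*} [RCLike 𝕜]

theorem meanOsc_ccBall (f : (ι → ℝ) → 𝕜) (x : ι → ℝ) (r : ℝ) :
    meanOsc f (ccBall b x r) = meanOscillation (X := CarnotSpace b) b.lebesgue f
      (Metric.ball (x : CarnotSpace b) r) :=
  (congrArg (meanOsc f) (b.ball_carnotSpace x r)).symm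

theorem ball_subset_compl_ball_iff {x y : CarnotSpace b} {r R : ℝ} :
    Metric.ball x r ⊆ (Metric.ball y R)ᶜ ↔
      ccBall b (x : ι → ℝ) r ⊆ (ccBall b (y : ι → ℝ) R)ᶜ := by
  rw [ball_carnotSpace, ball_carnotSpace]
  rfl

theorem exists_isBallRegular : ∃ c : ℝ,
    IsBallRegular b.lebesgue c (∑ i, b.layer i) :=
  let ⟨c, hc, h⟩ := b.exists_lebesgue_ball
  ⟨c, hc, h⟩

instance : IsLocallyFiniteMeasure b.lebesgue :=
  inferInstanceAs (IsLocallyFiniteMeasure (volume : Measure (ι → ℝ)))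

variable {b} {f g h : (ι → ℝ) → 𝕜}

theorem integrableOn_ccBall (hf : LocallyIntegrable f volume) (x : ι → ℝ) (r : ℝ) :
    IntegrableOn f (ccBall b x r) volume := by
  have h := LocallyIntegrable.integrableOn_ball (X := CarnotSpace b) (μ := b.lebesgue) hf x r
  exact Eq.subst (motive := fun s => IntegrableOn f s volume) (b.ball_carnotSpace x r) h

theorem measurableSet_ccBall (x : ι → ℝ) (r : ℝ) : MeasurableSet (ccBall b x r) := by
  have h := measurableSet_ball (α := CarnotSpace b) (x := x) (ε := r)
  exact Eq.subst (motive := fun s : Set (ι → ℝ) => MeasurableSet s) (b.ball_carnotSpace x r) h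

theorem meanOsc_ccBall_add_le (hf : LocallyIntegrable f volume) (hg : LocallyIntegrable g volume)
    (x : ι → ℝ) (r : ℝ) : meanOsc (f + g) (ccBall b x r) ≤
      meanOsc f (ccBall b x r) + meanOsc g (ccBall b x r) :=
  meanOscillation_add_le (measurableSet_ccBall x r) (integrableOn_ccBall hf x r)
    (integrableOn_ccBall hg x r)

theorem bmoNorm_le {K : ℝ≥0∞} (hf : ∀ x r, 0 < r → meanOsc f (ccBall b x r) ≤ K) :
    bmoNorm b f ≤ K :=
  iSup_le fun x => iSup_le fun r => iSup_le fun hr => hf x r hr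

theorem meanOsc_le_bmoNorm (f : (ι → ℝ) → 𝕜) (x : ι → ℝ) {r : ℝ} (hr : 0 < r) :
    meanOsc f (ccBall b x r) ≤ bmoNorm b f :=
  le_iSup_of_le x (le_iSup_of_le r (le_iSup_of_le hr le_rfl))

theorem meanOsc_ccBall_le_of_norm_le (hf : LocallyIntegrable f volume) {K : ℝ}
    (hK : ∀ x, ‖f x‖ ≤ K) (x : ι → ℝ) {r : ℝ} (hr : 0 < r) :
    meanOsc f (ccBall b x r) ≤ 2 * ENNReal.ofReal K := by
  obtain ⟨c, hc⟩ := b.exists_isBallRegular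
  rw [meanOsc_ccBall]
  refine hc.meanOscillation_ball_le_of_le hr
    (LocallyIntegrable.integrableOn_ball (X := CarnotSpace b) (μ := b.lebesgue) hf x r) 0 fun z _ => ?_
  rw [sub_zero, ← ofReal_norm]
  exact ENNReal.ofReal_le_ofReal (hK z)

theorem meanOsc_ccBall_of_isEmpty [IsEmpty ι] (f : (ι → ℝ) → 𝕜) (x : ι → ℝ) {r : ℝ} (hr : 0 < r) :
    meanOsc f (ccBall b x r) = 0 := by
  obtain ⟨c, hc⟩ := b.exists_isBallRegular
  rw [meanOsc_ccBall, show f = fun _ => f 0 from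
    funext fun y => congrArg f (Subsingleton.elim _ _)]
  exact meanOscillation_const (X := CarnotSpace b) measurableSet_ball (hc.ball_ne_zero x hr)
    (hc.ball_ne_top x hr) _

theorem exists_meanOsc_le_of_lt (hf : Continuous f) (hfs : HasCompactSupport f) {ε : ℝ≥0∞}
    (hε : 0 < ε) :
    ∃ δ : ℝ, 0 < δ ∧ ∀ x r, 0 < r → r < δ → meanOsc f (ccBall b x r) ≤ ε := by
  obtain ⟨c, hc⟩ := b.exists_isBallRegular
  simp only [meanOsc_ccBall]
  exact IsBallRegular.exists_meanOscillation_le_of_lt (X := CarnotSpace b) hc (f := f) hf hfs hε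

theorem exists_meanOsc_le_of_ge (hf : Continuous f) (hfs : HasCompactSupport f) {ε : ℝ≥0∞}
    (hε : 0 < ε) :
    ∃ R : ℝ, 0 < R ∧ ∀ x r, R ≤ r → meanOsc f (ccBall b x r) ≤ ε := by
  -- In the trivial group `Q = 0` and volumes do not grow, but every function on the single point is
  -- constant.
  rcases isEmpty_or_nonempty ι with hι | ⟨⟨i⟩⟩
  · exact ⟨1, one_pos, fun x r hr => by
      rw [meanOsc_ccBall_of_isEmpty f x (one_pos.trans_le hr)]; exact zero_le⟩
  obtain ⟨c, hc⟩ := b.exists_isBallRegular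
  simp only [meanOsc_ccBall]
  exact IsBallRegular.exists_meanOscillation_le_of_ge (X := CarnotSpace b) hc (f := f)
    ((b.one_le_layer i).trans (Finset.single_le_sum (f := b.layer) (fun _ _ => Nat.zero_le _)
      (Finset.mem_univ i))) (hf.integrable_of_hasCompactSupport hfs (μ := volume)) hε

theorem exists_meanOsc_eq_zero (hfs : HasCompactSupport f) :
    ∃ R : ℝ, 0 < R ∧ ∀ x r, 0 < r → ccBall b x r ⊆ (ccBall b 0 R)ᶜ →
      meanOsc f (ccBall b x r) = 0 := by
  obtain ⟨c, hc⟩ := b.exists_isBallRegular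
  obtain ⟨R, hR, H⟩ := IsBallRegular.exists_meanOscillation_eq_zero (X := CarnotSpace b) hc
    (f := f) hfs (0 : ι → ℝ)
  refine ⟨R, hR, fun x r hr h => ?_⟩
  rw [meanOsc_ccBall]
  exact H x r hr (b.ball_subset_compl_ball_iff.2 h)

theorem exists_bmoNorm_sub_le (hf : LocallyIntegrable f volume) :
    ∃ K : ℝ≥0∞, K ≠ ⊤ ∧ ∀ (ε : ℝ≥0∞) (δ R : ℝ), 0 < δ → 0 < R →
      (∀ x r, 0 < r → r < δ → meanOsc f (ccBall b x r) ≤ ε) →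
      (∀ x r, R ≤ r → meanOsc f (ccBall b x r) ≤ ε) →
      (∀ x r, 0 < r → ccBall b x r ⊆ (ccBall b 0 R)ᶜ → meanOsc f (ccBall b x r) ≤ ε) →
      ∃ a : (ι → ℝ) → 𝕜, Continuous a ∧ HasCompactSupport a ∧ bmoNorm b (f - a) ≤ K * ε := by
  obtain ⟨c, hc⟩ := b.exists_isBallRegular
  refine ⟨76 * 32 ^ ∑ i, b.layer i, by finiteness, fun ε δ R hδ hR h1 h2 h3 => ?_⟩
  simp only [meanOsc_ccBall] at h1 h2 h3
  obtain ⟨a, ha, has, H⟩ := 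
    IsBallRegular.exists_continuous_hasCompactSupport_meanOscillation_sub_le
    (X := CarnotSpace b) hc (f := f) (o := (0 : ι → ℝ)) hf hδ hR h1 h2
    fun x r hr hB =>
      h3 x r hr (b.ball_subset_compl_ball_iff.1 hB)
  refine ⟨a, ha, has, bmoNorm_le fun x r hr => ?_⟩
  rw [meanOsc_ccBall, mul_assoc]
  exact H x r hr

/-- A uniform approximation that does not enlarge the support suffices, the BMO seminorm being at
most twice the sup norm. -/
theorem exists_smooth_bmoNorm_sub_le (hf : Continuous f) (hfs : HasCompactSupport f) {ε : ℝ≥0∞}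
    (hε : 0 < ε) : ∃ h : (ι → ℝ) → 𝕜, ContDiff ℝ ∞ h ∧ HasCompactSupport h ∧
      bmoNorm b (f - h) ≤ ε := by
  obtain ⟨η, hη, hηε⟩ := ENNReal.lt_iff_exists_real_btwn.1 (ENNReal.half_pos hε.ne')
  obtain ⟨h, hh, hd, hs⟩ := hf.exists_contDiff_approx ⊤ (ε := fun _ => η) continuous_const
    fun _ => ENNReal.ofReal_pos.1 hηε.1
  refine ⟨h, hh, hfs.mono hs, bmoNorm_le fun x r hr => ?_⟩
  refine (meanOsc_ccBall_le_of_norm_le (hf.sub hh.continuous).locallyIntegrable (K := η)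
    (fun y => ?_) x hr).trans ?_
  · rw [Pi.sub_apply, ← dist_eq_norm, dist_comm]
    exact (hd y).le
  · calc 2 * ENNReal.ofReal η ≤ 2 * (ε / 2) := by gcongr; exact hηε.2.le
      _ = ε := ENNReal.mul_div_cancel (by simp) (by simp)

end AdaptedBasis

/-! ### The characterisation of VMO. -/

theorem mainTheorem3 {𝔤 : Type*} [LieRing 𝔤] [LieAlgebra ℝ 𝔤] {ι : Type*} [Fintype ι]
    {S : Stratification 𝔤} (b : AdaptedBasis S ι) {𝕜 : Type*} [RCLike 𝕜]
    (f : (ι → ℝ) → 𝕜) (hf : MemBMO b f) :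
    MemVMO b f ↔
      Tendsto (fun a : ℝ => ⨆ g : ι → ℝ, meanOsc f (ccBall b g a)) (𝓝[>] 0) (𝓝 0) ∧
      Tendsto (fun a : ℝ => ⨆ g : ι → ℝ, meanOsc f (ccBall b g a)) atTop (𝓝 0) ∧
      Tendsto (fun r : ℝ => ⨆ (g : ι → ℝ) (a : ℝ) (_ : 0 < a)
        (_ : ccBall b g a ⊆ (ccBall b 0 r)ᶜ), meanOsc f (ccBall b g a)) atTop (𝓝 0) := by
  constructor
  · rintro ⟨-, hv⟩
    have key : ∀ ε : ℝ≥0∞, 0 < ε → ∃ h : (ι → ℝ) → 𝕜, Continuous h ∧ HasCompactSupport h ∧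
        ∀ x r, 0 < r → meanOsc h (ccBall b x r) ≤ ε / 2 → meanOsc f (ccBall b x r) ≤ ε := by
      intro ε hε
      obtain ⟨h, hh, hs, hb⟩ := hv (ε / 2) (ENNReal.half_pos hε.ne')
      refine ⟨h, hh.continuous, hs, fun x r hr hx => ?_⟩
      have h1 := AdaptedBasis.meanOsc_ccBall_add_le (b := b)
        (hf.1.sub hh.continuous.locallyIntegrable) hh.continuous.locallyIntegrable x r
      rw [sub_add_cancel] at h1
      refine h1.trans ((add_le_add ((AdaptedBasis.meanOsc_le_bmoNorm _ x hr).trans hb.le)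
        hx).trans_eq (ENNReal.add_halves ε))
    refine ⟨?_, ?_, ?_⟩ <;> rw [ENNReal.tendsto_nhds_zero] <;> intro ε hε <;>
      obtain ⟨h, hh, hs, H⟩ := key ε hε
    · obtain ⟨δ, hδ, hd⟩ := AdaptedBasis.exists_meanOsc_le_of_lt (b := b) hh hs
        (ENNReal.half_pos hε.ne')
      filter_upwards [Ioo_mem_nhdsGT hδ] with r hr
      exact iSup_le fun x => H x r hr.1 (hd x r hr.1 hr.2)
    · obtain ⟨R, hR, hd⟩ := AdaptedBasis.exists_meanOsc_le_of_ge (b := b) hh hs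
        (ENNReal.half_pos hε.ne')
      filter_upwards [eventually_ge_atTop R] with r hr
      exact iSup_le fun x => H x r (hR.trans_le hr) (hd x r hr)
    · obtain ⟨R, hR, hd⟩ := AdaptedBasis.exists_meanOsc_eq_zero (b := b) hs
      filter_upwards [eventually_ge_atTop R] with r hr
      refine iSup_le fun x => iSup_le fun a => iSup_le fun ha => iSup_le fun hB =>
        H x a ha ((hd x a ha (hB.trans (Set.compl_subset_compl.2 ?_))).trans_le zero_le)
      exact fun y hy => lt_of_lt_of_le hy (ENNReal.ofReal_le_ofReal hr)
  · rintro ⟨h1, h2, h3⟩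
    refine ⟨hf, fun ε₀ hε₀ => ?_⟩
    -- The estimates below are non-strict, while VMO asks for a strict bound.
    obtain ⟨ε, hε, hεε₀⟩ := exists_between hε₀
    obtain ⟨K, hK, HK⟩ := AdaptedBasis.exists_bmoNorm_sub_le (b := b) hf.1
    have hε2 := ENNReal.half_pos hε.ne'
    have hη : 0 < ε / 2 / K := ENNReal.div_pos hε2.ne' hK
    rw [ENNReal.tendsto_nhds_zero] at h1 h2 h3
    obtain ⟨δ, hδ, H1⟩ := mem_nhdsGT_iff_exists_Ioo_subset.1 (h1 _ hη)
    obtain ⟨R₂, H2⟩ := eventually_atTop.1 (h2 _ hη)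
    obtain ⟨R₃, H3⟩ := eventually_atTop.1 (h3 _ hη)
    -- One radius serves the large and the far balls; the `1` keeps it positive. The level `ε / 2 /
    -- K` makes the error at most `ε / 2`.
    obtain ⟨a, ha, has, hab⟩ := HK _ δ (max (max R₂ R₃) 1) hδ (by positivity)
      (fun x r hr hrδ => (le_iSup (fun x => meanOsc f (ccBall b x r)) x).trans (H1 ⟨hr, hrδ⟩))
      (fun x r hr => (le_iSup (fun x => meanOsc f (ccBall b x r)) x).trans
        (H2 r (((le_max_left _ _).trans (le_max_left _ _)).trans hr)))
      (fun x r hr hB => le_trans (le_iSup₂_of_le x r (by rw [iSup_pos hr, iSup_pos hB]))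
        (H3 (max (max R₂ R₃) 1) ((le_max_right _ _).trans (le_max_left _ _))))
    obtain ⟨h, hh, hs, hah⟩ := AdaptedBasis.exists_smooth_bmoNorm_sub_le (b := b) ha has hε2
    refine ⟨h, hh, hs, lt_of_le_of_lt (AdaptedBasis.bmoNorm_le fun x r hr => ?_) hεε₀⟩
    rw [← sub_add_sub_cancel f a h]
    calc _ ≤ meanOsc (f - a) (ccBall b x r) + meanOsc (a - h) (ccBall b x r) :=
          AdaptedBasis.meanOsc_ccBall_add_le (hf.1.sub ha.locallyIntegrable)
            (ha.locallyIntegrable.sub hh.continuous.locallyIntegrable) x r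
      _ ≤ ε / 2 + ε / 2 := add_le_add
          (((AdaptedBasis.meanOsc_le_bmoNorm _ x hr).trans hab).trans ENNReal.mul_div_le)
          ((AdaptedBasis.meanOsc_le_bmoNorm _ x hr).trans hah)
      _ = ε := ENNReal.add_halves ε
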